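/- Let $d\ge 2$, let $p,q\in[1,\infty]$ satisfy $1/p+1/q<2/d$, with $q<\infty$ if $d=2$, and put $$p^*=\frac{p}{p-1},\qquad \rho=\frac{2qd}{q(d-2)+d},\qquad \nu=2-\frac{2p^*}{\rho}\in(1,2)$$ (limiting values for infinite exponents: $p^*=1$ if $p=\infty$, and $\rho=2d/(d-2)$ if $q=\infty$). Let $a:\mathbb R^d\to\mathbb R^{d\times d}$ be a measurable symmetric matrix field and $\lambda,\Lambda:\mathbb R^d\to[0,\infty)$ measurable with $\lambda(x)|\xi|^2\le\langle a(x)\xi,\xi\rangle\le\Lambda(x)|\xi|^2$ for almost every $x$ and all $\xi\in\mathbb R^d$. For a set $B$ of finite positive measure write $\|f\|_{p,B}=(|B|^{-1}\int_B|f|^p\,dx)^{1/p}$ (the essential supremum of $|f|$ over $B$ if $p=\infty$); set $\lambda^{-1}=\infty$ where $\lambda=0$, and assume $$\limsup_{R\to\infty}\|\Lambda\|_{p,B(0,R)}<\infty,\qquad \limsup_{R\to\infty}\|\lambda^{-1}\|_{q,B(0,R)}<\infty .$$ Let $\mathcal E(u,v)=\sum_{i,j}\int_{\mathbb R^d}a_{ij}\,\partial_iu\,\partial_jv\,dx$,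 first for $u,v\in C_0^\infty(\mathbb R^d)$ and then on its closure. Write $(u,v)_\Lambda=\int uv\,\Lambda\,dx$. For $G\subset\mathbb R^d$ open let $\mathcal F^\Lambda_G$ be the closure of $C_0^\infty(G)$ in $L^2(\Lambda dx)$ with respect to $\mathcal E+(\cdot,\cdot)_\Lambda$, and $\mathcal F^\Lambda=\mathcal F^\Lambda_{\mathbb R^d}$. For an open interval $I$, a map $u:I\to\mathcal F^\Lambda$ is supercaloric in $I\times G$ if $t\mapsto(u(t,\cdot),\phi)_\Lambda$ is differentiable on $I$ for every $\phi\in L^2(G,\Lambda dx)$ and $\frac{d}{dt}(u(t,\cdot),\phi)_\Lambda+\mathcal E(u(t,\cdot),\phi)\ge 0$ for all $t\in I$ and all non-negative $\phi\in\mathcal F^\Lambda_G$. It is positive if, for every $t\in I$, $u(t,\cdot)>0$ almost everywhere in $G$. For $\tau>0$, $x\in\mathbb R^d$, $s\in\mathbb R$, $r>0$, $\sigma\in(0,1]$ let $B=B(x,r)$, $Q=(s-\tau r^2,s)\times B$, $Q'_\sigma=(s-\tau r^2,\,s-(1-\sigma)\tau r^2)\times B(x,\sigma r)$, and put $$\|u\|_{\alpha,Q'_\sigma,\Lambda}=\Bigl(\frac1{|Q'_\sigma|}\iint_{Q'_\sigma}|u(t,z)|^\alpha\Lambda(z)\,dz\,dt\Bigr)^{1/\alpha}\in[0,\infty],\qquad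 C_S^{B,\Lambda}=\|\lambda^{-1}\|_{q,B}\,\|\Lambda\|_{p,B}^{2p^*/\rho}.$$ **Theorem.** Let $0<\alpha_0<\nu$. There is a constant $C_5>0$ depending only on $d,p,q,\alpha_0$ such that for all $a,\lambda,\Lambda$ as above, all $\tau>0$, $x\in\mathbb R^d$, $s\in\mathbb R$, $r>0$, all $1/2\le\sigma'<\sigma\le1$, every positive supercaloric function $u$ in $Q$, and all $0<\alpha<\alpha_0\nu^{-1}$, $$\|u\|_{\alpha_0,Q'_{\sigma'},\Lambda}\le\Biggl\{C_5\,\tau(1+\tau^{-1})^{\frac{\nu}{\nu-1}}\Bigl[\frac{1\vee C_S^{B,\Lambda}}{(\sigma-\sigma')^2}\Bigr]^{\frac{\nu}{\nu-1}}\Biggr\}^{(1+\nu)(1/\alpha-1/\alpha_0)}\|u\|_{\alpha,Q'_\sigma,\Lambda}.$$ -/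

import Mathlib

open MeasureTheory Filter Topology Set
open scoped ENNReal

noncomputable section

namespace CaloricModel

/-- The space `ℝ^d` with its Euclidean norm and Lebesgue measure. -/
abbrev Rd (d : ℕ) : Type := EuclideanSpace ℝ (Fin d)

/-- The Hölder conjugate `p* = p / (p - 1) = 1 / (1 - 1/p)` of `p ∈ (1, ∞]`; it is `1` for
`p = ∞`. -/
def pstar (p : ℝ≥0∞) : ℝ := 1 / (1 - (p⁻¹).toReal)

/-- `ρ = 2 q d / (q (d - 2) + d) = 2 d / ((d - 2) + d / q)`, the Sobolev conjugate of
`2 q / (q + 1)`; for `q = ∞` and `d ≥ 3` it is `2 d / (d - 2)`. -/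
def rho (q : ℝ≥0∞) (d : ℕ) : ℝ := 2 * (d : ℝ) / (((d : ℝ) - 2) + (d : ℝ) * (q⁻¹).toReal)

/-- The exponent `ν = 2 - 2 p* / ρ`. -/
def nu (d : ℕ) (p q : ℝ≥0∞) : ℝ := 2 - 2 * pstar p / rho q d

/-- The averaged norm `‖f‖_{p,B} = (|B|⁻¹ ∫_B f^p dx)^{1/p}` of a `[0, ∞]`-valued function, which
is the essential supremum over `B` when `p = ∞`. -/
def avgNorm {d : ℕ} (p : ℝ≥0∞) (B : Set (Rd d)) (f : Rd d → ℝ≥0∞) : ℝ≥0∞ :=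
  eLpNorm f p ((volume B)⁻¹ • volume.restrict B)

/-- The weight `Λ`, as a function with values in `[0, ∞]`. -/
def weight {d : ℕ} (Lam : Rd d → ℝ) : Rd d → ℝ≥0∞ := fun x => ENNReal.ofReal (Lam x)

/-- The function `λ⁻¹` with values in `[0, ∞]`; it is `∞` where `λ = 0`. -/
def invWeight {d : ℕ} (lam : Rd d → ℝ) : Rd d → ℝ≥0∞ := fun x => (ENNReal.ofReal (lam x))⁻¹

/-- The measure `θ dx`. -/
def weightedMeasure {d : ℕ} (θ : Rd d → ℝ) : Measure (Rd d) :=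
  volume.withDensity (weight θ)

/-- The bilinear form `∑ i j, A i j * v i * w j` of a matrix. -/
def bilin {d : ℕ} (A : Matrix (Fin d) (Fin d) ℝ) (v w : Rd d) : ℝ :=
  ∑ i, ∑ j, A i j * v i * w j

/-- The standing assumptions on the coefficients: `a` is a measurable symmetric matrix field with
`λ |ξ|² ≤ ⟨a ξ, ξ⟩ ≤ Λ |ξ|²`, and the averages of `Λ^p` and `λ^{-q}` over the balls `B(0, r)` stay
bounded as `r → ∞` (for an infinite exponent: the essential suprema stay bounded). -/
structure IsCoefficient {d : ℕ} (p q : ℝ≥0∞) (a : Rd d → Matrix (Fin d) (Fin d) ℝ)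
    (lam Lam : Rd d → ℝ) : Prop where
  measurable_a : ∀ i j, Measurable fun x => a x i j
  measurable_lam : Measurable lam
  measurable_Lam : Measurable Lam
  symm : ∀ x, (a x).IsSymm
  lam_nonneg : ∀ x, 0 ≤ lam x
  Lam_nonneg : ∀ x, 0 ≤ Lam x
  ellipticity : ∀ᵐ x, ∀ ξ : Rd d,
    lam x * ‖ξ‖ ^ 2 ≤ bilin (a x) ξ ξ ∧ bilin (a x) ξ ξ ≤ Lam x * ‖ξ‖ ^ 2
  limsup_Lam : limsup (fun r : ℝ => avgNorm p (Metric.ball 0 r) (weight Lam)) atTop < ∞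
  limsup_lam : limsup (fun r : ℝ => avgNorm q (Metric.ball 0 r) (invWeight lam)) atTop < ∞

/-- `f ∈ C_0^∞(G)`. -/
def IsTestFunction {d : ℕ} (G : Set (Rd d)) (f : Rd d → ℝ) : Prop :=
  ContDiff ℝ ((⊤ : ℕ∞) : WithTop ℕ∞) f ∧ HasCompactSupport f ∧ tsupport f ⊆ G

/-- `u ∈ 𝓕_G^θ`, and `g` is its gradient: the pair `(u, g)` belongs to the closure of the pairs
`(f, ∇f)`, `f ∈ C_0^∞(G)`, in `L²(θ dx) × L²(a dx)`, where the second space consists of the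
vector fields with `∫ ⟨a g, g⟩ dx < ∞`. So `u` is the limit in `L²(θ dx)` of an `𝓔`-Cauchy
sequence in `C_0^∞(G)`, and the closed form is `𝓔(u, v) = ∫ ⟨a ∇u, ∇v⟩ dx`. The space `𝓕^θ` is the
case `G = ℝ^d`. -/
def HasFormGradient {d : ℕ} (a : Rd d → Matrix (Fin d) (Fin d) ℝ) (θ : Rd d → ℝ)
    (G : Set (Rd d)) (u : Rd d → ℝ) (g : Rd d → Rd d) : Prop :=
  MemLp u 2 (weightedMeasure θ) ∧ AEStronglyMeasurable g volume ∧
    ∃ f : ℕ → Rd d → ℝ, (∀ n, IsTestFunction G (f n)) ∧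
      Tendsto (fun n => eLpNorm (fun x => f n x - u x) 2 (weightedMeasure θ)) atTop (𝓝 0) ∧
      Tendsto (fun n => ∫⁻ x, ENNReal.ofReal
        (bilin (a x) (gradient (f n) x - g x) (gradient (f n) x - g x))) atTop (𝓝 0)

/-- The form `𝓔(u, v) = ∑ i j, ∫ a_ij ∂_i u ∂_j v dx`, as a function of the gradients. -/
def energy {d : ℕ} (a : Rd d → Matrix (Fin d) (Fin d) ℝ) (g h : Rd d → Rd d) : ℝ :=
  ∫ x, bilin (a x) (g x) (h x)

/-- The inner product `(u, v)_θ` of `L²(G, θ dx)`. -/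
def innerG {d : ℕ} (θ : Rd d → ℝ) (G : Set (Rd d)) (u v : Rd d → ℝ) : ℝ :=
  ∫ x in G, u x * v x ∂(weightedMeasure θ)

/-- `u : I → 𝓕^θ` is supercaloric in `I × G` (`I` and `G` open): `t ↦ (u_t, φ)_θ` is differentiable
on `I` for all `φ ∈ L²(G, θ dx)`, and `d/dt (u_t, φ)_θ + 𝓔(u_t, φ) ≥ 0` on `I` for all non-negative
`φ ∈ 𝓕_G^θ`. -/
def IsSupercaloric {d : ℕ} (a : Rd d → Matrix (Fin d) (Fin d) ℝ) (θ : Rd d → ℝ)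
    (I : Set ℝ) (G : Set (Rd d)) (u : ℝ → Rd d → ℝ) : Prop :=
  (∀ φ : Rd d → ℝ, MemLp φ 2 ((weightedMeasure θ).restrict G) →
    ∀ t ∈ I, DifferentiableAt ℝ (fun t' => innerG θ G (u t') φ) t) ∧
  ∀ t ∈ I, ∃ g : Rd d → Rd d, HasFormGradient a θ univ (u t) g ∧
    ∀ (φ : Rd d → ℝ) (h : Rd d → Rd d), HasFormGradient a θ G φ h → (∀ᵐ x, 0 ≤ φ x) →
      0 ≤ deriv (fun t' => innerG θ G (u t') φ) t + energy a g h

/-- The averaged space-time norm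
`‖u‖_{α, I × B, Λ} = (|I|⁻¹ |B|⁻¹ ∫_I ∫_B |u(t,x)|^α Λ(x) dx dt)^{1/α}`. -/
def avgNormQ {d : ℕ} (Lam : Rd d → ℝ) (α : ℝ) (I : Set ℝ) (B : Set (Rd d))
    (u : ℝ → Rd d → ℝ) : ℝ≥0∞ :=
  ((volume I)⁻¹ * (volume B)⁻¹ *
    ∫⁻ t in I, ∫⁻ x in B, ‖u t x‖ₑ ^ α * weight Lam x) ^ (1 / α)

/-- The norm `‖u‖_{α, Q'_σ, Λ}` over
`Q'_σ = (s - τ r², s - (1 - σ) τ r²) × B(x, σ r)`. -/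
def normQ' {d : ℕ} (Lam : Rd d → ℝ) (α τ : ℝ) (x : Rd d) (s r σ : ℝ)
    (u : ℝ → Rd d → ℝ) : ℝ≥0∞ :=
  avgNormQ Lam α (Ioo (s - τ * r ^ 2) (s - (1 - σ) * τ * r ^ 2)) (Metric.ball x (σ * r)) u

/-- The Sobolev constant `C_S^{B,Λ} = ‖λ⁻¹‖_{q,B} ‖Λ‖_{p,B}^{2 p* / ρ}`. -/
def sobolevConst {d : ℕ} (p q : ℝ≥0∞) (lam Lam : Rd d → ℝ) (B : Set (Rd d)) : ℝ≥0∞ :=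
  avgNorm q B (invWeight lam) * avgNorm p B (weight Lam) ^ (2 * pstar p / rho q d)

end CaloricModel

end

noncomputable section

namespace CaloricModel

/-! ### Exponents -/

/-! The proof is a Moser iteration over small positive powers, in a degenerate weighted setting.
Test the supercaloric inequality with `η² β (u + ε)^(β - 1)`, where `η` is a spatial cut-off and `0
< β < 1`. Since the power is concave, the energy enters with the good sign: the time derivative of
the mass `∫ η² (u + ε)^β Λ`, plus a multiple of `sup |∇η|²` times the mass on a larger set,
dominates the energy of `η (u + ε)^(β/2)` (`IsSupercaloric.caccioppoli`). Earlier masses are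
therefore controlled by later ones, so the cylinders shrink only at their late end. Averaging over
late times bounds both the supremum of the mass and the time integral of the energy
(`mass_le_and_integral_le`).

The gain of integrability comes from a weighted Sobolev inequality: Gagliardo–Nirenberg–Sobolev at
the exponent `2q/(q+1)`, followed by Hölder against `λ⁻¹` in `L^q` and `Λ` in `L^p`, bounds the norm
in `L^(2/(2-ν))(Λ dx)` by the energy. Interpolation with `L²(Λ dx)` gives `∫ w^(2ν) Λ ≤ C (∫ w²
Λ)^(ν-1) 𝓔(w, w)`, and the hypothesis on `1/p + 1/q` is what makes `ν > 1`. Integrated in time, this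
is one step from exponent `β` to any `γ ∈ [β, νβ]`, with a scale-invariant constant (`moser_step`).
Since `βν ≤ α₀ < ν`, the exponent `β` stays away from `1` and the constants do not blow up.

The steps run through `α, να, ν²α, …` until the exponent lies in `[α₀/ν², α₀/ν)`, then to `α₀/ν` and
to `α₀`. The powers `1/β - 1/γ` of the base telescope to `1/α - 1/α₀`, while the numerical factors
and the losses from halving the gap `σ - σ'` form a geometric series comparable to the same quantity
(`moser_iteration`). The base is at least `1`, so enlarging the exponent by the factor `1 + ν` is
harmless.

Two points need care. Positivity of `u` holds only in the ball, so the powers are replaced by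
globally smooth functions with bounded derivatives (`regPow`). Differentiability in time is only
weak, so the chain rule for the mass goes through the uniform boundedness principle
(`hasDerivAt_integral_comp`). -/

theorem toReal_inv_add_toReal_inv_lt {d : ℕ} (hd : 2 ≤ d) {p q : ℝ≥0∞}
    (hpq : p⁻¹ + q⁻¹ < 2 / (d : ℝ≥0∞)) : (p⁻¹).toReal + (q⁻¹).toReal < 2 / (d : ℝ) := by
  have hd0 : (d : ℝ≥0∞) ≠ 0 := by simp; omega
  have hfin : (2 : ℝ≥0∞) / d ≠ ∞ := ENNReal.div_ne_top (by simp) hd0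
  have h1 : p⁻¹ ≠ ∞ := ne_top_of_lt (lt_of_le_of_lt le_self_add hpq)
  have h2 : q⁻¹ ≠ ∞ := ne_top_of_lt (lt_of_le_of_lt le_add_self hpq)
  rw [← ENNReal.toReal_add h1 h2]
  have := (ENNReal.toReal_lt_toReal (ENNReal.add_ne_top.2 ⟨h1, h2⟩) hfin).2 hpq
  simpa [ENNReal.toReal_div] using this

/-- The exponent `2 p* / ρ = 2 - ν`. -/
def codim (d : ℕ) (p q : ℝ≥0∞) : ℝ := 2 * pstar p / rho q d

theorem nu_eq (d : ℕ) (p q : ℝ≥0∞) : nu d p q = 2 - codim d p q := rfl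

structure Admissible (d : ℕ) (p q : ℝ≥0∞) : Prop where
  two_le : 2 ≤ d
  one_le_p : 1 ≤ p
  one_le_q : 1 ≤ q
  lt : p⁻¹ + q⁻¹ < 2 / (d : ℝ≥0∞)
  ne_top : d = 2 → q ≠ ∞

namespace Admissible

variable {d : ℕ} {p q : ℝ≥0∞}

theorem toReal_lt (h : Admissible d p q) : (p⁻¹).toReal + (q⁻¹).toReal < 2 / (d : ℝ) :=
  toReal_inv_add_toReal_inv_lt h.two_le h.lt

theorem two_le_cast (h : Admissible d p q) : (2 : ℝ) ≤ d := by exact_mod_cast h.two_le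

theorem two_div_le (h : Admissible d p q) : 2 / (d : ℝ) ≤ 1 := by
  have := h.two_le_cast
  rw [div_le_one (by linarith)]; exact this

theorem p_lt_one (h : Admissible d p q) : (p⁻¹).toReal < 1 := by
  have := h.toReal_lt; have := h.two_div_le
  have : 0 ≤ (q⁻¹).toReal := ENNReal.toReal_nonneg
  linarith

theorem q_lt_one (h : Admissible d p q) : (q⁻¹).toReal < 1 := by
  have := h.toReal_lt; have := h.two_div_le
  have : 0 ≤ (p⁻¹).toReal := ENNReal.toReal_nonneg
  linarith

theorem denom_pos (h : Admissible d p q) : 0 < ((d : ℝ) - 2) + (d : ℝ) * (q⁻¹).toReal := by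
  have h2 := h.two_le_cast
  have hq0 : 0 ≤ (q⁻¹).toReal := ENNReal.toReal_nonneg
  rcases eq_or_ne d 2 with hd | hd
  · have h3 := h.ne_top hd
    have : 0 < (q⁻¹).toReal := by
      refine ENNReal.toReal_pos (by simpa using h3) ?_
      have := h.one_le_q
      simp; intro h0; simp [h0] at this
    have : 0 < (d : ℝ) * (q⁻¹).toReal := by positivity
    linarith
  · have : (3 : ℝ) ≤ d := by
      have := h.two_le
      have : 3 ≤ d := by omega
      exact_mod_cast this
    have : 0 ≤ (d : ℝ) * (q⁻¹).toReal := by positivity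
    linarith

theorem rho_pos (h : Admissible d p q) : 0 < rho q d := by
  have h2 := h.two_le_cast
  exact div_pos (by linarith) h.denom_pos

theorem codim_mul_rho (h : Admissible d p q) :
    codim d p q * rho q d * (1 - (p⁻¹).toReal) = 2 := by
  have h1 : (1 - (p⁻¹).toReal) ≠ 0 := by have := h.p_lt_one; linarith
  have h2 := h.rho_pos.ne'
  unfold codim pstar
  field_simp

theorem two_div_rho (h : Admissible d p q) :
    2 / rho q d = 1 - 2 / (d : ℝ) + (q⁻¹).toReal := by
  have h1 := h.denom_pos.ne'
  have h2 : (d : ℝ) ≠ 0 := by have := h.two_le_cast; linarith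
  unfold rho
  field_simp

theorem codim_mul (h : Admissible d p q) :
    codim d p q * (1 - (p⁻¹).toReal) = 1 - 2 / (d : ℝ) + (q⁻¹).toReal := by
  rw [← h.two_div_rho, eq_div_iff h.rho_pos.ne', mul_right_comm]
  exact h.codim_mul_rho

theorem codim_pos (h : Admissible d p q) : 0 < codim d p q := by
  have h1 : 0 < (1 - (p⁻¹).toReal) := by have := h.p_lt_one; linarith
  have h2 := h.rho_pos
  unfold codim pstar
  positivity

/-- If the exponent were at least `1`, then `codim_mul` would give `1 - 1/p ≤ 1 - 2/d + 1/q`,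
contradicting `1/p + 1/q < 2/d`. This is the condition that makes the iteration gain integrability.
-/
theorem codim_lt_one (h : Admissible d p q) : codim d p q < 1 := by
  have h1 : 0 < (1 - (p⁻¹).toReal) := by have := h.p_lt_one; linarith
  have h2 := h.codim_mul
  have h3 := h.toReal_lt
  by_contra! h4
  nlinarith

theorem one_lt_nu (h : Admissible d p q) : 1 < nu d p q := by
  have := h.codim_lt_one; rw [nu_eq]; linarith

/-- The dimensional balance behind scale invariance: the powers of `|B|` from the averaged norms and
from the normalisation of the space-time integrals combine to `|B|^(2/d)`, a constant times `r²`. -/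
theorem volume_exponent (h : Admissible d p q) :
    (q⁻¹).toReal + (p⁻¹).toReal * codim d p q + (nu d p q - 1) = 2 / (d : ℝ) := by
  have := h.codim_mul; rw [nu_eq]; linarith

end Admissible

/-! ### Hölder's inequality with one extended exponent -/

/-- Writing the exponent of `F` in terms of `1/p` covers `p = ∞`, where `W` is simply bounded by its
essential supremum. It is applied to `λ⁻¹` and to `Λ`. -/
theorem lintegral_rpow_mul_rpow_le {α : Type*} [MeasurableSpace α] {μ : Measure α}
    {F W : α → ℝ≥0∞} (hF : AEMeasurable F μ) (hW : AEMeasurable W μ) {p : ℝ≥0∞} (hp : 1 ≤ p)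
    {e : ℝ} (he : 0 < e) (hep : e * (p⁻¹).toReal ≤ 1) :
    ∫⁻ x, F x ^ (1 - e * (p⁻¹).toReal) * W x ^ e ∂μ ≤
      (∫⁻ x, F x ∂μ) ^ (1 - e * (p⁻¹).toReal) * eLpNorm W p μ ^ e := by
  rcases eq_or_ne p ∞ with rfl | hp'
  · simp only [ENNReal.inv_top, ENNReal.toReal_zero, mul_zero, sub_zero, ENNReal.rpow_one,
      eLpNorm_exponent_top]
    rw [← lintegral_mul_const'' _ hF]
    refine lintegral_mono_ae ?_
    filter_upwards [enorm_ae_le_eLpNormEssSup W μ] with x hx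
    gcongr
    simpa using hx
  · have hp0 : p ≠ 0 := (lt_of_lt_of_le one_pos hp).ne'
    have hpr : 0 < p.toReal := ENNReal.toReal_pos hp0 hp'
    have key := ENNReal.lintegral_mul_norm_pow_le hF (hW.pow_const p.toReal)
      (p := 1 - e * (p⁻¹).toReal) (q := e * (p⁻¹).toReal) (by linarith)
      (by positivity) (by ring)
    have hmul : p.toReal * (e * (p⁻¹).toReal) = e := by
      rw [ENNReal.toReal_inv]; field_simp
    simp only [← ENNReal.rpow_mul, hmul] at key
    refine key.trans (le_of_eq ?_)
    rw [eLpNorm_eq_lintegral_rpow_enorm_toReal hp0 hp', ← ENNReal.rpow_mul]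
    simp only [enorm_eq_self]
    congr 2
    rw [ENNReal.toReal_inv]; ring

/-! ### Coefficients -/

theorem measurable_weight {d : ℕ} {f : Rd d → ℝ} (hf : Measurable f) : Measurable (weight f) :=
  hf.ennreal_ofReal

theorem measurable_invWeight {d : ℕ} {f : Rd d → ℝ} (hf : Measurable f) :
    Measurable (invWeight f) := hf.ennreal_ofReal.inv

theorem avgNorm_eq {d : ℕ} (p : ℝ≥0∞) {B : Set (Rd d)} (hB : volume B ≠ ∞) (f : Rd d → ℝ≥0∞) :
    avgNorm p B f =
      (volume B)⁻¹ ^ (p⁻¹).toReal * eLpNorm f p (volume.restrict B) := by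
  unfold avgNorm
  rw [eLpNorm_smul_measure_of_ne_zero (by simpa using hB), one_div, smul_eq_mul]

theorem volume_ball_ne_top {d : ℕ} (x : Rd d) (r : ℝ) : volume (Metric.ball x r) ≠ ∞ :=
  measure_ball_lt_top.ne

theorem volume_ball_ne_zero {d : ℕ} (x : Rd d) {r : ℝ} (hr : 0 < r) :
    volume (Metric.ball x r) ≠ 0 := (Metric.measure_ball_pos volume x hr).ne'

theorem eLpNorm_eq_avgNorm {d : ℕ} {p : ℝ≥0∞} {x : Rd d} {r : ℝ} (hr : 0 < r)
    (f : Rd d → ℝ≥0∞) :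
    eLpNorm f p (volume.restrict (Metric.ball x r)) =
      volume (Metric.ball x r) ^ (p⁻¹).toReal * avgNorm p (Metric.ball x r) f := by
  rw [avgNorm_eq p (volume_ball_ne_top x r), ← mul_assoc, ENNReal.inv_rpow,
    ENNReal.mul_inv_cancel, one_mul]
  · exact (ENNReal.rpow_pos (pos_iff_ne_zero.2 (volume_ball_ne_zero x hr))
      (volume_ball_ne_top x r)).ne'
  · exact ENNReal.rpow_ne_top_of_nonneg ENNReal.toReal_nonneg (volume_ball_ne_top x r)

/-- Every ball lies in a large ball centred at the origin. The growth hypotheses on the coefficients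
enter only through this local finiteness. -/
theorem eLpNorm_ball_lt_top {d : ℕ} {p : ℝ≥0∞} {f : Rd d → ℝ≥0∞}
    (hf : limsup (fun r : ℝ => avgNorm p (Metric.ball 0 r) f) atTop < ∞) (x : Rd d) (r : ℝ) :
    eLpNorm f p (volume.restrict (Metric.ball x r)) < ∞ := by
  have h1 := eventually_lt_of_limsup_lt hf
  obtain ⟨R, hR, hR1, hR0⟩ := (h1.and ((eventually_ge_atTop (‖x‖ + r)).and
    (eventually_gt_atTop 0))).exists
  have hsub : Metric.ball x r ⊆ Metric.ball (0 : Rd d) R := by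
    apply Metric.ball_subset_ball'
    rw [dist_zero_right]; linarith
  refine (eLpNorm_mono_measure f (Measure.restrict_mono hsub le_rfl)).trans_lt ?_
  rw [eLpNorm_eq_avgNorm hR0]
  exact ENNReal.mul_lt_top (ENNReal.rpow_lt_top_of_nonneg ENNReal.toReal_nonneg
    (volume_ball_ne_top _ _)) hR

namespace IsCoefficient

variable {d : ℕ} {p q : ℝ≥0∞} {a : Rd d → Matrix (Fin d) (Fin d) ℝ} {lam Lam : Rd d → ℝ}

/-- Local finiteness of `λ⁻¹` in `L^q` makes it locally integrable, hence finite almost everywhere.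
-/
theorem lam_pos (ha : IsCoefficient p q a lam Lam) (hq : 1 ≤ q) : ∀ᵐ x, 0 < lam x := by
  have h1 : ∀ n : ℕ, ∀ᵐ x ∂(volume.restrict (Metric.ball (0 : Rd d) n)),
      invWeight lam x < ∞ := by
    intro n
    have hfin := eLpNorm_ball_lt_top ha.limsup_lam 0 n
    have hle : eLpNorm (invWeight lam) 1 (volume.restrict (Metric.ball (0 : Rd d) n)) < ∞ := by
      have hm : AEMeasurable (invWeight lam) (volume.restrict (Metric.ball (0 : Rd d) n)) :=
        (measurable_invWeight ha.measurable_lam).aemeasurable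
      have hq1 : (q⁻¹).toReal ≤ 1 := by
        have := ENNReal.toReal_mono (by simp) (ENNReal.inv_le_one.2 hq)
        simpa using this
      have := lintegral_rpow_mul_rpow_le (F := fun _ => 1) (W := invWeight lam)
        aemeasurable_const hm hq (e := 1) one_pos (by linarith)
      simp only [ENNReal.one_rpow, one_mul, ENNReal.rpow_one, lintegral_const,
        Measure.restrict_apply_univ] at this
      rw [eLpNorm_one_eq_lintegral_enorm]
      simp only [enorm_eq_self]
      refine this.trans_lt (ENNReal.mul_lt_top (ENNReal.rpow_lt_top_of_nonneg (by linarith)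
        (volume_ball_ne_top _ _)) hfin)
    rw [eLpNorm_one_eq_lintegral_enorm] at hle
    simp only [enorm_eq_self] at hle
    exact ae_lt_top (measurable_invWeight ha.measurable_lam) hle.ne
  have h2 : ∀ᵐ x, ∀ n : ℕ, x ∈ Metric.ball (0 : Rd d) n → invWeight lam x < ∞ :=
    ae_all_iff.2 fun n => (ae_restrict_iff' measurableSet_ball).1 (h1 n)
  filter_upwards [h2] with x hx
  obtain ⟨n, hn⟩ := exists_nat_gt ‖x‖
  have := hx n (by simpa using hn)
  simpa [invWeight] using this

theorem Lam_pos (ha : IsCoefficient p q a lam Lam) (hd : 2 ≤ d) (hq : 1 ≤ q) :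
    ∀ᵐ x, 0 < Lam x := by
  filter_upwards [ha.lam_pos hq, ha.ellipticity] with x h1 h2
  have h3 := h2 (EuclideanSpace.single ⟨0, by omega⟩ 1)
  have h4 := h3.1.trans h3.2
  simp only [PiLp.norm_single, norm_one, one_pow, mul_one] at h4
  linarith

/-- Since `Λ ≥ λ > 0` almost everywhere, `Λ dx` and Lebesgue measure have the same null sets. This
lets almost everywhere statements pass between them. -/
theorem volume_absolutelyContinuous (ha : IsCoefficient p q a lam Lam) (hd : 2 ≤ d)
    (hq : 1 ≤ q) : (volume : Measure (Rd d)) ≪ weightedMeasure Lam := by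
  refine withDensity_absolutelyContinuous' (measurable_weight ha.measurable_Lam).aemeasurable ?_
  filter_upwards [ha.Lam_pos hd hq] with x hx
  simpa [weight] using hx

theorem weightedMeasure_absolutelyContinuous (θ : Rd d → ℝ) :
    weightedMeasure θ ≪ (volume : Measure (Rd d)) :=
  withDensity_absolutelyContinuous _ _

theorem weightedMeasure_ball_lt_top (ha : IsCoefficient p q a lam Lam) (hp : 1 ≤ p) (x : Rd d)
    (r : ℝ) : weightedMeasure Lam (Metric.ball x r) < ∞ := by
  have hp1 : (p⁻¹).toReal ≤ 1 := by
    have := ENNReal.toReal_mono (by simp) (ENNReal.inv_le_one.2 hp)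
    simpa using this
  have := lintegral_rpow_mul_rpow_le (F := fun _ => 1) (W := weight Lam)
    (μ := volume.restrict (Metric.ball x r)) aemeasurable_const
    (measurable_weight ha.measurable_Lam).aemeasurable hp (e := 1) one_pos (by linarith)
  simp only [ENNReal.one_rpow, one_mul, ENNReal.rpow_one, lintegral_const,
    Measure.restrict_apply_univ] at this
  rw [weightedMeasure, withDensity_apply _ measurableSet_ball]
  refine this.trans_lt (ENNReal.mul_lt_top (ENNReal.rpow_lt_top_of_nonneg (by linarith)
        (volume_ball_ne_top _ _)) (eLpNorm_ball_lt_top ha.limsup_Lam x r))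

theorem isFiniteMeasureOnCompacts (ha : IsCoefficient p q a lam Lam) (hp : 1 ≤ p) :
    IsFiniteMeasureOnCompacts (weightedMeasure Lam) := by
  refine ⟨fun K hK => ?_⟩
  obtain ⟨R, hR⟩ := hK.isBounded.subset_ball 0
  exact (measure_mono hR).trans_lt (ha.weightedMeasure_ball_lt_top hp 0 R)

theorem lintegral_weightedMeasure (ha : IsCoefficient p q a lam Lam) (f : Rd d → ℝ≥0∞) :
    ∫⁻ x, f x ∂(weightedMeasure Lam) = ∫⁻ x, f x * weight Lam x := by
  rw [weightedMeasure, lintegral_withDensity_eq_lintegral_mul_non_measurable _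
    (measurable_weight ha.measurable_Lam) (by simp [weight])]
  simp only [Pi.mul_apply, mul_comm]

theorem setLIntegral_weightedMeasure (ha : IsCoefficient p q a lam Lam) {s : Set (Rd d)}
    (hs : MeasurableSet s) (f : Rd d → ℝ≥0∞) :
    ∫⁻ x in s, f x ∂(weightedMeasure Lam) = ∫⁻ x in s, f x * weight Lam x := by
  rw [weightedMeasure, restrict_withDensity hs,
    lintegral_withDensity_eq_lintegral_mul_non_measurable _
    (measurable_weight ha.measurable_Lam) (by simp [weight])]
  simp only [Pi.mul_apply, mul_comm]

theorem ae_mono_vol (ha : IsCoefficient p q a lam Lam) (hd : 2 ≤ d) (hq : 1 ≤ q)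
    {P : Rd d → Prop} (h : ∀ᵐ x ∂(weightedMeasure Lam), P x) : ∀ᵐ x, P x :=
  (ha.volume_absolutelyContinuous hd hq).ae_le h

end IsCoefficient

/-! ### Bilinear algebra -/

section Bilin

variable {d : ℕ} (A : Matrix (Fin d) (Fin d) ℝ)

theorem bilin_add_left (v w z : Rd d) : bilin A (v + w) z = bilin A v z + bilin A w z := by
  simp [bilin, mul_add, add_mul, Finset.sum_add_distrib]

theorem bilin_add_right (v w z : Rd d) : bilin A z (v + w) = bilin A z v + bilin A z w := by
  simp [bilin, mul_add, Finset.sum_add_distrib]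

theorem bilin_smul_left (c : ℝ) (v w : Rd d) : bilin A (c • v) w = c * bilin A v w := by
  simp only [bilin, PiLp.smul_apply, smul_eq_mul, Finset.mul_sum]
  refine Finset.sum_congr rfl fun i _ => Finset.sum_congr rfl fun j _ => ?_
  ring

theorem bilin_smul_right (c : ℝ) (v w : Rd d) : bilin A v (c • w) = c * bilin A v w := by
  simp only [bilin, PiLp.smul_apply, smul_eq_mul, Finset.mul_sum]
  refine Finset.sum_congr rfl fun i _ => Finset.sum_congr rfl fun j _ => ?_
  ring

variable {A}

theorem bilin_comm (hA : A.IsSymm) (v w : Rd d) : bilin A v w = bilin A w v := by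
  unfold bilin
  rw [Finset.sum_comm]
  refine Finset.sum_congr rfl fun i _ => Finset.sum_congr rfl fun j _ => ?_
  rw [hA.apply i j]; ring

theorem bilin_add_self (hA : A.IsSymm) (v w : Rd d) :
    bilin A (v + w) (v + w) = bilin A v v + 2 * bilin A v w + bilin A w w := by
  rw [bilin_add_left, bilin_add_right, bilin_add_right, bilin_comm hA w v]; ring

/-- Young's inequality for a semidefinite form: expand it at `s v - w` and divide by `s`. -/
theorem two_mul_bilin_le (hA : A.IsSymm) (hpos : ∀ ξ, 0 ≤ bilin A ξ ξ) {s : ℝ} (hs : 0 < s)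
    (v w : Rd d) : 2 * bilin A v w ≤ s * bilin A v v + s⁻¹ * bilin A w w := by
  have h := hpos (s • v + (-1 : ℝ) • w)
  simp only [bilin_add_self hA, bilin_smul_left, bilin_smul_right] at h
  have h2 : 0 ≤ s⁻¹ * (s * (s * bilin A v v) + 2 * (s * (-1 * bilin A v w)) +
    -1 * (-1 * bilin A w w)) := by
    refine mul_nonneg (by positivity) (h.trans_eq (by ring))
  have h3 : s⁻¹ * (s * (s * bilin A v v) + 2 * (s * (-1 * bilin A v w)) +
    -1 * (-1 * bilin A w w)) = s * bilin A v v - 2 * bilin A v w + s⁻¹ * bilin A w w := by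
    field_simp; ring
  linarith

theorem abs_bilin_le (hA : A.IsSymm) (hpos : ∀ ξ, 0 ≤ bilin A ξ ξ) (v w : Rd d) :
    |bilin A v w| ≤ bilin A v v + bilin A w w := by
  have h1 := two_mul_bilin_le hA hpos one_pos v w
  have h2 := two_mul_bilin_le hA hpos one_pos v ((-1 : ℝ) • w)
  simp only [bilin_smul_left, bilin_smul_right] at h2
  have := hpos v; have := hpos w
  rw [abs_le]; constructor <;> linarith

theorem bilin_add_self_le (hA : A.IsSymm) (hpos : ∀ ξ, 0 ≤ bilin A ξ ξ) (v w : Rd d) :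
    bilin A (v + w) (v + w) ≤ 2 * bilin A v v + 2 * bilin A w w := by
  have h1 := two_mul_bilin_le hA hpos one_pos v w
  rw [bilin_add_self hA]; linarith

end Bilin

/-! ### The form on vector fields -/

/-- `∫ ⟨a g, g⟩ dx ∈ [0, ∞]`. -/
def formSq {d : ℕ} (a : Rd d → Matrix (Fin d) (Fin d) ℝ) (g : Rd d → Rd d) : ℝ≥0∞ :=
  ∫⁻ x, ENNReal.ofReal (bilin (a x) (g x) (g x))

namespace IsCoefficient

variable {d : ℕ} {p q : ℝ≥0∞} {a : Rd d → Matrix (Fin d) (Fin d) ℝ} {lam Lam : Rd d → ℝ}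

theorem bilin_nonneg (ha : IsCoefficient p q a lam Lam) :
    ∀ᵐ x, ∀ ξ : Rd d, 0 ≤ bilin (a x) ξ ξ := by
  filter_upwards [ha.ellipticity] with x hx ξ
  exact (mul_nonneg (ha.lam_nonneg x) (by positivity)).trans (hx ξ).1

theorem aemeasurable_bilin (ha : IsCoefficient p q a lam Lam) {g h : Rd d → Rd d}
    (hg : AEStronglyMeasurable g volume) (hh : AEStronglyMeasurable h volume) :
    AEMeasurable (fun x => bilin (a x) (g x) (h x)) volume := by
  unfold bilin
  refine Finset.aemeasurable_fun_sum _ fun i _ => Finset.aemeasurable_fun_sum _ fun j _ => ?_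
  have h1 : AEMeasurable (fun x => g x i) volume :=
    ((EuclideanSpace.proj (𝕜 := ℝ) i).continuous.comp_aestronglyMeasurable hg).aemeasurable
  have h2 : AEMeasurable (fun x => h x j) volume :=
    ((EuclideanSpace.proj (𝕜 := ℝ) j).continuous.comp_aestronglyMeasurable hh).aemeasurable
  exact ((ha.measurable_a i j).aemeasurable.mul h1).mul h2

theorem formSq_add_le (ha : IsCoefficient p q a lam Lam) {g : Rd d → Rd d}
    (hg : AEStronglyMeasurable g volume) (h : Rd d → Rd d) :
    formSq a (fun x => g x + h x) ≤ 2 * (formSq a g + formSq a h) := by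
  unfold formSq
  rw [← lintegral_add_left' (ha.aemeasurable_bilin hg hg).ennreal_ofReal,
    ← lintegral_const_mul' _ _ (by simp)]
  refine lintegral_mono_ae ?_
  filter_upwards [ha.bilin_nonneg] with x hx
  rw [← ENNReal.ofReal_add (hx _) (hx _),
    show (2 : ℝ≥0∞) * _ = ENNReal.ofReal 2 * _ by rw [ENNReal.ofReal_ofNat],
    ← ENNReal.ofReal_mul (by simp)]
  refine ENNReal.ofReal_le_ofReal ?_
  have := bilin_add_self_le (ha.symm x) hx (g x) (h x)
  simpa [mul_add] using this

theorem formSq_le (ha : IsCoefficient p q a lam Lam) (g : Rd d → Rd d) :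
    formSq a g ≤ ∫⁻ x, ‖g x‖ₑ ^ (2 : ℝ) ∂(weightedMeasure Lam) := by
  rw [ha.lintegral_weightedMeasure]
  refine lintegral_mono_ae ?_
  filter_upwards [ha.ellipticity] with x hx
  refine (ENNReal.ofReal_le_ofReal (hx _).2).trans (le_of_eq ?_)
  rw [ENNReal.ofReal_mul (ha.Lam_nonneg x), mul_comm, weight,
    ENNReal.ofReal_pow (norm_nonneg _), ofReal_norm]
  norm_cast

theorem formSq_smul_le (ha : IsCoefficient p q a lam Lam) (F : Rd d → ℝ) (g : Rd d → Rd d)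
    {c : ℝ} (hc : ∀ x, |F x| ≤ c) :
    formSq a (fun x => F x • g x) ≤ ENNReal.ofReal (c ^ 2) * formSq a g := by
  unfold formSq
  rw [← lintegral_const_mul' _ _ (by simp)]
  refine lintegral_mono_ae ?_
  filter_upwards [ha.bilin_nonneg] with x hx
  rw [← ENNReal.ofReal_mul (by positivity)]
  refine ENNReal.ofReal_le_ofReal ?_
  rw [bilin_smul_left, bilin_smul_right, ← mul_assoc]
  refine mul_le_mul_of_nonneg_right ?_ (hx _)
  rw [← sq]
  exact sq_le_sq' (by linarith [neg_abs_le (F x), hc x]) ((le_abs_self _).trans (hc x))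

end IsCoefficient

/-! ### Test functions and their gradients -/

theorem gradient_apply_eq {d : ℕ} (f : Rd d → ℝ) :
    gradient f = fun x => (InnerProductSpace.toDual ℝ (Rd d)).symm (fderiv ℝ f x) := rfl

theorem norm_gradient {d : ℕ} (f : Rd d → ℝ) (x : Rd d) : ‖gradient f x‖ = ‖fderiv ℝ f x‖ := by
  rw [gradient_apply_eq]; simp

namespace IsTestFunction

variable {d : ℕ} {G : Set (Rd d)} {f : Rd d → ℝ}

theorem continuous_gradient (hf : IsTestFunction G f) : Continuous (gradient f) := by
  rw [gradient_apply_eq]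
  exact (LinearIsometryEquiv.continuous _).comp (hf.1.continuous_fderiv (by simp))

theorem gradient_eq_zero (_hf : IsTestFunction G f) {x : Rd d} (hx : x ∉ tsupport f) :
    gradient f x = 0 := by
  rw [gradient_apply_eq]
  simp [fderiv_of_notMem_tsupport ℝ hx]

theorem hasCompactSupport_gradient (hf : IsTestFunction G f) :
    HasCompactSupport (gradient f) :=
  HasCompactSupport.of_support_subset_isCompact hf.2.1 fun x hx => by
    by_contra h
    exact hx (hf.gradient_eq_zero h)

theorem exists_abs_le (hf : IsTestFunction G f) : ∃ c, 0 ≤ c ∧ ∀ x, |f x| ≤ c := by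
  obtain ⟨c, hc⟩ := hf.1.continuous.bounded_above_of_compact_support hf.2.1
  exact ⟨c, (abs_nonneg _).trans (hc 0), hc⟩

theorem exists_norm_gradient_le (hf : IsTestFunction G f) :
    ∃ c, 0 ≤ c ∧ ∀ x, ‖gradient f x‖ ≤ c := by
  obtain ⟨c, hc⟩ := hf.continuous_gradient.bounded_above_of_compact_support
    hf.hasCompactSupport_gradient
  exact ⟨c, (norm_nonneg _).trans (hc 0), hc⟩

theorem sq (hf : IsTestFunction G f) : IsTestFunction G (fun x => f x ^ 2) := by
  refine ⟨hf.1.pow 2, ?_, ?_⟩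
  · simp only [pow_two]; exact hf.2.1.mul_left
  · simp only [pow_two]; exact (tsupport_mul_subset_left).trans hf.2.2

theorem hasGradientAt (hf : IsTestFunction G f) (x : Rd d) :
    HasGradientAt f (gradient f x) x :=
  ((hf.1.differentiable (by simp)) x).hasGradientAt

theorem gradient_sq (hf : IsTestFunction G f) (x : Rd d) :
    gradient (fun y => f y ^ 2) x = (2 * f x) • gradient f x := by
  refine HasGradientAt.gradient ?_
  rw [hasGradientAt_iff_hasFDerivAt]
  have := (hasGradientAt_iff_hasFDerivAt.1 (hf.hasGradientAt x)).pow 2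
  convert! this using 1
  simp

theorem mul_comp {η : Rd d → ℝ} (hη : IsTestFunction G η) {G' : Set (Rd d)}
    (hf : IsTestFunction G' f) {Ψ : ℝ → ℝ} (hΨ : ContDiff ℝ ((⊤ : ℕ∞) : WithTop ℕ∞) Ψ) :
    IsTestFunction G (fun x => η x * Ψ (f x)) :=
  ⟨hη.1.mul (hΨ.comp hf.1), hη.2.1.mul_right, tsupport_mul_subset_left.trans hη.2.2⟩

theorem gradient_mul_comp {η : Rd d → ℝ} (hη : IsTestFunction G η) {G' : Set (Rd d)}
    (hf : IsTestFunction G' f) {Ψ : ℝ → ℝ} (hΨ : ContDiff ℝ ((⊤ : ℕ∞) : WithTop ℕ∞) Ψ)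
    (x : Rd d) :
    gradient (fun x => η x * Ψ (f x)) x =
      Ψ (f x) • gradient η x + (η x * deriv Ψ (f x)) • gradient f x := by
  refine HasGradientAt.gradient ?_
  rw [hasGradientAt_iff_hasFDerivAt]
  have h1 := hasGradientAt_iff_hasFDerivAt.1 (hf.hasGradientAt x)
  have h2 := hasGradientAt_iff_hasFDerivAt.1 (hη.hasGradientAt x)
  have h3 := ((hΨ.differentiable (by simp)) (f x)).hasDerivAt
  have := h2.mul (h3.comp_hasFDerivAt x h1)
  convert! this using 1
  rw [map_add, map_smul, map_smul, add_comm, mul_smul]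
  rfl

end IsTestFunction

theorem abs_sub_le_of_abs_deriv_le {Ψ : ℝ → ℝ} (hΨ : Differentiable ℝ Ψ) {L : ℝ}
    (hL : ∀ y, |deriv Ψ y| ≤ L) (b c : ℝ) : |Ψ b - Ψ c| ≤ L * |b - c| :=
  convex_univ.norm_image_sub_le_of_norm_deriv_le (fun x _ => hΨ x) (fun x _ => hL x)
    (mem_univ c) (mem_univ b)

/-! ### The form domain and its chain rule -/

namespace HasFormGradient

variable {d : ℕ} {p q : ℝ≥0∞} {a : Rd d → Matrix (Fin d) (Fin d) ℝ} {lam Lam : Rd d → ℝ}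
  {G : Set (Rd d)} {u : Rd d → ℝ} {g : Rd d → Rd d}

/-- A single approximating test function suffices: `g` is at finite energy distance from its
gradient, which has finite energy because it is bounded with compact support and `Λ` is locally
integrable. -/
theorem formSq_lt_top (ha : IsCoefficient p q a lam Lam) (hp : 1 ≤ p)
    (hu : HasFormGradient a Lam G u g) : formSq a g < ∞ := by
  obtain ⟨_, hg, f, hf, _, hlim⟩ := hu
  have hev := (tendsto_order.1 hlim).2 1 one_pos
  obtain ⟨n, hn⟩ := hev.exists
  have := ha.isFiniteMeasureOnCompacts hp
  have h1 : formSq a (gradient (f n)) < ∞ := by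
    refine (ha.formSq_le _).trans_lt ?_
    have := ((hf n).continuous_gradient.memLp_of_hasCompactSupport (μ := weightedMeasure Lam)
      (p := 2) (hf n).hasCompactSupport_gradient).2
    simpa using lintegral_rpow_enorm_lt_top_of_eLpNorm_lt_top (by simp) (by simp) this
  have hm : AEStronglyMeasurable (gradient (f n)) volume :=
    (hf n).continuous_gradient.aestronglyMeasurable
  have h2 : formSq a g ≤ 2 * (formSq a (gradient (f n)) +
      formSq a (fun x => (-1 : ℝ) • (gradient (f n) x - g x))) := by
    refine le_trans (le_of_eq ?_) (ha.formSq_add_le hm _)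
    congr 1; ext1 x; simp
  have h3 : formSq a (fun x => (-1 : ℝ) • (gradient (f n) x - g x)) < ∞ := by
    refine (ha.formSq_smul_le (fun _ => -1) (fun x => gradient (f n) x - g x)
      (c := 1) (by simp)).trans_lt ?_
    exact ENNReal.mul_lt_top (by simp) (hn.trans ENNReal.one_lt_top)
  exact h2.trans_lt (ENNReal.mul_lt_top (by simp) (ENNReal.add_lt_top.2 ⟨h1, h3⟩))

theorem aestronglyMeasurable (ha : IsCoefficient p q a lam Lam) (hA : Admissible d p q)
    (hu : HasFormGradient a Lam G u g) : AEStronglyMeasurable u volume :=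
  hu.1.1.mono_ac (ha.volume_absolutelyContinuous hA.two_le hA.one_le_q)

/-- A subsequence also converges almost everywhere, first for `Λ dx` and then for Lebesgue measure.
The chain rule and Fatou's lemma need this. -/
theorem exists_seq (ha : IsCoefficient p q a lam Lam) (hA : Admissible d p q)
    (hu : HasFormGradient a Lam G u g) :
    ∃ f : ℕ → Rd d → ℝ, (∀ n, IsTestFunction G (f n)) ∧
      Tendsto (fun n => eLpNorm (fun x => f n x - u x) 2 (weightedMeasure Lam)) atTop (𝓝 0) ∧
      Tendsto (fun n => formSq a (fun x => gradient (f n) x - g x)) atTop (𝓝 0) ∧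
      ∀ᵐ x, Tendsto (fun n => f n x) atTop (𝓝 (u x)) := by
  obtain ⟨hu2, hg, f, hf, hlim, hlim'⟩ := hu
  obtain ⟨ns, hns, hae⟩ := (tendstoInMeasure_of_tendsto_eLpNorm (by simp)
    (fun n => (hf n).1.continuous.aestronglyMeasurable) hu2.1 hlim).exists_seq_tendsto_ae
  exact ⟨fun n => f (ns n), fun n => hf _, hlim.comp hns.tendsto_atTop,
    hlim'.comp hns.tendsto_atTop, ha.ae_mono_vol hA.two_le hA.one_le_q hae⟩

/-- The chain rule for the gradient of the form. -/
theorem mul_comp (ha : IsCoefficient p q a lam Lam) (hA : Admissible d p q)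
    {G' : Set (Rd d)} (hu : HasFormGradient a Lam G' u g) {η : Rd d → ℝ}
    (hη : IsTestFunction G η) {Ψ : ℝ → ℝ} (hΨ : ContDiff ℝ ((⊤ : ℕ∞) : WithTop ℕ∞) Ψ)
    {L : ℝ} (hL : ∀ y, |deriv Ψ y| ≤ L) :
    HasFormGradient a Lam G (fun x => η x * Ψ (u x))
      (fun x => Ψ (u x) • gradient η x + (η x * deriv Ψ (u x)) • g x) := by
  have hgfin := hu.formSq_lt_top ha hA.one_le_p
  have hum := hu.aestronglyMeasurable ha hA
  obtain ⟨f, hf, hlim, hlim', hae⟩ := hu.exists_seq ha hA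
  obtain ⟨hu2, hg, -⟩ := hu
  have := ha.isFiniteMeasureOnCompacts hA.one_le_p
  have hΨd : Differentiable ℝ Ψ := hΨ.differentiable (by simp)
  have hΨ'c : Continuous (deriv Ψ) := hΨ.continuous_deriv (by simp)
  have hL0 : 0 ≤ L := (abs_nonneg _).trans (hL 0)
  have hlip := abs_sub_le_of_abs_deriv_le hΨd hL
  obtain ⟨c, hc0, hc⟩ := hη.exists_abs_le
  obtain ⟨c', hc0', hc'⟩ := hη.exists_norm_gradient_le
  have hηc : Continuous η := hη.1.continuous
  have hηg : AEStronglyMeasurable (gradient η) volume :=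
    hη.continuous_gradient.aestronglyMeasurable
  have hΨu : AEStronglyMeasurable (fun x => Ψ (u x)) volume :=
    hΨ.continuous.comp_aestronglyMeasurable hum
  have hΨ'u : AEStronglyMeasurable (fun x => deriv Ψ (u x)) volume :=
    hΨ'c.comp_aestronglyMeasurable hum
  refine ⟨?_, ?_, fun n x => η x * Ψ (f n x), fun n => hη.mul_comp (hf n) hΨ, ?_, ?_⟩
  -- `Ψ(u) - Ψ(0)` is dominated by `L |u|`, while the constant `Ψ(0)` is square integrable only
  -- because `η` has compact support.
  · have h1 : MemLp (fun x => η x * (Ψ (u x) - Ψ 0)) 2 (weightedMeasure Lam) := by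
      refine hu2.of_le_mul (c := c * L) ?_ (ae_of_all _ fun x => ?_)
      · exact hηc.aestronglyMeasurable.mul
          ((hΨ.continuous.comp_aestronglyMeasurable hu2.1).sub aestronglyMeasurable_const)
      · rw [norm_mul, mul_assoc]
        have := hlip (u x) 0
        rw [sub_zero] at this
        exact mul_le_mul (hc x) this (norm_nonneg _) hc0
    have h2 : MemLp (fun x => η x * Ψ 0) 2 (weightedMeasure Lam) :=
      (hηc.mul continuous_const).memLp_of_hasCompactSupport hη.2.1.mul_right
    convert! h1.add h2 using 1
    ext x; simp; ring
  · exact (hΨu.smul hηg).add ((hηc.aestronglyMeasurable.mul hΨ'u).smul hg)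
  · have h1 : ∀ n, eLpNorm (fun x => η x * Ψ (f n x) - η x * Ψ (u x)) 2 (weightedMeasure Lam)
        ≤ ENNReal.ofReal (c * L) * eLpNorm (fun x => f n x - u x) 2 (weightedMeasure Lam) := by
      intro n
      refine eLpNorm_le_mul_eLpNorm_of_ae_le_mul (ae_of_all _ fun x => ?_) 2
      rw [← mul_sub, norm_mul, mul_assoc]
      exact mul_le_mul (hc x) (hlip _ _) (norm_nonneg _) hc0
    have h2 := ENNReal.Tendsto.const_mul hlim (Or.inr (ENNReal.ofReal_ne_top (r := c * L)))
    rw [mul_zero] at h2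
    exact tendsto_of_tendsto_of_tendsto_of_le_of_le tendsto_const_nhds h2 (fun _ => zero_le) h1
  -- The error in the gradient splits into three terms. The one with `Ψ(f n) - Ψ(u)` is handled by
  -- upper ellipticity and `L²(Λ dx)` convergence, the one with `∇(f n) - g` by energy convergence.
  -- The one with `Ψ'(f n) - Ψ'(u)` has only almost everywhere convergence, hence dominated
  -- convergence.
  · have hX : ∀ n, formSq a (fun x => (Ψ (f n x) - Ψ (u x)) • gradient η x) ≤
        ENNReal.ofReal (L * c') ^ (2 : ℝ) *
          eLpNorm (fun x => f n x - u x) 2 (weightedMeasure Lam) ^ (2 : ℝ) := by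
      intro n
      refine (ha.formSq_le _).trans ?_
      rw [← ENNReal.mul_rpow_of_nonneg _ _ (by norm_num)]
      have h1 : eLpNorm (fun x => (Ψ (f n x) - Ψ (u x)) • gradient η x) 2 (weightedMeasure Lam)
          ≤ ENNReal.ofReal (L * c') *
            eLpNorm (fun x => f n x - u x) 2 (weightedMeasure Lam) := by
        refine eLpNorm_le_mul_eLpNorm_of_ae_le_mul (ae_of_all _ fun x => ?_) 2
        rw [norm_smul, mul_right_comm]
        exact mul_le_mul (hlip _ _) (hc' x) (norm_nonneg _) (by positivity)
      refine le_trans (le_of_eq ?_) (ENNReal.rpow_le_rpow h1 (by norm_num))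
      rw [eLpNorm_eq_lintegral_rpow_enorm_toReal (by simp) (by simp), ← ENNReal.rpow_mul]
      simp
    have hY : ∀ n, formSq a (fun x => (η x * deriv Ψ (f n x)) • (gradient (f n) x - g x)) ≤
        ENNReal.ofReal ((c * L) ^ 2) * formSq a (fun x => gradient (f n) x - g x) := by
      intro n
      refine ha.formSq_smul_le _ _ fun x => ?_
      rw [abs_mul]
      exact mul_le_mul (hc x) (hL _) (abs_nonneg _) hc0
    have hZ : Tendsto (fun n => formSq a
        (fun x => (η x * (deriv Ψ (f n x) - deriv Ψ (u x))) • g x)) atTop (𝓝 0) := by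
      have hm : ∀ n, AEStronglyMeasurable
          (fun x => (η x * (deriv Ψ (f n x) - deriv Ψ (u x))) • g x) volume := fun n =>
        (hηc.aestronglyMeasurable.mul
          ((hΨ'c.comp (hf n).1.continuous).aestronglyMeasurable.sub hΨ'u)).smul hg
      have := tendsto_lintegral_of_dominated_convergence' (μ := volume)
        (F := fun n x => ENNReal.ofReal (bilin (a x)
          ((η x * (deriv Ψ (f n x) - deriv Ψ (u x))) • g x)
          ((η x * (deriv Ψ (f n x) - deriv Ψ (u x))) • g x))) (f := fun _ => 0)
        (fun x => ENNReal.ofReal ((c * (2 * L)) ^ 2) * ENNReal.ofReal (bilin (a x) (g x) (g x)))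
        (fun n => (ha.aemeasurable_bilin (hm n) (hm n)).ennreal_ofReal) ?_ ?_ ?_
      · simpa [formSq] using this
      · intro n
        filter_upwards [ha.bilin_nonneg] with x hx
        rw [← ENNReal.ofReal_mul (by positivity)]
        refine ENNReal.ofReal_le_ofReal ?_
        rw [bilin_smul_left, bilin_smul_right, ← mul_assoc, ← sq]
        refine mul_le_mul_of_nonneg_right ?_ (hx _)
        rw [← sq_abs]
        refine pow_le_pow_left₀ (abs_nonneg _) ?_ 2
        rw [abs_mul]
        refine mul_le_mul (hc x) ?_ (abs_nonneg _) hc0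
        have := abs_sub (deriv Ψ (f n x)) (deriv Ψ (u x))
        linarith [hL (f n x), hL (u x)]
      · rw [lintegral_const_mul' _ _ (by simp)]
        exact (ENNReal.mul_lt_top (by simp) hgfin).ne
      · filter_upwards [hae] with x hx
        have h1 : Tendsto (fun n => η x * (deriv Ψ (f n x) - deriv Ψ (u x))) atTop (𝓝 0) := by
          have := (((hΨ'c.tendsto (u x)).comp hx).sub_const (deriv Ψ (u x))).const_mul (η x)
          simpa using this
        have h2 : Tendsto (fun n => (η x * (deriv Ψ (f n x) - deriv Ψ (u x))) *
          ((η x * (deriv Ψ (f n x) - deriv Ψ (u x))) * bilin (a x) (g x) (g x))) atTop (𝓝 0) := by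
          have := h1.mul (h1.mul_const (bilin (a x) (g x) (g x)))
          simpa using this
        simp only [bilin_smul_left, bilin_smul_right]
        have := (ENNReal.continuous_ofReal.tendsto 0).comp h2
        simpa [Function.comp_def] using this
    have hle : ∀ n, formSq a (fun x => gradient (fun x => η x * Ψ (f n x)) x -
          (Ψ (u x) • gradient η x + (η x * deriv Ψ (u x)) • g x)) ≤
        2 * (ENNReal.ofReal (L * c') ^ (2 : ℝ) *
          eLpNorm (fun x => f n x - u x) 2 (weightedMeasure Lam) ^ (2 : ℝ) +
        2 * (ENNReal.ofReal ((c * L) ^ 2) * formSq a (fun x => gradient (f n) x - g x) +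
          formSq a (fun x => (η x * (deriv Ψ (f n x) - deriv Ψ (u x))) • g x))) := by
      intro n
      have hmX : AEStronglyMeasurable (fun x => (Ψ (f n x) - Ψ (u x)) • gradient η x) volume :=
        ((hΨ.continuous.comp (hf n).1.continuous).aestronglyMeasurable.sub hΨu).smul hηg
      have hmY : AEStronglyMeasurable
          (fun x => (η x * deriv Ψ (f n x)) • (gradient (f n) x - g x)) volume :=
        (hηc.aestronglyMeasurable.mul
          (hΨ'c.comp (hf n).1.continuous).aestronglyMeasurable).smul
          ((hf n).continuous_gradient.aestronglyMeasurable.sub hg)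
      have hsplit : (fun x => gradient (fun x => η x * Ψ (f n x)) x -
          (Ψ (u x) • gradient η x + (η x * deriv Ψ (u x)) • g x)) = fun x =>
          (Ψ (f n x) - Ψ (u x)) • gradient η x +
          ((η x * deriv Ψ (f n x)) • (gradient (f n) x - g x) +
           (η x * (deriv Ψ (f n x) - deriv Ψ (u x))) • g x) := by
        ext1 x
        rw [hη.gradient_mul_comp (hf n) hΨ]
        module
      rw [hsplit]
      refine (ha.formSq_add_le hmX _).trans ?_
      gcongr
      · exact hX n
      · refine (ha.formSq_add_le hmY _).trans ?_
        gcongr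
        exact hY n
    refine tendsto_of_tendsto_of_tendsto_of_le_of_le tendsto_const_nhds ?_
      (fun _ => zero_le) hle
    have t1 : Tendsto (fun n => ENNReal.ofReal (L * c') ^ (2 : ℝ) *
          eLpNorm (fun x => f n x - u x) 2 (weightedMeasure Lam) ^ (2 : ℝ)) atTop (𝓝 0) := by
      have h1 := (ENNReal.continuous_rpow_const (y := 2)).tendsto 0 |>.comp hlim
      have h2 := ENNReal.Tendsto.const_mul h1
        (Or.inr (ENNReal.rpow_ne_top_of_nonneg (y := 2) (by norm_num)
          (ENNReal.ofReal_ne_top (r := L * c'))))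
      simpa using h2
    have t2 : Tendsto (fun n => ENNReal.ofReal ((c * L) ^ 2) *
        formSq a (fun x => gradient (f n) x - g x)) atTop (𝓝 0) := by
      have h2 := ENNReal.Tendsto.const_mul hlim'
        (Or.inr (ENNReal.ofReal_ne_top (r := (c * L) ^ 2)))
      simpa using h2
    have t3 := ENNReal.Tendsto.const_mul (t2.add hZ) (Or.inr (ENNReal.ofNat_ne_top (n := 2)))
    have t4 := ENNReal.Tendsto.const_mul (t1.add t3) (Or.inr (ENNReal.ofNat_ne_top (n := 2)))
    simpa using t4

end HasFormGradient

/-! ### Regularised powers -/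

/-- A smooth positive function that equals `v + ε` for `v ≥ 0` and is constant for
`v ≤ -ε / 2`. -/
def regShift (ε v : ℝ) : ℝ := ε + v * Real.smoothTransition (1 + 2 * v / ε)

/-- A smooth function that equals `(v + ε) ^ γ` for `v ≥ 0`. -/
def regPow (ε γ v : ℝ) : ℝ := regShift ε v ^ γ

section RegPow

variable {ε : ℝ} (hε : 0 < ε) (γ : ℝ)
include hε

theorem regShift_of_nonneg {v : ℝ} (hv : 0 ≤ v) : regShift ε v = v + ε := by
  rw [regShift, Real.smoothTransition.one_of_one_le]
  · ring
  · have : 0 ≤ 2 * v / ε := by positivity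
    linarith

theorem regShift_of_le {v : ℝ} (hv : v ≤ -(ε / 2)) : regShift ε v = ε := by
  rw [regShift, Real.smoothTransition.zero_of_nonpos]
  · ring
  · have : 2 * v / ε ≤ -1 := by rw [div_le_iff₀ hε]; linarith
    linarith

/-- In the transition zone `v ≥ -ε/2` and the transition function is at most `1`, so the value is at
least `ε/2`. Positivity makes every real power of it smooth. -/
theorem regShift_pos (v : ℝ) : 0 < regShift ε v := by
  rcases le_total 0 v with h | h
  · rw [regShift_of_nonneg hε h]; linarith
  rcases le_total v (-(ε / 2)) with h' | h'
  · rw [regShift_of_le hε h']; exact hε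
  · have h1 := Real.smoothTransition.le_one (1 + 2 * v / ε)
    have h2 := Real.smoothTransition.nonneg (1 + 2 * v / ε)
    unfold regShift
    nlinarith

theorem regPow_of_nonneg {v : ℝ} (hv : 0 ≤ v) : regPow ε γ v = (v + ε) ^ γ := by
  rw [regPow, regShift_of_nonneg hε hv]

theorem contDiff_regPow : ContDiff ℝ ((⊤ : ℕ∞) : WithTop ℕ∞) (regPow ε γ) := by
  have h : ContDiff ℝ ((⊤ : ℕ∞) : WithTop ℕ∞) (regShift ε) := by
    unfold regShift
    refine contDiff_const.add (contDiff_id.mul (Real.smoothTransition.contDiff.comp ?_))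
    exact contDiff_const.add ((contDiff_const.mul contDiff_id).div_const _)
  exact h.rpow_const_of_ne fun v => (regShift_pos hε v).ne'

theorem deriv_regPow_eq {v : ℝ} (hv : 0 < v) :
    deriv (regPow ε γ) v = γ * (v + ε) ^ (γ - 1) := by
  have h : regPow ε γ =ᶠ[𝓝 v] fun y => (y + ε) ^ γ := by
    filter_upwards [lt_mem_nhds hv] with y hy using regPow_of_nonneg hε γ hy.le
  rw [h.deriv_eq]
  have := ((hasDerivAt_id v).add_const ε).rpow_const (p := γ)
    (Or.inl (by simp only [id]; positivity))
  simpa using this.deriv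

theorem deriv_deriv_regPow_eq {v : ℝ} (hv : 0 < v) :
    deriv (deriv (regPow ε γ)) v = γ * (γ - 1) * (v + ε) ^ (γ - 2) := by
  have h : deriv (regPow ε γ) =ᶠ[𝓝 v] fun y => γ * (y + ε) ^ (γ - 1) := by
    filter_upwards [lt_mem_nhds hv] with y hy using deriv_regPow_eq hε γ hy
  rw [h.deriv_eq]
  have := (((hasDerivAt_id v).add_const ε).rpow_const (p := γ - 1)
    (Or.inl (by simp only [id]; positivity))).const_mul γ
  rw [show γ - 1 - 1 = γ - 2 by ring] at this
  simpa [mul_assoc] using this.deriv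

theorem deriv_regPow_of_lt {v : ℝ} (hv : v < -(ε / 2)) : deriv (regPow ε γ) v = 0 := by
  have h : regPow ε γ =ᶠ[𝓝 v] fun _ => ε ^ γ := by
    filter_upwards [gt_mem_nhds hv] with y hy
    rw [regPow, regShift_of_le hε (le_of_lt hy)]
  rw [h.deriv_eq, deriv_const]

theorem deriv_deriv_regPow_of_lt {v : ℝ} (hv : v < -(ε / 2)) :
    deriv (deriv (regPow ε γ)) v = 0 := by
  have h : deriv (regPow ε γ) =ᶠ[𝓝 v] fun _ => 0 := by
    filter_upwards [gt_mem_nhds hv] with y hy using deriv_regPow_of_lt hε γ hy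
  rw [h.deriv_eq, deriv_const]

omit hε in
-- Global bounds on derivatives of `regPow` are required because `u` has no sign outside the ball.
-- They vanish far to the left, are explicit on the right, and a compact interval remains.
theorem exists_abs_le_of_continuous {Q : ℝ → ℝ} (hQ : Continuous Q) {b c : ℝ}
    (h1 : ∀ v < b, Q v = 0) (h2 : ∀ v > 0, |Q v| ≤ c) : ∃ L, ∀ v, |Q v| ≤ L := by
  obtain ⟨L, hL⟩ := isCompact_Icc (a := b) (b := 0) |>.exists_bound_of_continuousOn hQ.continuousOn
  refine ⟨max (max L c) 0, fun v => ?_⟩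
  rcases lt_or_ge v b with h | h
  · simp [h1 v h]
  rcases lt_or_ge 0 v with h' | h'
  · exact (h2 v h').trans (by simp)
  · exact (hL v ⟨h, h'⟩).trans (by simp)

theorem exists_abs_deriv_regPow_le (hγ : γ ≤ 1) : ∃ L, ∀ v, |deriv (regPow ε γ) v| ≤ L := by
  refine exists_abs_le_of_continuous ((contDiff_regPow hε γ).continuous_deriv (by simp))
    (b := -(ε / 2)) (c := |γ| * ε ^ (γ - 1)) (fun v hv => deriv_regPow_of_lt hε γ hv) ?_
  intro v hv
  rw [deriv_regPow_eq hε γ hv, abs_mul, abs_of_nonneg (Real.rpow_nonneg (by linarith) _)]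
  exact mul_le_mul_of_nonneg_left
    (Real.rpow_le_rpow_of_nonpos hε (by linarith) (by linarith)) (abs_nonneg _)

theorem contDiff_deriv_regPow :
    ContDiff ℝ ((⊤ : ℕ∞) : WithTop ℕ∞) (deriv (regPow ε γ)) := by
  have := contDiff_regPow hε γ
  rw [contDiff_infty_iff_deriv] at this
  exact this.2

theorem exists_abs_deriv_deriv_regPow_le (hγ : γ ≤ 1) :
    ∃ L, ∀ v, |deriv (deriv (regPow ε γ)) v| ≤ L := by
  refine exists_abs_le_of_continuous ((contDiff_deriv_regPow hε γ).continuous_deriv (by simp))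
    (b := -(ε / 2)) (c := |γ * (γ - 1)| * ε ^ (γ - 2))
    (fun v hv => deriv_deriv_regPow_of_lt hε γ hv) ?_
  intro v hv
  rw [deriv_deriv_regPow_eq hε γ hv, abs_mul, abs_of_nonneg (Real.rpow_nonneg (by linarith) _)]
  exact mul_le_mul_of_nonneg_left
    (Real.rpow_le_rpow_of_nonpos hε (by linarith) (by linarith)) (abs_nonneg _)

end RegPow

/-! ### Differentiation in time -/

/-- Apply the mean value inequality to `P(y) - P'(c) y`, whose derivative is at most `L |b - c|`
between `c` and `b`. The sharp factor `1/2` is not needed. -/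
theorem abs_taylor_le {P : ℝ → ℝ} (hP : Differentiable ℝ P) (hP' : Differentiable ℝ (deriv P))
    {L : ℝ} (hL : ∀ v, |deriv (deriv P) v| ≤ L) (b c : ℝ) :
    |P b - P c - deriv P c * (b - c)| ≤ L * (b - c) ^ 2 := by
  have hL0 : 0 ≤ L := (abs_nonneg _).trans (hL 0)
  have key := (convex_uIcc c b).norm_image_sub_le_of_norm_hasDerivWithin_le
    (f := fun y => P y - deriv P c * y) (f' := fun y => deriv P y - deriv P c)
    (C := L * |b - c|) (x := c) (y := b) ?_ ?_ left_mem_uIcc right_mem_uIcc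
  · rw [Real.norm_eq_abs, Real.norm_eq_abs, mul_assoc, ← sq, sq_abs] at key
    refine le_trans (le_of_eq ?_) key
    congr 1; ring
  · intro y _
    have := (hP y).hasDerivAt.sub ((hasDerivAt_id y).const_mul (deriv P c))
    rw [mul_one] at this
    exact this.hasDerivWithinAt
  · intro y hy
    refine (abs_sub_le_of_abs_deriv_le hP' hL y c).trans ?_
    exact mul_le_mul_of_nonneg_left (abs_sub_left_of_mem_uIcc hy) hL0

/-- Weak differentiability at `t` bounds the difference quotients against each fixed `φ`, so by
Banach–Steinhaus they are bounded in norm: the curve is Lipschitz at `t` in `L²`. -/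
theorem exists_integral_sq_sub_le {α : Type*} [MeasurableSpace α] {μ : Measure α} {I : Set ℝ}
    (hI : IsOpen I) {u : ℝ → α → ℝ} (hu : ∀ t ∈ I, MemLp (u t) 2 μ) {t : ℝ} (ht : t ∈ I)
    (hdiff : ∀ φ : α → ℝ, MemLp φ 2 μ →
      DifferentiableAt ℝ (fun t' => ∫ x, u t' x * φ x ∂μ) t) :
    ∃ C : ℝ, ∀ᶠ t' in 𝓝 t, t' ∈ I ∧ ∫ x, (u t' x - u t x) ^ 2 ∂μ ≤ C * (t' - t) ^ 2 := by
  by_contra! hcon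
  -- Negating the claim with constant `n²` gives times `τ n → t` whose difference quotients have
  -- norm greater than `n`.
  have h1 : ∀ n : ℕ, ∃ t', t' ∈ I ∧ |t' - t| < 1 / ((n : ℝ) + 1) ∧
      (n : ℝ) ^ 2 * (t' - t) ^ 2 < ∫ x, (u t' x - u t x) ^ 2 ∂μ := by
    intro n
    have hnear : ∀ᶠ t' in 𝓝 t, t' ∈ I ∧ |t' - t| < 1 / ((n : ℝ) + 1) :=
      (hI.eventually_mem ht).and
        (Metric.ball_mem_nhds t (by positivity : (0 : ℝ) < 1 / ((n : ℝ) + 1)))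
    obtain ⟨t', h, h'⟩ := ((hcon ((n : ℝ) ^ 2)).and_eventually hnear).exists
    exact ⟨t', h'.1, h'.2, h h'.1⟩
  choose τ hτI hτ hτC using h1
  have hne : ∀ n, τ n ≠ t := by
    intro n h0
    have := hτC n
    simp [h0] at this
  let U : ℕ → Lp ℝ 2 μ := fun n =>
    (τ n - t)⁻¹ • ((hu _ (hτI n)).toLp _ - (hu t ht).toLp _)
  have hU : ∀ n, (U n : α → ℝ) =ᵐ[μ] fun x => (τ n - t)⁻¹ * (u (τ n) x - u t x) := by
    intro n
    filter_upwards [Lp.coeFn_smul (τ n - t)⁻¹ ((hu _ (hτI n)).toLp _ - (hu t ht).toLp _),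
      Lp.coeFn_sub ((hu _ (hτI n)).toLp _) ((hu t ht).toLp _), (hu _ (hτI n)).coeFn_toLp,
      (hu t ht).coeFn_toLp] with x h1 h2 h3 h4
    simp only [U, h1, Pi.smul_apply, h2, Pi.sub_apply, h3, h4, smul_eq_mul]
  have hτt : Tendsto τ atTop (𝓝[≠] t) := by
    refine tendsto_nhdsWithin_iff.2 ⟨?_, Eventually.of_forall hne⟩
    rw [tendsto_iff_dist_tendsto_zero]
    exact squeeze_zero (fun _ => dist_nonneg) (fun n => (hτ n).le)
      tendsto_one_div_add_atTop_nhds_zero_nat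
  obtain ⟨C, hC⟩ := banach_steinhaus (g := fun n => innerSL ℝ (U n)) fun φ => by
    have hφ : MemLp (φ : α → ℝ) 2 μ := Lp.memLp φ
    have hlim := (hasDerivAt_iff_tendsto_slope.1 (hdiff φ hφ).hasDerivAt).comp hτt
    obtain ⟨C, hC⟩ := (Metric.isBounded_range_of_tendsto _ hlim).exists_norm_le
    refine ⟨C, fun n => ?_⟩
    refine le_trans (le_of_eq ?_) (hC _ (mem_range_self n))
    congr 1
    simp only [innerSL_apply_apply, L2.inner_def, Function.comp_def, slope, vsub_eq_sub,
      smul_eq_mul]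
    have i1 : Integrable (fun x => u (τ n) x * (φ : α → ℝ) x) μ :=
      (hu _ (hτI n)).integrable_mul hφ
    have i2 : Integrable (fun x => u t x * (φ : α → ℝ) x) μ := (hu t ht).integrable_mul hφ
    rw [← integral_sub i1 i2, ← integral_const_mul]
    refine integral_congr_ae ?_
    filter_upwards [hU n] with x hx
    rw [hx]; simp; ring
  have hnorm : ∀ n : ℕ, (n : ℝ) ^ 2 < ‖U n‖ ^ 2 := by
    intro n
    rw [← real_inner_self_eq_norm_sq, L2.inner_def]
    have : ∫ x, inner ℝ ((U n : α → ℝ) x) ((U n : α → ℝ) x) ∂μ =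
        ((τ n - t) ^ 2)⁻¹ * ∫ x, (u (τ n) x - u t x) ^ 2 ∂μ := by
      rw [← integral_const_mul]
      refine integral_congr_ae ?_
      filter_upwards [hU n] with x hx
      rw [hx, real_inner_self_eq_norm_sq, Real.norm_eq_abs, sq_abs, mul_pow, inv_pow]
    rw [this, lt_inv_mul_iff₀ (by have := sub_ne_zero.2 (hne n); positivity), mul_comm]
    exact hτC n
  obtain ⟨n, hn⟩ := exists_nat_gt C
  have h2 := hC n
  rw [innerSL_apply_norm] at h2
  have h3 := hnorm n
  have h4 : ‖U n‖ ^ 2 ≤ (n : ℝ) ^ 2 :=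
    pow_le_pow_left₀ (norm_nonneg _) (h2.trans hn.le) 2
  linarith

/-- The chain rule for `t ↦ ∫ ω P(u_t)` along a weakly differentiable curve in `L²`. -/
theorem hasDerivAt_integral_comp {α : Type*} [MeasurableSpace α] {μ : Measure α}
    [IsFiniteMeasure μ] {I : Set ℝ}
    (hI : IsOpen I) {u : ℝ → α → ℝ} (hu : ∀ t ∈ I, MemLp (u t) 2 μ) {t : ℝ} (ht : t ∈ I)
    (hdiff : ∀ φ : α → ℝ, MemLp φ 2 μ →
      DifferentiableAt ℝ (fun t' => ∫ x, u t' x * φ x ∂μ) t)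
    {ω : α → ℝ} (hω : AEStronglyMeasurable ω μ) {c : ℝ} (hc0 : 0 ≤ c) (hc : ∀ x, |ω x| ≤ c)
    {P : ℝ → ℝ} (hP : ContDiff ℝ ((⊤ : ℕ∞) : WithTop ℕ∞) P) {L : ℝ}
    (hL : ∀ v, |deriv P v| ≤ L) {L' : ℝ} (hL' : ∀ v, |deriv (deriv P) v| ≤ L') :
    HasDerivAt (fun t' => ∫ x, ω x * P (u t' x) ∂μ)
      (deriv (fun t' => ∫ x, u t' x * (ω x * deriv P (u t x)) ∂μ) t) t := by
  have hPd : Differentiable ℝ P := hP.differentiable (by simp)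
  have hP'c : Continuous (deriv P) := hP.continuous_deriv (by simp)
  have hP'd : Differentiable ℝ (deriv P) :=
    (contDiff_infty_iff_deriv.1 hP).2.differentiable (by simp)
  have hmeas : AEStronglyMeasurable (fun x => ω x * deriv P (u t x)) μ :=
    hω.mul (hP'c.comp_aestronglyMeasurable (hu t ht).1)
  have hφ : MemLp (fun x => ω x * deriv P (u t x)) 2 μ := by
    refine MemLp.of_bound hmeas (c * L) (ae_of_all _ fun x => ?_)
    rw [norm_mul]
    exact mul_le_mul (hc x) (hL _) (norm_nonneg _) hc0
  have hint : ∀ t' ∈ I, Integrable (fun x => ω x * P (u t' x)) μ := by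
    intro t' ht'
    have h1 : Integrable (fun x => |L| * |u t' x| + |P 0|) μ :=
      (((hu t' ht').integrable (by norm_num)).abs.const_mul _).add (integrable_const _)
    refine (h1.const_mul c).mono'
      (hω.mul (hP.continuous.comp_aestronglyMeasurable (hu t' ht').1)) (ae_of_all _ fun x => ?_)
    rw [norm_mul]
    refine mul_le_mul (hc x) ?_ (norm_nonneg _) hc0
    have h2 := abs_sub_le_of_abs_deriv_le hPd hL (u t' x) 0
    rw [sub_zero] at h2
    have h3 : L * |u t' x| ≤ |L| * |u t' x| := by gcongr; exact le_abs_self L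
    have h4 := abs_sub_abs_le_abs_sub (P (u t' x)) (P 0)
    rw [Real.norm_eq_abs]; linarith
  have hint2 : ∀ t' ∈ I, Integrable (fun x => u t' x * (ω x * deriv P (u t x))) μ :=
    fun t' ht' => (hu t' ht').integrable_mul hφ
  obtain ⟨C, hC⟩ := exists_integral_sq_sub_le hI hu ht hdiff
  set H := fun t' => ∫ x, ω x * P (u t' x) ∂μ
  set J := fun t' => ∫ x, u t' x * (ω x * deriv P (u t x)) ∂μ
  have hJ : HasDerivAt J (deriv J t) t := (hdiff _ hφ).hasDerivAt
  -- `J` linearises `P` at `u t` and is differentiable by assumption. The difference of the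
  -- increments is an integrated Taylor remainder, quadratic in `t' - t` by the `L²` Lipschitz
  -- bound.
  have hD : HasDerivAt (fun t' => H t' - J t' - (H t - J t)) 0 t := by
    have hO : (fun t' => H t' - J t' - (H t - J t)) =O[𝓝 t] fun t' => ‖t' - t‖ ^ 2 := by
      refine Asymptotics.IsBigO.of_bound (c * L' * C) ?_
      filter_upwards [hC] with t' ⟨ht', hC'⟩
      have hcL : 0 ≤ c * L' := mul_nonneg hc0 ((abs_nonneg _).trans (hL' 0))
      have hint4 : Integrable (fun x => (u t' x - u t x) ^ 2) μ :=
        ((hu t' ht').sub (hu t ht)).integrable_sq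
      have e1 : H t' - J t' - (H t - J t) = ∫ x, ω x * (P (u t' x) - P (u t x) -
          deriv P (u t x) * (u t' x - u t x)) ∂μ := by
        simp only [H, J]
        have i1 : ∀ s ∈ I, Integrable
            (fun x => ω x * P (u s x) - u s x * (ω x * deriv P (u t x))) μ :=
          fun s hs => (hint s hs).sub (hint2 s hs)
        rw [← integral_sub (hint t' ht') (hint2 t' ht'), ← integral_sub (hint t ht) (hint2 t ht),
          ← integral_sub (i1 t' ht') (i1 t ht)]
        refine integral_congr_ae (ae_of_all _ fun x => ?_)
        simp only; ring
      rw [e1, norm_pow, norm_norm, Real.norm_eq_abs (t' - t), sq_abs]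
      calc ‖∫ x, ω x * (P (u t' x) - P (u t x) - deriv P (u t x) * (u t' x - u t x)) ∂μ‖
          ≤ ∫ x, c * L' * (u t' x - u t x) ^ 2 ∂μ := by
            refine norm_integral_le_of_norm_le (hint4.const_mul _) (ae_of_all _ fun x => ?_)
            rw [norm_mul, mul_assoc]
            exact mul_le_mul (hc x) (abs_taylor_le hPd hP'd hL' _ _) (norm_nonneg _)
              hc0
        _ = c * L' * ∫ x, (u t' x - u t x) ^ 2 ∂μ := integral_const_mul _ _
        _ ≤ c * L' * (C * (t' - t) ^ 2) := by gcongr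
        _ = c * L' * C * (t' - t) ^ 2 := by ring
    exact (hO.hasFDerivAt one_lt_two).hasDerivAt
  have := hD.add hJ
  rw [zero_add] at this
  have h2 := this.add_const (H t - J t)
  refine h2.congr_of_eventuallyEq (Eventually.of_forall fun t' => ?_)
  simp only [Pi.add_apply]; ring

/-! ### Weighted Sobolev inequality -/

/-- The constant of the Gagliardo–Nirenberg–Sobolev inequality for the exponent
`2 q / (q + 1)`. -/
def gnsConst (d : ℕ) (q : ℝ≥0∞) : NNReal :=
  SNormLESNormFDerivOfEqConst ℝ (volume : Measure (Rd d)) (2 / (1 + (q⁻¹).toReal))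

variable {d : ℕ} {p q : ℝ≥0∞} {a : Rd d → Matrix (Fin d) (Fin d) ℝ} {lam Lam : Rd d → ℝ}

theorem gagliardo_nirenberg (hA : Admissible d p q) {G : Set (Rd d)} {f : Rd d → ℝ}
    (hf : IsTestFunction G f) :
    (∫⁻ x, ‖f x‖ₑ ^ rho q d) ^ (1 / rho q d) ≤ gnsConst d q *
      (∫⁻ x, ‖gradient f x‖ₑ ^ (2 / (1 + (q⁻¹).toReal))) ^ ((1 + (q⁻¹).toReal) / 2) := by
  have hy0 : 0 ≤ (q⁻¹).toReal := ENNReal.toReal_nonneg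
  have hy1 := hA.q_lt_one
  set y := (q⁻¹).toReal with hy
  have hρ := hA.rho_pos
  have hd : 0 < d := by have := hA.two_le; omega
  set s : NNReal := ⟨2 / (1 + y), by positivity⟩ with hs
  have hs' : (s : ℝ) = 2 / (1 + y) := rfl
  set ρ : NNReal := ⟨rho q d, hρ.le⟩ with hρ'
  have hρ'' : (ρ : ℝ) = rho q d := rfl
  have h1s : 1 ≤ s := by
    rw [← NNReal.coe_le_coe, hs', NNReal.coe_one, le_div_iff₀ (by linarith)]; linarith
  have h1 := eLpNorm_le_eLpNorm_fderiv_of_eq (F := ℝ) (E := Rd d) volume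
    (hf.1.of_le (by exact_mod_cast le_top)) hf.2.1 (p := s) (p' := ρ) h1s
    (by simpa using hd) (by
      rw [NNReal.coe_inv, hs', hρ'', finrank_euclideanSpace, Fintype.card_fin]
      have := hA.two_div_rho
      rw [← hy] at this
      have h2 : (rho q d)⁻¹ = (2 / rho q d) / 2 := by field_simp
      rw [h2, this, inv_div]; field_simp; ring)
  have hρ0 : (ρ : ℝ≥0∞) ≠ 0 := by
    have : (0 : NNReal) < ρ := hρ
    exact_mod_cast this.ne'
  have hs0 : (s : ℝ≥0∞) ≠ 0 := by
    have : (0 : NNReal) < s := one_pos.trans_le h1s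
    exact_mod_cast this.ne'
  rw [eLpNorm_eq_lintegral_rpow_enorm_toReal hρ0 (by simp),
    eLpNorm_eq_lintegral_rpow_enorm_toReal hs0 (by simp)] at h1
  simp only [ENNReal.coe_toReal, hρ'', hs'] at h1
  have h3 : ∀ x, ‖fderiv ℝ f x‖ₑ = ‖gradient f x‖ₑ := fun x => by
    rw [← ofReal_norm, ← ofReal_norm, norm_gradient]
  simp only [h3, one_div_div] at h1
  exact h1

/-- Write `|∇f|^(2e) = (λ |∇f|²)^e (λ⁻¹)^e` with `e = 1/(1 + 1/q)`. Since `1 - e/q = e`, Hölder puts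
`λ⁻¹` in `L^q`, and lower ellipticity bounds the other factor by the energy. -/
theorem sobolev_testFunction (ha : IsCoefficient p q a lam Lam) (hA : Admissible d p q)
    {z : Rd d} {r : ℝ} {f : Rd d → ℝ} (hf : IsTestFunction (Metric.ball z r) f) :
    (∫⁻ x, ‖f x‖ₑ ^ rho q d) ^ (2 / rho q d) ≤ (gnsConst d q : ℝ≥0∞) ^ (2 : ℝ) *
      (eLpNorm (invWeight lam) q (volume.restrict (Metric.ball z r)) *
        formSq a (gradient f)) := by
  have hy0 : 0 ≤ (q⁻¹).toReal := ENNReal.toReal_nonneg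
  have h1 := gagliardo_nirenberg hA hf
  set y := (q⁻¹).toReal with hy
  have h2 := ENNReal.rpow_le_rpow h1 (zero_le_two (α := ℝ))
  rw [← ENNReal.rpow_mul, ENNReal.mul_rpow_of_nonneg _ _ zero_le_two, ← ENNReal.rpow_mul,
    one_div_mul_eq_div, div_mul_cancel₀ _ two_ne_zero] at h2
  refine h2.trans ?_
  gcongr
  set e : ℝ := 1 / (1 + y) with he
  have he0 : 0 < e := by positivity
  have hey : 1 - e * y = e := by rw [he]; field_simp; ring
  set G := Metric.ball z r
  have hgm : AEStronglyMeasurable (gradient f) volume :=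
    hf.continuous_gradient.aestronglyMeasurable
  have hFm : Measurable fun x => ENNReal.ofReal (lam x) * ‖gradient f x‖ₑ ^ (2 : ℝ) :=
    ha.measurable_lam.ennreal_ofReal.mul (hf.continuous_gradient.measurable.enorm.pow_const _)
  have h3 : ∫⁻ x, ‖gradient f x‖ₑ ^ (2 / (1 + y)) ≤
      (∫⁻ x in G, ENNReal.ofReal (lam x) * ‖gradient f x‖ₑ ^ (2 : ℝ)) ^ e *
        eLpNorm (invWeight lam) q (volume.restrict G) ^ e := by
    have hset : ∫⁻ x, ‖gradient f x‖ₑ ^ (2 / (1 + y)) =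
        ∫⁻ x in G, ‖gradient f x‖ₑ ^ (2 / (1 + y)) := by
      refine (setLIntegral_eq_of_support_subset fun x hx => ?_).symm
      by_contra hxG
      refine hx ?_
      simp only
      rw [hf.gradient_eq_zero fun h => hxG (hf.2.2 h)]
      simp; positivity
    rw [hset]
    have := lintegral_rpow_mul_rpow_le (μ := volume.restrict G) hFm.aemeasurable
      (measurable_invWeight ha.measurable_lam).aemeasurable hA.one_le_q (e := e) he0
      (by rw [← hy]; linarith)
    rw [← hy, hey] at this
    refine le_trans (le_of_eq (lintegral_congr_ae ?_)) this
    filter_upwards [ae_restrict_of_ae (ha.lam_pos hA.one_le_q)] with x hx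
    have h0 : ENNReal.ofReal (lam x) ≠ 0 := by simpa using hx
    rw [ENNReal.mul_rpow_of_nonneg _ _ he0.le, mul_right_comm, invWeight,
      ← ENNReal.mul_rpow_of_nonneg _ _ he0.le, ENNReal.mul_inv_cancel h0 ENNReal.ofReal_ne_top,
      ENNReal.one_rpow, one_mul, ← ENNReal.rpow_mul]
    congr 1
    rw [he]; ring
  have h4 := ENNReal.rpow_le_rpow h3 (z := 1 + y) (by linarith)
  rw [ENNReal.mul_rpow_of_nonneg _ _ (by linarith), ← ENNReal.rpow_mul, ← ENNReal.rpow_mul,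
    show e * (1 + y) = 1 by rw [he]; field_simp, ENNReal.rpow_one, ENNReal.rpow_one] at h4
  refine h4.trans ?_
  rw [mul_comm]
  gcongr
  refine (setLIntegral_le_lintegral _ _).trans (lintegral_mono_ae ?_)
  filter_upwards [ha.ellipticity] with x hx
  refine le_trans (le_of_eq ?_) (ENNReal.ofReal_le_ofReal (hx _).1)
  rw [ENNReal.ofReal_mul (ha.lam_nonneg x), ENNReal.ofReal_pow (norm_nonneg _), ofReal_norm]
  norm_cast

/-- Fatou along an almost everywhere convergent approximating sequence. The extra factor `2` is the
price of comparing `∇(f n)` with `h` by `formSq_add_le`. -/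
theorem HasFormGradient.sobolev (ha : IsCoefficient p q a lam Lam) (hA : Admissible d p q)
    {z : Rd d} {r : ℝ} {w : Rd d → ℝ} {h : Rd d → Rd d}
    (hw : HasFormGradient a Lam (Metric.ball z r) w h) :
    (∫⁻ x, ‖w x‖ₑ ^ rho q d) ^ (2 / rho q d) ≤ (gnsConst d q : ℝ≥0∞) ^ (2 : ℝ) *
      (eLpNorm (invWeight lam) q (volume.restrict (Metric.ball z r)) * (2 * formSq a h)) := by
  obtain ⟨f, hf, -, hlim, hae⟩ := hw.exists_seq ha hA
  have hρ := hA.rho_pos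
  set N := eLpNorm (invWeight lam) q (volume.restrict (Metric.ball z r))
  have hN : N ≠ ∞ := (eLpNorm_ball_lt_top ha.limsup_lam z r).ne
  set E := (gnsConst d q : ℝ≥0∞) ^ (2 : ℝ) with hE'
  have hE : E ≠ ∞ := ENNReal.rpow_ne_top_of_nonneg zero_le_two ENNReal.coe_ne_top
  have h1 : ∀ n, ∫⁻ x, ‖f n x‖ₑ ^ rho q d ≤
      (E * (N * (2 * (formSq a (fun x => gradient (f n) x - h x) + formSq a h))))
        ^ (rho q d / 2) := by
    intro n
    have hm : AEStronglyMeasurable (fun x => gradient (f n) x - h x) volume :=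
      (hf n).continuous_gradient.aestronglyMeasurable.sub hw.2.1
    have h2 := ha.formSq_add_le hm h
    simp only [sub_add_cancel] at h2
    have h3 : (∫⁻ x, ‖f n x‖ₑ ^ rho q d) ^ (2 / rho q d) ≤
      E * (N * (2 * (formSq a (fun x => gradient (f n) x - h x) + formSq a h))) := by
      refine (sobolev_testFunction ha hA (hf n)).trans ?_
      gcongr
    have h4 := ENNReal.rpow_le_rpow h3 (z := rho q d / 2) (by positivity)
    rwa [← ENNReal.rpow_mul, show 2 / rho q d * (rho q d / 2) = 1 by field_simp,
      ENNReal.rpow_one] at h4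
  have h5 : Tendsto (fun n =>
      (E * (N * (2 * (formSq a (fun x => gradient (f n) x - h x) + formSq a h))))
        ^ (rho q d / 2)) atTop (𝓝 ((E * (N * (2 * (0 + formSq a h)))) ^ (rho q d / 2))) := by
    refine ((ENNReal.continuous_rpow_const).tendsto _).comp ?_
    refine ENNReal.Tendsto.const_mul ?_ (Or.inr hE)
    refine ENNReal.Tendsto.const_mul ?_ (Or.inr hN)
    refine ENNReal.Tendsto.const_mul ?_ (Or.inr (by simp))
    exact hlim.add tendsto_const_nhds
  have h6 : ∫⁻ x, ‖w x‖ₑ ^ rho q d ≤ (E * (N * (2 * (0 + formSq a h)))) ^ (rho q d / 2) := by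
    calc ∫⁻ x, ‖w x‖ₑ ^ rho q d = ∫⁻ x, liminf (fun n => ‖f n x‖ₑ ^ rho q d) atTop := by
          refine lintegral_congr_ae ?_
          filter_upwards [hae] with x hx
          refine (Tendsto.liminf_eq ?_).symm
          exact ((ENNReal.continuous_rpow_const).tendsto _).comp
            ((continuous_enorm.tendsto _).comp hx)
      _ ≤ liminf (fun n => ∫⁻ x, ‖f n x‖ₑ ^ rho q d) atTop :=
          lintegral_liminf_le fun n => (hf n).1.continuous.measurable.enorm.pow_const _
      _ ≤ liminf (fun n => (E * (N * (2 * (formSq a (fun x => gradient (f n) x - h x) +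
            formSq a h)))) ^ (rho q d / 2)) atTop := liminf_le_liminf (Eventually.of_forall h1)
      _ = _ := h5.liminf_eq
  have h7 := ENNReal.rpow_le_rpow h6 (z := 2 / rho q d) (by positivity)
  rwa [← ENNReal.rpow_mul, show rho q d / 2 * (2 / rho q d) = 1 by field_simp,
      ENNReal.rpow_one, zero_add] at h7

/-- Hölder with `Λ` in `L^p` turns the unweighted exponent `ρ` into `ρ (1 - 1/p) = 2/(2 - ν)`. -/
theorem HasFormGradient.weighted_sobolev (ha : IsCoefficient p q a lam Lam)
    (hA : Admissible d p q) {z : Rd d} {r : ℝ} {w : Rd d → ℝ} {h : Rd d → Rd d}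
    (hw : HasFormGradient a Lam (Metric.ball z r) w h) :
    (∫⁻ x in Metric.ball z r, ‖w x‖ₑ ^ (2 / codim d p q) ∂(weightedMeasure Lam)) ^ codim d p q ≤
      2 * (gnsConst d q : ℝ≥0∞) ^ (2 : ℝ) *
      (eLpNorm (invWeight lam) q (volume.restrict (Metric.ball z r)) *
        eLpNorm (weight Lam) p (volume.restrict (Metric.ball z r)) ^ codim d p q) *
      formSq a h := by
  have hm := hA.codim_pos
  have hρ := hA.rho_pos
  have hwm := hw.aestronglyMeasurable ha hA
  have hx1 := hA.p_lt_one
  have h1 := lintegral_rpow_mul_rpow_le (μ := volume.restrict (Metric.ball z r))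
    (F := fun x => ‖w x‖ₑ ^ rho q d) (W := weight Lam) (hwm.restrict.enorm.pow_const _)
    (measurable_weight ha.measurable_Lam).aemeasurable hA.one_le_p one_pos (by linarith)
  simp only [one_mul, ENNReal.rpow_one] at h1
  have hexp : rho q d * (1 - (p⁻¹).toReal) = 2 / codim d p q := by
    rw [eq_div_iff hm.ne', ← hA.codim_mul_rho]; ring
  have hexp2 : (1 - (p⁻¹).toReal) * codim d p q = 2 / rho q d := by
    rw [eq_div_iff hρ.ne', ← hA.codim_mul_rho]; ring
  simp only [← ENNReal.rpow_mul, hexp] at h1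
  rw [ha.setLIntegral_weightedMeasure measurableSet_ball]
  have h2 := ENNReal.rpow_le_rpow h1 hm.le
  rw [ENNReal.mul_rpow_of_nonneg _ _ hm.le, ← ENNReal.rpow_mul, hexp2] at h2
  refine h2.trans ?_
  have h3 : (∫⁻ x in Metric.ball z r, ‖w x‖ₑ ^ rho q d) ^ (2 / rho q d) ≤ _ :=
    (ENNReal.rpow_le_rpow (setLIntegral_le_lintegral _ _) (by positivity)).trans
      (hw.sobolev ha hA)
  refine (mul_le_mul_left h3 _).trans (le_of_eq ?_)
  ring

/-! ### The Caccioppoli inequality -/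

theorem IsCoefficient.integrable_bilin_self (ha : IsCoefficient p q a lam Lam)
    {g : Rd d → Rd d} (hg : AEStronglyMeasurable g volume) (hfin : formSq a g < ∞) :
    Integrable (fun x => bilin (a x) (g x) (g x)) := by
  refine ⟨(ha.aemeasurable_bilin hg hg).aestronglyMeasurable, ?_⟩
  rw [hasFiniteIntegral_iff_ofReal]
  · exact hfin
  · filter_upwards [ha.bilin_nonneg] with x hx using hx _

theorem IsCoefficient.toReal_formSq (ha : IsCoefficient p q a lam Lam)
    {g : Rd d → Rd d} (hg : AEStronglyMeasurable g volume) :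
    (formSq a g).toReal = ∫ x, bilin (a x) (g x) (g x) := by
  rw [integral_eq_lintegral_of_nonneg_ae
    (by filter_upwards [ha.bilin_nonneg] with x hx using hx _)
    (ha.aemeasurable_bilin hg hg).aestronglyMeasurable]
  rfl

theorem IsCoefficient.integrable_bilin (ha : IsCoefficient p q a lam Lam)
    {g h : Rd d → Rd d} (hg : AEStronglyMeasurable g volume) (hgfin : formSq a g < ∞)
    (hh : AEStronglyMeasurable h volume) (hhfin : formSq a h < ∞) :
    Integrable (fun x => bilin (a x) (g x) (h x)) := by
  refine ((ha.integrable_bilin_self hg hgfin).add (ha.integrable_bilin_self hh hhfin)).mono'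
    (ha.aemeasurable_bilin hg hh).aestronglyMeasurable ?_
  filter_upwards [ha.bilin_nonneg] with x hx
  exact abs_bilin_le (ha.symm x) hx _ _

/-- `∫_G ω P(u_t) Λ dx` for the regularised power `P(v) = (v + ε) ^ β`. -/
def regMass (Lam : Rd d → ℝ) (G : Set (Rd d)) (ε β : ℝ) (u : ℝ → Rd d → ℝ) (ω : Rd d → ℝ)
    (t : ℝ) : ℝ :=
  ∫ x in G, ω x * regPow ε β (u t x) ∂(weightedMeasure Lam)

theorem IsSupercaloric.hasDerivAt_regMass (ha : IsCoefficient p q a lam Lam) (hp : 1 ≤ p)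
    {I : Set ℝ} (hI : IsOpen I) {z : Rd d} {r : ℝ} {u : ℝ → Rd d → ℝ}
    (hu : IsSupercaloric a Lam I (Metric.ball z r) u) {ε β : ℝ} (hε : 0 < ε) (hβ : β ≤ 1)
    {ω : Rd d → ℝ} (hω : AEStronglyMeasurable ω (weightedMeasure Lam)) {c : ℝ} (hc0 : 0 ≤ c)
    (hc : ∀ x, |ω x| ≤ c) {t : ℝ} (ht : t ∈ I) :
    HasDerivAt (regMass Lam (Metric.ball z r) ε β u ω)
      (deriv (fun t' => innerG Lam (Metric.ball z r) (u t')
        (fun x => ω x * deriv (regPow ε β) (u t x))) t) t := by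
  obtain ⟨L, hL⟩ := exists_abs_deriv_regPow_le hε β hβ
  obtain ⟨L', hL'⟩ := exists_abs_deriv_deriv_regPow_le hε β hβ
  have : IsFiniteMeasure ((weightedMeasure Lam).restrict (Metric.ball z r)) :=
    ⟨by simpa using ha.weightedMeasure_ball_lt_top hp z r⟩
  refine hasDerivAt_integral_comp hI (fun t' ht' => ?_) ht (fun φ hφ => hu.1 φ hφ t ht)
    hω.restrict hc0 hc (contDiff_regPow hε β) hL hL'
  obtain ⟨g, hg, -⟩ := hu.2 t' ht'
  exact hg.1.restrict _

theorem integrable_regPow_comp {α : Type*} [MeasurableSpace α] {μ : Measure α}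
    [IsFiniteMeasure μ] {ε β : ℝ} (hε : 0 < ε) (hβ : β ≤ 1) {v : α → ℝ} (hv : MemLp v 2 μ) :
    Integrable (fun x => regPow ε β (v x)) μ := by
  obtain ⟨L, hL⟩ := exists_abs_deriv_regPow_le hε β hβ
  have h3 : Integrable (fun x => L * |v x| + |regPow ε β 0|) μ :=
    (((hv.integrable (by norm_num)).abs.const_mul _).add (integrable_const _))
  refine h3.mono' ((contDiff_regPow hε β).continuous.comp_aestronglyMeasurable hv.1)
    (ae_of_all _ fun x => ?_)
  have h2 := abs_sub_le_of_abs_deriv_le ((contDiff_regPow hε β).differentiable (by simp))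
    hL (v x) 0
  rw [sub_zero] at h2
  have h4 := abs_sub_abs_le_abs_sub (regPow ε β (v x)) (regPow ε β 0)
  rw [Real.norm_eq_abs]; linarith

/-- Here `ξ = ∇u`, `ζ = ∇η`, `y = u + ε`. With `Y = y^(β/2) ζ` and `X` the other part of `∇(η
y^(β/2))`, the tested term is `4⟨X,Y⟩ - (4(1-β)/β)⟨X,X⟩`, hence at most `4⟨X,Y⟩ - 4k⟨X,X⟩`. Young's
inequality spends `2k⟨X,X⟩` on the cross term, and the remaining `2k⟨X,X⟩` pays for `k⟨X+Y,X+Y⟩`. -/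
theorem bilin_caccioppoli {A : Matrix (Fin d) (Fin d) ℝ} (hA : A.IsSymm)
    (hpos : ∀ ξ, 0 ≤ bilin A ξ ξ) {k β y η : ℝ} (hβ : 0 < β) (hk : 0 < k) (hkβ : k * β ≤ 1 - β)
    (hy : 0 < y) (ξ ζ : Rd d) :
    bilin A ξ ((β * y ^ (β - 1)) • ((2 * η) • ζ) +
        (η ^ 2 * (β * (β - 1) * y ^ (β - 2))) • ξ) +
      k * bilin A (y ^ (β / 2) • ζ + (η * (β / 2 * y ^ (β / 2 - 1))) • ξ)
        (y ^ (β / 2) • ζ + (η * (β / 2 * y ^ (β / 2 - 1))) • ξ) ≤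
      (2 * k + 2 / k) * (y ^ β * bilin A ζ ζ) := by
  set s := y ^ (β / 2) with hs
  have e1 : y ^ β = s ^ 2 := by
    rw [hs, ← Real.rpow_natCast, ← Real.rpow_mul hy.le]; congr 1; push_cast; ring
  have e2 : y ^ (β / 2 - 1) = s * y⁻¹ := by rw [Real.rpow_sub_one hy.ne']; rfl
  have e3 : y ^ (β - 1) = s ^ 2 * y⁻¹ := by rw [Real.rpow_sub_one hy.ne', e1]; rfl
  have e4 : y ^ (β - 2) = s ^ 2 * y⁻¹ ^ 2 := by
    rw [show β - 2 = β - 1 - 1 by ring, Real.rpow_sub_one hy.ne', e3, div_eq_mul_inv]; ring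
  rw [e1, e2, e3, e4]
  set X : Rd d := (η * (β / 2 * (s * y⁻¹))) • ξ with hX
  set Y : Rd d := s • ζ with hY
  have h1 := two_mul_bilin_le hA hpos hk X Y
  have h2 := mul_le_mul_of_nonneg_left (bilin_add_self_le hA hpos Y X) hk.le
  have hXX : bilin A X X = (η * (β / 2 * (s * y⁻¹))) ^ 2 * bilin A ξ ξ := by
    rw [hX, bilin_smul_left, bilin_smul_right]; ring
  have hXY : bilin A X Y = (η * (β / 2 * (s * y⁻¹))) * s * bilin A ξ ζ := by
    rw [hX, hY, bilin_smul_left, bilin_smul_right]; ring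
  have hYY : bilin A Y Y = s ^ 2 * bilin A ζ ζ := by
    rw [hY, bilin_smul_left, bilin_smul_right]; ring
  have h3 : bilin A ξ ((β * (s ^ 2 * y⁻¹)) • ((2 * η) • ζ) +
        (η ^ 2 * (β * (β - 1) * (s ^ 2 * y⁻¹ ^ 2))) • ξ) ≤ 4 * bilin A X Y - 4 * k * bilin A X X := by
    rw [hXX, hXY, bilin_add_right, bilin_smul_right, bilin_smul_right, bilin_smul_right]
    have h4 := mul_le_mul_of_nonneg_right hkβ
      (mul_nonneg (by positivity : 0 ≤ β * (η * s * y⁻¹) ^ 2) (hpos ξ))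
    nlinarith [h4]
  rw [← hYY]
  have : k⁻¹ = 1 / k := by simp
  rw [this] at h1
  have h5 : (2 * k + 2 / k) * bilin A Y Y = 2 * k * bilin A Y Y + 2 * (1 / k * bilin A Y Y) := by
    ring
  rw [h5]
  linarith

theorem IsSupercaloric.caccioppoli (ha : IsCoefficient p q a lam Lam) (hA : Admissible d p q)
    {I : Set ℝ} (hI : IsOpen I) {z : Rd d} {r : ℝ} {u : ℝ → Rd d → ℝ}
    (hu : IsSupercaloric a Lam I (Metric.ball z r) u)
    (hpos : ∀ t ∈ I, ∀ᵐ x, x ∈ Metric.ball z r → 0 < u t x)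
    {ε β k ℓ : ℝ} (hε : 0 < ε) (hβ : 0 < β) (hk : 0 < k) (hkβ : k * β ≤ 1 - β)
    {η : Rd d → ℝ} (hη : IsTestFunction (Metric.ball z r) η)
    (hℓ : ∀ x, ‖gradient η x‖ ≤ ℓ) {K : Set (Rd d)} (hK : MeasurableSet K)
    (hKη : tsupport η ⊆ K) (hKG : K ⊆ Metric.ball z r) {t : ℝ} (ht : t ∈ I) :
    ∃ h, HasFormGradient a Lam (Metric.ball z r) (fun x => η x * regPow ε (β / 2) (u t x)) h ∧
      k * (formSq a h).toReal ≤
        deriv (regMass Lam (Metric.ball z r) ε β u (fun x => η x ^ 2)) t +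
        (2 * k + 2 / k) * ℓ ^ 2 *
          regMass Lam (Metric.ball z r) ε β u (K.indicator fun _ => 1) t := by
  set G := Metric.ball z r with hG
  have hβ1 : β ≤ 1 := by nlinarith
  obtain ⟨g, hg, hsuper⟩ := hu.2 t ht
  obtain ⟨L, hL⟩ := exists_abs_deriv_regPow_le hε (β / 2) (by linarith)
  obtain ⟨L', hL'⟩ := exists_abs_deriv_deriv_regPow_le hε β hβ1
  have hw := hg.mul_comp ha hA hη (contDiff_regPow hε (β / 2)) hL
  have hφ := hg.mul_comp ha hA hη.sq (contDiff_deriv_regPow hε β) hL'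
  refine ⟨_, hw, ?_⟩
  set hw' := fun x => regPow ε (β / 2) (u t x) • gradient η x +
    (η x * deriv (regPow ε (β / 2)) (u t x)) • g x with hw'_def
  set hφ' := fun x => deriv (regPow ε β) (u t x) • gradient (fun x => η x ^ 2) x +
    (η x ^ 2 * deriv (deriv (regPow ε β)) (u t x)) • g x with hφ'_def
  have hη0 : ∀ x, x ∉ K → η x = 0 := fun x hx =>
    image_eq_zero_of_notMem_tsupport fun h => hx (hKη h)
  have hη0' : ∀ x, x ∉ K → gradient η x = 0 := fun x hx =>
    hη.gradient_eq_zero fun h => hx (hKη h)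
  have hφ0 : ∀ᵐ x, 0 ≤ η x ^ 2 * deriv (regPow ε β) (u t x) := by
    filter_upwards [hpos t ht] with x hx
    by_cases hxG : x ∈ G
    · have h0 := hx hxG
      rw [deriv_regPow_eq hε β h0]; positivity
    · rw [hη0 x fun h => hxG (hKG h)]; simp
  have h1 := hsuper _ _ hφ hφ0
  obtain ⟨c, hc0, hc⟩ := hη.sq.exists_abs_le
  -- With the test function `η² P'(u t)`, `P = regPow ε β`, the weak time derivative is the
  -- derivative of the mass.
  have hderiv := (hu.hasDerivAt_regMass ha hA.one_le_p hI hε hβ1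
    (ω := fun x => η x ^ 2) hη.sq.1.continuous.aestronglyMeasurable hc0 hc ht).deriv
  rw [← hderiv] at h1
  have hgf := hg.formSq_lt_top ha hA.one_le_p
  have hwf := hw.formSq_lt_top ha hA.one_le_p
  have hφf := hφ.formSq_lt_top ha hA.one_le_p
  have hfin : IsFiniteMeasure ((weightedMeasure Lam).restrict G) :=
    ⟨by simpa using ha.weightedMeasure_ball_lt_top hA.one_le_p z r⟩
  have hPint : Integrable (fun x => K.indicator (fun _ => (1 : ℝ)) x * regPow ε β (u t x))
      (weightedMeasure Lam) := by
    have h2 : IntegrableOn (fun x => regPow ε β (u t x)) G (weightedMeasure Lam) :=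
      integrable_regPow_comp hε hβ1 (hg.1.restrict G)
    have h4 := (h2.mono_set hKG).integrable_indicator hK
    refine h4.congr (ae_of_all _ fun x => ?_)
    by_cases hx : x ∈ K <;> simp [hx]
  have hmass : regMass Lam G ε β u (K.indicator fun _ => 1) t =
      ∫ x, Lam x * (K.indicator (fun _ => (1 : ℝ)) x * regPow ε β (u t x)) := by
    unfold regMass
    rw [setIntegral_eq_integral_of_forall_compl_eq_zero, weightedMeasure,
      integral_withDensity_eq_integral_toReal_smul (measurable_weight ha.measurable_Lam)
        (ae_of_all _ fun x => by simp [weight])]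
    · refine integral_congr_ae (ae_of_all _ fun x => ?_)
      simp [weight, ENNReal.toReal_ofReal (ha.Lam_nonneg x)]
    · intro x hx
      have : x ∉ K := fun h => hx (hKG h)
      simp [this]
  have hint : Integrable
      (fun x => Lam x * (K.indicator (fun _ => (1 : ℝ)) x * regPow ε β (u t x))) := by
    rw [weightedMeasure, integrable_withDensity_iff_integrable_smul'
      (measurable_weight ha.measurable_Lam) (ae_of_all _ fun x => by simp [weight])] at hPint
    refine hPint.congr (ae_of_all _ fun x => ?_)
    simp [weight, ENNReal.toReal_ofReal (ha.Lam_nonneg x)]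
  have i1 := ha.integrable_bilin hg.2.1 hgf hφ.2.1 hφf
  have i2 := ha.integrable_bilin_self hw.2.1 hwf
  have key : energy a g hφ' + k * (formSq a hw').toReal ≤ (2 * k + 2 / k) * ℓ ^ 2 *
      regMass Lam G ε β u (K.indicator fun _ => 1) t := by
    rw [energy, ha.toReal_formSq hw.2.1, hmass, ← integral_const_mul, ← integral_const_mul,
      ← integral_add i1 (i2.const_mul k)]
    refine integral_mono_ae (i1.add (i2.const_mul k)) (hint.const_mul _) ?_
    filter_upwards [hpos t ht, ha.bilin_nonneg, ha.ellipticity] with x hx hb hell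
    simp only [hφ'_def, hw'_def]
    by_cases hxK : x ∈ K
    · have h0 := hx (hKG hxK)
      have hy : 0 < u t x + ε := by linarith
      rw [deriv_regPow_eq hε β h0, deriv_deriv_regPow_eq hε β h0, deriv_regPow_eq hε _ h0,
        regPow_of_nonneg hε _ h0.le, regPow_of_nonneg hε _ h0.le, hη.gradient_sq]
      refine (bilin_caccioppoli (ha.symm x) hb hβ hk hkβ hy _ _).trans ?_
      rw [indicator_of_mem hxK, one_mul, mul_assoc]
      refine mul_le_mul_of_nonneg_left ?_ (by positivity)
      have h5 := (hell (gradient η x)).2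
      have h6 : ‖gradient η x‖ ^ 2 ≤ ℓ ^ 2 := pow_le_pow_left₀ (norm_nonneg _) (hℓ x) 2
      have h7 : bilin (a x) (gradient η x) (gradient η x) ≤ Lam x * ℓ ^ 2 :=
        h5.trans (mul_le_mul_of_nonneg_left h6 (ha.Lam_nonneg x))
      calc (u t x + ε) ^ β * bilin (a x) (gradient η x) (gradient η x)
          ≤ (u t x + ε) ^ β * (Lam x * ℓ ^ 2) :=
            mul_le_mul_of_nonneg_left h7 (Real.rpow_nonneg hy.le _)
        _ = _ := by ring
    · have h8 : bilin (a x) (g x) (0 : Rd d) = 0 := by simp [bilin]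
      have h9 : bilin (a x) (0 : Rd d) (0 : Rd d) = 0 := by simp [bilin]
      rw [hη.gradient_sq, hη0 x hxK, hη0' x hxK]
      simp [hxK, h8, h9]
  linarith

/-! ### A Gronwall-type estimate -/

/-- `Z(t) = W(t) + C ∫_{t₁}^t A` is nondecreasing. For `t ≤ T` compare `Z(t)` with `Z(s)`, `s ∈ [T,
T']`, and average over `s`; this replaces a cut-off in time. The same bound for `Z(T)` controls the
integral of `Z'`, because `Z(t₁) ≥ 0`. -/
theorem mass_le_and_integral_le {W W' A : ℝ → ℝ} {I : Set ℝ} (hI : IsOpen I) {C t₁ T T' : ℝ}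
    (hC : 0 ≤ C) (ht : t₁ ≤ T) (hT : T < T') (hsub : Icc t₁ T' ⊆ I)
    (hW : ∀ t ∈ I, HasDerivAt W (W' t) t) (hA : ContinuousOn A I) (hW0 : ∀ t ∈ I, 0 ≤ W t)
    (hWA : ∀ t ∈ I, W t ≤ A t) (hR : ∀ t ∈ I, 0 ≤ W' t + C * A t) :
    (∀ t ∈ Icc t₁ T, W t ≤ (1 / (T' - T) + C) * ∫ s in t₁..T', A s) ∧
      IntervalIntegrable (fun t => W' t + C * A t) volume t₁ T ∧
      ∫ t in t₁..T, (W' t + C * A t) ≤ (1 / (T' - T) + C) * ∫ s in t₁..T', A s := by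
  have hA0 : ∀ t ∈ I, 0 ≤ A t := fun t h => (hW0 t h).trans (hWA t h)
  have hAc : ContinuousOn A (Icc t₁ T') := hA.mono hsub
  have hint : ∀ {b c : ℝ}, t₁ ≤ b → b ≤ c → c ≤ T' → IntervalIntegrable A volume b c := by
    intro b c hb hbc hc
    refine (hAc.mono ?_).intervalIntegrable
    rw [uIcc_of_le hbc]; exact Icc_subset_Icc hb hc
  set Z : ℝ → ℝ := fun t => W t + C * ∫ s in t₁..t, A s with hZ
  have hZd : ∀ t ∈ Icc t₁ T', HasDerivAt Z (W' t + C * A t) t := by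
    intro t ht'
    refine (hW t (hsub ht')).add (HasDerivAt.const_mul C ?_)
    exact intervalIntegral.integral_hasDerivAt_right (hint le_rfl ht'.1 ht'.2)
      (hA.stronglyMeasurableAtFilter hI t (hsub ht')) (hA.continuousAt (hI.mem_nhds (hsub ht')))
  have hZmono : MonotoneOn Z (Icc t₁ T') := by
    refine monotoneOn_of_deriv_nonneg (convex_Icc _ _)
      (fun t h => (hZd t h).continuousAt.continuousWithinAt) ?_ ?_
    · intro t h
      exact (hZd t (interior_subset h)).differentiableAt.differentiableWithinAt
    · intro t h
      rw [(hZd t (interior_subset h)).deriv]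
      exact hR t (hsub (interior_subset h))
  have hI0 : ∀ t ∈ Icc t₁ T', 0 ≤ ∫ s in t₁..t, A s := fun t h =>
    intervalIntegral.integral_nonneg h.1 fun s hs => hA0 s (hsub ⟨hs.1, hs.2.trans h.2⟩)
  have hsplit : ∀ t ∈ Icc t₁ T', (∫ s in t₁..t, A s) + ∫ s in t..T', A s = ∫ s in t₁..T', A s :=
    fun t h => intervalIntegral.integral_add_adjacent_intervals (hint le_rfl h.1 h.2)
      (hint h.1 h.2 le_rfl)
  have hrest : ∀ t ∈ Icc t₁ T', 0 ≤ ∫ s in t..T', A s := fun t h =>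
    intervalIntegral.integral_nonneg h.2 fun s hs => hA0 s (hsub ⟨h.1.trans hs.1, hs.2⟩)
  have hZM : ∀ t ∈ Icc t₁ T, Z t ≤ (1 / (T' - T) + C) * ∫ s in t₁..T', A s := by
    intro t ht'
    have hpos : 0 < T' - T := sub_pos.2 hT
    set D := ∫ s in t₁..T', A s
    have h1 : ∀ s ∈ Icc T T', Z t ≤ A s + C * D := by
      intro s hs
      have hs' : s ∈ Icc t₁ T' := ⟨ht.trans hs.1, hs.2⟩
      refine (hZmono ⟨ht'.1, ht'.2.trans hT.le⟩ hs' (ht'.2.trans hs.1)).trans ?_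
      have h2 := hsplit s hs'
      have h3 := hrest s hs'
      exact add_le_add (hWA s (hsub hs')) (mul_le_mul_of_nonneg_left (by linarith) hC)
    have h2 : ∫ _ in T..T', Z t ≤ ∫ s in T..T', (A s + C * D) :=
      intervalIntegral.integral_mono_on hT.le (by simp)
        ((hint ht hT.le le_rfl).add (by simp)) h1
    rw [intervalIntegral.integral_add (hint ht hT.le le_rfl) (by simp),
      intervalIntegral.integral_const, intervalIntegral.integral_const, smul_eq_mul,
      smul_eq_mul] at h2
    have h3 : ∫ s in T..T', A s ≤ D := by
      have := hsplit T ⟨ht, hT.le⟩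
      have := hI0 T ⟨ht, hT.le⟩
      linarith
    rw [add_mul, one_div, ← sub_le_iff_le_add, le_inv_mul_iff₀ hpos]
    linarith
  -- `W'` is not known to be continuous; integrability comes from `Z' ≥ 0`.
  have hii : IntervalIntegrable (fun t => W' t + C * A t) volume t₁ T := by
    refine intervalIntegral.intervalIntegrable_deriv_of_nonneg (g := Z) ?_ ?_ ?_
    · rw [uIcc_of_le ht]
      exact fun t h => (hZd t ⟨h.1, h.2.trans hT.le⟩).continuousAt.continuousWithinAt
    · rw [min_eq_left ht, max_eq_right ht]
      exact fun t h => hZd t ⟨h.1.le, h.2.le.trans hT.le⟩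
    · rw [min_eq_left ht, max_eq_right ht]
      exact fun t h => hR t (hsub ⟨h.1.le, h.2.le.trans hT.le⟩)
  refine ⟨fun t ht' => ?_, ?_, ?_⟩
  · refine le_trans ?_ (hZM t ht')
    have := hI0 t ⟨ht'.1, ht'.2.trans hT.le⟩
    simp only [hZ]
    have := mul_nonneg hC this
    linarith
  · exact hii
  · rw [intervalIntegral.integral_eq_sub_of_hasDerivAt (f := Z) ?_ hii]
    · have h1 := hZM T ⟨ht, le_rfl⟩
      have h2 : 0 ≤ Z t₁ := by
        simp only [hZ, intervalIntegral.integral_same, mul_zero, add_zero]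
        exact hW0 _ (hsub ⟨le_rfl, ht.trans hT.le⟩)
      linarith
    · rw [uIcc_of_le ht]
      exact fun t h => hZd t ⟨h.1, h.2.trans hT.le⟩

/-! ### Cut-off functions -/

theorem exists_abs_deriv_smoothTransition_le :
    ∃ c : ℝ, 0 < c ∧ ∀ v, |deriv Real.smoothTransition v| ≤ c := by
  have hc : Continuous (deriv Real.smoothTransition) :=
    (Real.smoothTransition.contDiff (n := 1)).continuous_deriv (by simp)
  obtain ⟨L, hL⟩ := isCompact_Icc (a := (0 : ℝ)) (b := 1) |>.exists_bound_of_continuousOn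
    hc.continuousOn
  refine ⟨max L 1, by positivity, fun v => ?_⟩
  rcases lt_or_ge v 0 with h | h
  · have : Real.smoothTransition =ᶠ[𝓝 v] fun _ => 0 := by
      filter_upwards [gt_mem_nhds h] with y hy
        using Real.smoothTransition.zero_of_nonpos (le_of_lt hy)
    rw [this.deriv_eq]; simp
  rcases lt_or_ge 1 v with h' | h'
  · have : Real.smoothTransition =ᶠ[𝓝 v] fun _ => 1 := by
      filter_upwards [lt_mem_nhds h'] with y hy
        using Real.smoothTransition.one_of_one_le (le_of_lt hy)
    rw [this.deriv_eq]; simp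
  · exact (hL v ⟨h, h'⟩).trans (by simp)

/-- A bound for the derivative of `Real.smoothTransition`. -/
def transitionBound : ℝ := exists_abs_deriv_smoothTransition_le.choose

theorem transitionBound_pos : 0 < transitionBound :=
  exists_abs_deriv_smoothTransition_le.choose_spec.1

theorem abs_deriv_smoothTransition_le (v : ℝ) :
    |deriv Real.smoothTransition v| ≤ transitionBound :=
  exists_abs_deriv_smoothTransition_le.choose_spec.2 v

/-- The profile is a function of `|x - z|²`, so it is smooth at the centre; the factor `ρ₁ + ρ₂`
cancels in the gradient bound. The third radius gives compact support inside an open ball. -/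
theorem exists_cutoff {d : ℕ} (z : Rd d) {ρ₁ ρ₂ ρ₃ : ℝ} (h0 : 0 < ρ₁) (h12 : ρ₁ < ρ₂)
    (h23 : ρ₂ < ρ₃) : ∃ η : Rd d → ℝ, IsTestFunction (Metric.ball z ρ₃) η ∧
      (∀ x, 0 ≤ η x) ∧ (∀ x, η x ≤ 1) ∧ (∀ x ∈ Metric.ball z ρ₁, η x = 1) ∧
      ∀ x, ‖gradient η x‖ ≤ 2 * transitionBound / (ρ₂ - ρ₁) := by
  have hD : 0 < ρ₂ ^ 2 - ρ₁ ^ 2 := by nlinarith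
  set φ : Rd d → ℝ := fun x => (ρ₂ ^ 2 - ‖x - z‖ ^ 2) / (ρ₂ ^ 2 - ρ₁ ^ 2) with hφ
  have hφc : ContDiff ℝ ((⊤ : ℕ∞) : WithTop ℕ∞) φ :=
    (contDiff_const.sub ((contDiff_id.sub contDiff_const).norm_sq ℝ)).div_const _
  set η : Rd d → ℝ := fun x => Real.smoothTransition (φ x) with hη
  have hzero : ∀ x, ρ₂ ≤ ‖x - z‖ → η x = 0 := by
    intro x hx
    refine Real.smoothTransition.zero_of_nonpos (div_nonpos_of_nonpos_of_nonneg ?_ hD.le)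
    have : ρ₂ ^ 2 ≤ ‖x - z‖ ^ 2 := pow_le_pow_left₀ (by linarith) hx 2
    linarith
  have hsupp : tsupport η ⊆ Metric.closedBall z ρ₂ := by
    refine closure_minimal (fun x hx => ?_) Metric.isClosed_closedBall
    rw [Metric.mem_closedBall, dist_eq_norm]
    by_contra! h
    exact hx (hzero x h.le)
  have htest : IsTestFunction (Metric.ball z ρ₃) η :=
    ⟨Real.smoothTransition.contDiff.comp hφc,
      HasCompactSupport.of_support_subset_isCompact (isCompact_closedBall z ρ₂)
        ((subset_tsupport _).trans hsupp),
      hsupp.trans (Metric.closedBall_subset_ball h23)⟩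
  refine ⟨η, htest,
    fun x => Real.smoothTransition.nonneg _, fun x => Real.smoothTransition.le_one _,
    fun x hx => ?_, fun x => ?_⟩
  · refine Real.smoothTransition.one_of_one_le ?_
    rw [Metric.mem_ball, dist_eq_norm] at hx
    rw [one_le_div hD]
    have : ‖x - z‖ ^ 2 ≤ ρ₁ ^ 2 := pow_le_pow_left₀ (norm_nonneg _) hx.le 2
    linarith
  · have hbnd : 0 ≤ 2 * transitionBound / (ρ₂ - ρ₁) :=
      div_nonneg (by linarith [transitionBound_pos]) (by linarith)
    by_cases hx : x ∈ tsupport η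
    · have hx2 : ‖x - z‖ ≤ ρ₂ := by
        have := hsupp hx
        rwa [Metric.mem_closedBall, dist_eq_norm] at this
      have h1 : HasFDerivAt (fun y : Rd d => ‖y - z‖ ^ 2) (2 • innerSL ℝ (x - z)) x := by
        have := (hasStrictFDerivAt_norm_sq (x - z)).hasFDerivAt.comp x
          ((hasFDerivAt_id x).sub_const z)
        rw [ContinuousLinearMap.comp_id] at this
        exact this
      have h2 : HasFDerivAt φ ((ρ₂ ^ 2 - ρ₁ ^ 2)⁻¹ • (-(2 • innerSL ℝ (x - z) : Rd d →L[ℝ] ℝ))) x := by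
        have := (h1.const_sub (ρ₂ ^ 2)).const_smul ((ρ₂ ^ 2 - ρ₁ ^ 2)⁻¹)
        refine this.congr_of_eventuallyEq (Eventually.of_forall fun y => ?_)
        simp [hφ, div_eq_inv_mul]
      have h3 : HasDerivAt Real.smoothTransition (deriv Real.smoothTransition (φ x)) (φ x) :=
        ((Real.smoothTransition.contDiff (n := 1)).differentiable (by simp) _).hasDerivAt
      have h4 := h3.comp_hasFDerivAt x h2
      rw [norm_gradient, HasFDerivAt.fderiv (f := η) h4, norm_smul, norm_smul, norm_neg,
        two_smul, ← two_smul ℝ, norm_smul, innerSL_apply_norm, Real.norm_eq_abs,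
        Real.norm_of_nonneg (inv_nonneg.2 hD.le), Real.norm_ofNat]
      calc |deriv Real.smoothTransition (φ x)| * ((ρ₂ ^ 2 - ρ₁ ^ 2)⁻¹ * (2 * ‖x - z‖))
          ≤ transitionBound * ((ρ₂ ^ 2 - ρ₁ ^ 2)⁻¹ * (2 * (ρ₂ + ρ₁))) := by
            gcongr
            · exact transitionBound_pos.le
            · exact abs_deriv_smoothTransition_le _
            · linarith
        _ = 2 * transitionBound / (ρ₂ - ρ₁) := by
            have e1 : ρ₂ ^ 2 - ρ₁ ^ 2 = (ρ₂ - ρ₁) * (ρ₂ + ρ₁) := by ring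
            have e2 : ρ₂ - ρ₁ ≠ 0 := by linarith
            have e3 : ρ₂ + ρ₁ ≠ 0 := by linarith
            rw [e1]; field_simp
    · rw [htest.gradient_eq_zero hx]; simpa using hbnd

/-! ### One step of the Moser iteration -/

/-- The constant of the weighted Sobolev inequality on a ball. -/
def ballSobolevConst (p q : ℝ≥0∞) (lam Lam : Rd d → ℝ) (G : Set (Rd d)) : ℝ≥0∞ :=
  2 * (gnsConst d q : ℝ≥0∞) ^ (2 : ℝ) *
      (eLpNorm (invWeight lam) q (volume.restrict G) *
        eLpNorm (weight Lam) p (volume.restrict G) ^ codim d p q)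

/-- Put `w = η (v + ε)^(β/2)`. Hölder between `L²` and `L^(2/m)`, `m = 2 - ν`, with weights `1 - m`
and `m` yields the exponent `2(1 - m) + 2 = 2ν`, and `w² ≥ v^β` where `η = 1`. -/
theorem lintegral_rpow_nu_le (ha : IsCoefficient p q a lam Lam) (hA : Admissible d p q)
    {z : Rd d} {r : ℝ} {v : Rd d → ℝ} {h : Rd d → Rd d} {ε β : ℝ} (hε : 0 < ε) (hβ : 0 < β)
    (hβ1 : β ≤ 1) {η : Rd d → ℝ} {B : Set (Rd d)} (hBm : MeasurableSet B)
    (hB : B ⊆ Metric.ball z r) (hη1 : ∀ x ∈ B, η x = 1) (hηc : Continuous η) {c : ℝ}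
    (hηb : ∀ x, |η x| ≤ c)
    (hv : MemLp v 2 (weightedMeasure Lam)) (hpos : ∀ᵐ x, x ∈ Metric.ball z r → 0 < v x)
    (hw : HasFormGradient a Lam (Metric.ball z r) (fun x => η x * regPow ε (β / 2) (v x)) h) :
    ∫⁻ x in B, ‖v x‖ₑ ^ (β * nu d p q) ∂(weightedMeasure Lam) ≤
      ENNReal.ofReal (∫ x in Metric.ball z r, η x ^ 2 * regPow ε β (v x) ∂(weightedMeasure Lam))
        ^ (nu d p q - 1) * (ballSobolevConst p q lam Lam (Metric.ball z r) * formSq a h) := by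
  set G := Metric.ball z r
  set μ := weightedMeasure Lam
  set w := fun x => η x * regPow ε (β / 2) (v x) with hw_def
  have hm := hA.codim_pos
  have hm1 := hA.codim_lt_one
  have hν : nu d p q - 1 = 1 - codim d p q := by rw [nu_eq]; ring
  have hfin : IsFiniteMeasure (μ.restrict G) :=
    ⟨by simpa using ha.weightedMeasure_ball_lt_top hA.one_le_p z r⟩
  have hposμ : ∀ᵐ x ∂μ, x ∈ G → 0 < v x :=
    (IsCoefficient.weightedMeasure_absolutelyContinuous Lam).ae_le hpos
  have hwm : AEMeasurable w (μ.restrict G) := hw.1.1.aemeasurable.restrict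
  have hsq : ∀ x, 0 < v x → w x ^ 2 = η x ^ 2 * regPow ε β (v x) := by
    intro x hx
    have h0 : 0 ≤ v x + ε := by linarith
    simp only [hw_def]
    rw [mul_pow, regPow_of_nonneg hε _ hx.le, regPow_of_nonneg hε _ hx.le,
      ← Real.rpow_natCast ((v x + ε) ^ (β / 2)), ← Real.rpow_mul h0]
    congr 2; push_cast; ring
  have hL2 : ∫⁻ x in G, ‖w x‖ₑ ^ (2 : ℝ) ∂μ =
      ENNReal.ofReal (∫ x in G, η x ^ 2 * regPow ε β (v x) ∂μ) := by
    rw [ofReal_integral_eq_lintegral_ofReal]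
    · refine lintegral_congr_ae ?_
      filter_upwards [ae_restrict_of_ae hposμ, ae_restrict_mem measurableSet_ball] with x hx hxG
      rw [← hsq x (hx hxG), ← sq_abs, ENNReal.ofReal_pow (abs_nonneg _), ← Real.norm_eq_abs,
        ofReal_norm]
      norm_cast
    · refine (integrable_regPow_comp hε hβ1 (hv.restrict G)).bdd_mul
        (hηc.pow 2).aestronglyMeasurable (c := c ^ 2) (ae_of_all _ fun x => ?_)
      rw [Real.norm_eq_abs, abs_pow]
      exact pow_le_pow_left₀ (abs_nonneg _) (hηb x) 2
    · filter_upwards [ae_restrict_of_ae hposμ, ae_restrict_mem measurableSet_ball] with x hx hxG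
      rw [← hsq x (hx hxG)]; positivity
  have hS := hw.weighted_sobolev ha hA
  have hH := ENNReal.lintegral_mul_norm_pow_le (μ := μ.restrict G)
    (f := fun x => ‖w x‖ₑ ^ (2 : ℝ)) (g := fun x => ‖w x‖ₑ ^ (2 / codim d p q))
    (hwm.enorm.pow_const _) (hwm.enorm.pow_const _) (p := 1 - codim d p q)
    (q := codim d p q) (by linarith) hm.le (by ring)
  rw [hν, ← hL2]
  refine le_trans ?_ (hH.trans (by gcongr; exact hS))
  refine (lintegral_mono_ae ?_).trans (lintegral_mono_set (f := fun x =>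
    (‖w x‖ₑ ^ (2 : ℝ)) ^ (1 - codim d p q) * (‖w x‖ₑ ^ (2 / codim d p q)) ^ codim d p q) hB)
  filter_upwards [ae_restrict_of_ae hposμ, ae_restrict_mem hBm] with x hx hxB
  have h0 := hx (hB hxB)
  rw [← ENNReal.rpow_mul, ← ENNReal.rpow_mul, ← ENNReal.rpow_add_of_nonneg _ _
    (by nlinarith) (by positivity), div_mul_cancel₀ _ hm.ne']
  have e1 : 2 * (1 - codim d p q) + 2 = 2 * nu d p q := by rw [nu_eq]; ring
  rw [e1, ENNReal.rpow_mul, ENNReal.rpow_mul]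
  refine ENNReal.rpow_le_rpow ?_ (by rw [nu_eq]; linarith)
  have h2 : v x ^ β ≤ w x ^ 2 := by
    rw [hsq x h0, hη1 x hxB, one_pow, one_mul, regPow_of_nonneg hε _ h0.le]
    exact Real.rpow_le_rpow h0.le (by linarith) hβ.le
  calc ‖v x‖ₑ ^ β = ENNReal.ofReal (v x ^ β) := by
        rw [← ENNReal.ofReal_rpow_of_pos h0, ← Real.enorm_of_nonneg h0.le]
    _ ≤ ENNReal.ofReal (w x ^ 2) := ENNReal.ofReal_le_ofReal h2
    _ = ‖w x‖ₑ ^ (2 : ℝ) := by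
        rw [← sq_abs, ENNReal.ofReal_pow (abs_nonneg _), ← Real.norm_eq_abs, ofReal_norm]
        norm_cast

/-- Intermediate exponents are needed because the iteration must land exactly on `α₀/ν`, whatever
`α` is. -/
theorem lintegral_rpow_interpolate {α : Type*} [MeasurableSpace α] {μ : Measure α} {f : α → ℝ≥0∞}
    (hf : AEMeasurable f μ) {β ν b : ℝ} (hβ : 0 ≤ β) (hν : 0 ≤ ν) (hb0 : 0 ≤ b) (hb1 : b ≤ 1) :
    ∫⁻ x, f x ^ (β * (1 + (ν - 1) * b)) ∂μ ≤
      (∫⁻ x, f x ^ β ∂μ) ^ (1 - b) * (∫⁻ x, f x ^ (β * ν) ∂μ) ^ b := by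
  refine le_trans (le_of_eq ?_) (ENNReal.lintegral_mul_norm_pow_le (hf.pow_const β)
    (hf.pow_const (β * ν)) (by linarith) hb0 (by ring))
  refine lintegral_congr fun x => ?_
  rw [← ENNReal.rpow_mul, ← ENNReal.rpow_mul, ← ENNReal.rpow_add_of_nonneg _ _
    (mul_nonneg hβ (by linarith)) (by positivity)]
  congr 1; ring

theorem IsSupercaloric.moser_step_aux (ha : IsCoefficient p q a lam Lam) (hA : Admissible d p q)
    {I : Set ℝ} (hI : IsOpen I) {z : Rd d} {r : ℝ} {u : ℝ → Rd d → ℝ}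
    (hu : IsSupercaloric a Lam I (Metric.ball z r) u)
    (hpos : ∀ t ∈ I, ∀ᵐ x, x ∈ Metric.ball z r → 0 < u t x)
    {ε β k ℓ : ℝ} (hε : 0 < ε) (hβ : 0 < β) (hk : 0 < k) (hkβ : k * β ≤ 1 - β)
    {η : Rd d → ℝ} (hη : IsTestFunction (Metric.ball z r) η)
    (hη0 : ∀ x, 0 ≤ η x) (hη1 : ∀ x, η x ≤ 1) (hℓ : ∀ x, ‖gradient η x‖ ≤ ℓ)
    {B K : Set (Rd d)} (hB : MeasurableSet B) (hBη : ∀ x ∈ B, η x = 1) (hK : MeasurableSet K)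
    (hKη : tsupport η ⊆ K) (hKG : K ⊆ Metric.ball z r)
    {t₁ T T' : ℝ} (ht : t₁ ≤ T) (hT : T < T') (hsub : Icc t₁ T' ⊆ I)
    {b : ℝ} (hb0 : 0 ≤ b) (hb1 : b ≤ 1) :
    ∫⁻ t in Ioc t₁ T, ∫⁻ x in B, ‖u t x‖ₑ ^ (β * (1 + (nu d p q - 1) * b))
        ∂(weightedMeasure Lam) ≤
      (ENNReal.ofReal (1 / (T' - T) + (2 * k + 2 / k) * ℓ ^ 2) ^ nu d p q *
        (ballSobolevConst p q lam Lam (Metric.ball z r) * ENNReal.ofReal (1 / k))) ^ b *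
      (∫⁻ t in Ioc t₁ T', ∫⁻ x in K, (‖u t x‖ₑ ^ β + ENNReal.ofReal ε ^ β)
        ∂(weightedMeasure Lam)) ^ (1 + (nu d p q - 1) * b) := by
  set G := Metric.ball z r
  set μ := weightedMeasure Lam with hμ
  set ν := nu d p q with hν
  have hν1 : 1 < ν := hA.one_lt_nu
  have hβ1 : β ≤ 1 := by nlinarith
  set C := (2 * k + 2 / k) * ℓ ^ 2 with hC
  have hC0 : 0 ≤ C := by positivity
  set S := ballSobolevConst p q lam Lam G
  have hBK : B ⊆ K := fun x hx => hKη (subset_tsupport _ (by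
    rw [Function.mem_support, hBη x hx]; exact one_ne_zero))
  have hBG : B ⊆ G := hBK.trans hKG
  have hfin : IsFiniteMeasure (μ.restrict G) :=
    ⟨by simpa using ha.weightedMeasure_ball_lt_top hA.one_le_p z r⟩
  have hmem : ∀ t ∈ I, MemLp (u t) 2 μ := fun t h => (hu.2 t h).choose_spec.1.1
  have hposμ : ∀ t ∈ I, ∀ᵐ x ∂μ, x ∈ G → 0 < u t x := fun t h =>
    (IsCoefficient.weightedMeasure_absolutelyContinuous Lam).ae_le (hpos t h)
  have hPint : ∀ t ∈ I, Integrable (fun x => regPow ε β (u t x)) (μ.restrict G) := fun t h =>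
    integrable_regPow_comp hε hβ1 ((hmem t h).restrict G)
  set W := regMass Lam G ε β u (fun x => η x ^ 2) with hW
  set A := regMass Lam G ε β u (K.indicator fun _ => 1) with hAdef
  have hind : ∀ x, |K.indicator (fun _ => (1 : ℝ)) x| ≤ 1 := fun x => by
    by_cases hx : x ∈ K <;> simp [hx]
  have hη_sq : ∀ x, |η x ^ 2| ≤ 1 := fun x => by
    rw [abs_of_nonneg (by positivity)]; exact pow_le_one₀ (hη0 x) (hη1 x)
  have hAint : ∀ t ∈ I, Integrable
      (fun x => K.indicator (fun _ => (1 : ℝ)) x * regPow ε β (u t x)) (μ.restrict G) :=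
    fun t h => (hPint t h).bdd_mul (measurable_const.indicator hK).aestronglyMeasurable
      (c := 1) (ae_of_all _ hind)
  have hWint : ∀ t ∈ I, Integrable (fun x => η x ^ 2 * regPow ε β (u t x)) (μ.restrict G) :=
    fun t h => (hPint t h).bdd_mul (hη.1.continuous.pow 2).aestronglyMeasurable
      (c := 1) (ae_of_all _ hη_sq)
  have hW' : ∀ t ∈ I, HasDerivAt W (deriv W t) t := fun t h =>
    (hu.hasDerivAt_regMass ha hA.one_le_p hI hε hβ1
      (hη.1.continuous.pow 2).aestronglyMeasurable zero_le_one hη_sq h).differentiableAt.hasDerivAt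
  have hAc : ContinuousOn A I := fun t h =>
    (hu.hasDerivAt_regMass ha hA.one_le_p hI hε hβ1
      (measurable_const.indicator hK).aestronglyMeasurable zero_le_one
      hind h).continuousAt.continuousWithinAt
  have hPpos : ∀ t ∈ I, ∀ᵐ x ∂(μ.restrict G), 0 ≤ regPow ε β (u t x) := by
    intro t h
    filter_upwards [ae_restrict_of_ae (hposμ t h), ae_restrict_mem measurableSet_ball]
      with x hx hxG
    have := hx hxG
    rw [regPow_of_nonneg hε _ this.le]; positivity
  have hW0 : ∀ t ∈ I, 0 ≤ W t := fun t h => by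
    refine integral_nonneg_of_ae ?_
    filter_upwards [hPpos t h] with x hx
    exact mul_nonneg (by positivity) hx
  have hWA : ∀ t ∈ I, W t ≤ A t := fun t h => by
    refine integral_mono_ae (hWint t h) (hAint t h) ?_
    filter_upwards [hPpos t h] with x hx
    refine mul_le_mul_of_nonneg_right ?_ hx
    by_cases hxK : x ∈ K
    · simp only [hxK, indicator_of_mem]; exact (le_abs_self _).trans (hη_sq x)
    · rw [image_eq_zero_of_notMem_tsupport fun h => hxK (hKη h)]; simp [hxK]
  have hcacc := fun t (h : t ∈ I) =>
    hu.caccioppoli ha hA hI hpos hε hβ hk hkβ hη hℓ hK hKη hKG h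
  set R := fun t => deriv W t + C * A t with hRdef
  have hR : ∀ t ∈ I, 0 ≤ R t := fun t h => by
    obtain ⟨h', -, hle⟩ := hcacc t h
    exact le_trans (by positivity) hle
  obtain ⟨hWM, hRint, hRM⟩ := mass_le_and_integral_le hI hC0 ht hT hsub hW' hAc hW0 hWA hR
  set D := ∫ s in t₁..T', A s with hD
  set m := 1 / (T' - T) + C with hm
  have hm0 : 0 ≤ m := by have := sub_pos.2 hT; positivity
  have hsubT : Ioc t₁ T ⊆ I := fun t h => hsub ⟨h.1.le, h.2.trans hT.le⟩
  have hsubT' : Ioc t₁ T' ⊆ I := fun t h => hsub ⟨h.1.le, h.2⟩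
  have hAii : IntervalIntegrable A volume t₁ T' :=
    (hAc.mono (by rw [uIcc_of_le (ht.trans hT.le)]; exact hsub)).intervalIntegrable
  have hDlin : ∫⁻ t in Ioc t₁ T', ENNReal.ofReal (A t) = ENNReal.ofReal D := by
    rw [hD, intervalIntegral.integral_of_le (ht.trans hT.le),
      ofReal_integral_eq_lintegral_ofReal hAii.1]
    filter_upwards [ae_restrict_mem measurableSet_Ioc] with t h
    exact (hW0 t (hsubT' h)).trans (hWA t (hsubT' h))
  have hRlin : ∫⁻ t in Ioc t₁ T, ENNReal.ofReal (R t) ≤ ENNReal.ofReal (m * D) := by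
    rw [← ofReal_integral_eq_lintegral_ofReal hRint.1,
      ← intervalIntegral.integral_of_le ht]
    · exact ENNReal.ofReal_le_ofReal hRM
    · filter_upwards [ae_restrict_mem measurableSet_Ioc] with t h
      exact hR t (hsubT h)
  have hAlin : ∀ t ∈ I, ENNReal.ofReal (A t) =
      ∫⁻ x in K, ENNReal.ofReal (regPow ε β (u t x)) ∂μ := by
    intro t h
    have h1 : A t = ∫ x in K, regPow ε β (u t x) ∂μ := by
      simp only [hAdef, regMass]
      have h2 : ∀ x, K.indicator (fun _ => (1 : ℝ)) x * regPow ε β (u t x) =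
          K.indicator (fun x => regPow ε β (u t x)) x := fun x => by
        by_cases hx : x ∈ K <;> simp [hx]
      simp only [h2]
      rw [setIntegral_indicator hK, inter_eq_self_of_subset_right hKG]
    rw [h1, ofReal_integral_eq_lintegral_ofReal]
    · exact IntegrableOn.mono_set (hPint t h) hKG
    · exact ae_restrict_of_ae_restrict_of_subset hKG (hPpos t h)
  -- Subadditivity of `y ↦ y^β` for `β ≤ 1` separates `ε` from `u`, which makes `ε → 0` immediate
  -- later.
  have hAup : ∀ t ∈ I, ENNReal.ofReal (A t) ≤
      ∫⁻ x in K, (‖u t x‖ₑ ^ β + ENNReal.ofReal ε ^ β) ∂μ := by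
    intro t h
    rw [hAlin t h]
    refine lintegral_mono_ae ?_
    filter_upwards [ae_restrict_of_ae (hposμ t h), ae_restrict_mem hK] with x hx hxK
    have h0 := hx (hKG hxK)
    rw [regPow_of_nonneg hε _ h0.le, ← ENNReal.ofReal_rpow_of_pos (by linarith),
      ENNReal.ofReal_add h0.le hε.le, Real.enorm_of_nonneg h0.le]
    exact ENNReal.rpow_add_le_add_rpow _ _ hβ.le hβ1
  have hAlow : ∀ t ∈ I, ∫⁻ x in B, ‖u t x‖ₑ ^ β ∂μ ≤ ENNReal.ofReal (A t) := by
    intro t h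
    rw [hAlin t h]
    refine le_trans (lintegral_mono_set hBK) (lintegral_mono_ae ?_)
    filter_upwards [ae_restrict_of_ae (hposμ t h), ae_restrict_mem hK] with x hx hxK
    have h0 := hx (hKG hxK)
    rw [regPow_of_nonneg hε _ h0.le, Real.enorm_of_nonneg h0.le, ENNReal.ofReal_rpow_of_pos h0]
    exact ENNReal.ofReal_le_ofReal (Real.rpow_le_rpow h0.le (by linarith) hβ.le)
  -- At fixed time, the mass is replaced by its uniform bound `m D` and the energy by `R t / k`.
  -- Only `A` and `R` still depend on time, and Hölder with weights `1 - b`, `b` integrates them;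
  -- the powers of `D` sum to `(1 - b) + bν`.
  have hpoint : ∀ t ∈ Ioc t₁ T, ∫⁻ x in B, ‖u t x‖ₑ ^ (β * (1 + (ν - 1) * b)) ∂μ ≤
      ENNReal.ofReal (A t) ^ (1 - b) * (ENNReal.ofReal (m * D) ^ (ν - 1) *
        (S * ENNReal.ofReal (1 / k)) * ENNReal.ofReal (R t)) ^ b := by
    intro t ht'
    have htI := hsubT ht'
    refine (lintegral_rpow_interpolate (hmem t htI).1.aemeasurable.restrict.enorm hβ.le
      (by linarith) hb0 hb1).trans ?_
    obtain ⟨h, hw, hle⟩ := hcacc t htI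
    have hhfin := hw.formSq_lt_top ha hA.one_le_p
    have h1 := lintegral_rpow_nu_le ha hA hε hβ hβ1 hB hBG hBη hη.1.continuous (c := 1)
      (fun x => by rw [abs_of_nonneg (hη0 x)]; exact hη1 x) (hmem t htI) (hpos t htI) hw
    have h2 : formSq a h ≤ ENNReal.ofReal (1 / k) * ENNReal.ofReal (R t) := by
      rw [← ENNReal.ofReal_mul (by positivity), ← ENNReal.ofReal_toReal hhfin.ne]
      refine ENNReal.ofReal_le_ofReal ?_
      rw [one_div, le_inv_mul_iff₀ hk]
      exact hle
    refine mul_le_mul' (ENNReal.rpow_le_rpow (hAlow t htI) (by linarith))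
      (ENNReal.rpow_le_rpow (h1.trans ?_) hb0)
    rw [mul_assoc, mul_assoc]
    refine mul_le_mul' (ENNReal.rpow_le_rpow (ENNReal.ofReal_le_ofReal
      (hWM t ⟨ht'.1.le, ht'.2⟩)) (by linarith)) (mul_le_mul' le_rfl h2)
  have hAm : AEMeasurable (fun t => ENNReal.ofReal (A t)) (volume.restrict (Ioc t₁ T)) :=
    ((hAii.1.mono_set (Ioc_subset_Ioc_right hT.le)).aemeasurable).ennreal_ofReal
  have hRm : AEMeasurable (fun t => ENNReal.ofReal (R t)) (volume.restrict (Ioc t₁ T)) :=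
    hRint.1.aemeasurable.ennreal_ofReal
  have hDfinal : ENNReal.ofReal D ≤
      ∫⁻ t in Ioc t₁ T', ∫⁻ x in K, (‖u t x‖ₑ ^ β + ENNReal.ofReal ε ^ β) ∂μ := by
    rw [← hDlin]
    exact setLIntegral_mono' measurableSet_Ioc fun t h => hAup t (hsubT' h)
  calc ∫⁻ t in Ioc t₁ T, ∫⁻ x in B, ‖u t x‖ₑ ^ (β * (1 + (ν - 1) * b)) ∂μ
      ≤ ∫⁻ t in Ioc t₁ T, ENNReal.ofReal (A t) ^ (1 - b) * (ENNReal.ofReal (m * D) ^ (ν - 1) *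
        (S * ENNReal.ofReal (1 / k)) * ENNReal.ofReal (R t)) ^ b :=
        setLIntegral_mono' measurableSet_Ioc hpoint
    _ ≤ (∫⁻ t in Ioc t₁ T, ENNReal.ofReal (A t)) ^ (1 - b) *
        (∫⁻ t in Ioc t₁ T, ENNReal.ofReal (m * D) ^ (ν - 1) *
        (S * ENNReal.ofReal (1 / k)) * ENNReal.ofReal (R t)) ^ b :=
        ENNReal.lintegral_mul_norm_pow_le hAm (hRm.const_mul _) (by linarith) hb0 (by ring)
    _ ≤ ENNReal.ofReal D ^ (1 - b) * (ENNReal.ofReal (m * D) ^ (ν - 1) *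
        (S * ENNReal.ofReal (1 / k)) * ENNReal.ofReal (m * D)) ^ b := by
        rw [lintegral_const_mul'' _ hRm]
        refine mul_le_mul' (ENNReal.rpow_le_rpow ?_ (by linarith))
          (ENNReal.rpow_le_rpow (mul_le_mul' le_rfl hRlin) hb0)
        rw [← hDlin]
        exact lintegral_mono_set (Ioc_subset_Ioc_right hT.le)
    _ = (ENNReal.ofReal m ^ ν * (S * ENNReal.ofReal (1 / k))) ^ b *
        ENNReal.ofReal D ^ (1 + (ν - 1) * b) := by
        have e1 : ENNReal.ofReal (m * D) ^ (ν - 1) * (S * ENNReal.ofReal (1 / k)) *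
            ENNReal.ofReal (m * D) = ENNReal.ofReal m ^ ν * (S * ENNReal.ofReal (1 / k)) *
            ENNReal.ofReal D ^ ν := by
          have : ENNReal.ofReal (m * D) ^ (ν - 1) * ENNReal.ofReal (m * D) =
              ENNReal.ofReal m ^ ν * ENNReal.ofReal D ^ ν := by
            nth_rw 2 [← ENNReal.rpow_one (ENNReal.ofReal (m * D))]
            rw [← ENNReal.rpow_add_of_nonneg _ _ (by linarith) zero_le_one, sub_add_cancel,
              ENNReal.ofReal_mul hm0, ENNReal.mul_rpow_of_nonneg _ _ (by linarith)]
          rw [mul_right_comm, this]; ring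
        rw [e1, ENNReal.mul_rpow_of_nonneg _ _ hb0, ← ENNReal.rpow_mul, mul_left_comm,
          ← ENNReal.rpow_add_of_nonneg _ _ (by linarith) (by positivity)]
        congr 2; ring
    _ ≤ _ := by gcongr

theorem ballSobolevConst_ne_top (ha : IsCoefficient p q a lam Lam) (hA : Admissible d p q)
    (z : Rd d) (r : ℝ) : ballSobolevConst p q lam Lam (Metric.ball z r) ≠ ∞ :=
  ENNReal.mul_ne_top
    (ENNReal.mul_ne_top (by simp) (ENNReal.rpow_ne_top_of_nonneg zero_le_two ENNReal.coe_ne_top))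
    (ENNReal.mul_ne_top (eLpNorm_ball_lt_top ha.limsup_lam z r).ne
      (ENNReal.rpow_ne_top_of_nonneg hA.codim_pos.le (eLpNorm_ball_lt_top ha.limsup_Lam z r).ne))

/-- Monotone exhaustion from the left end. The directed union form requires no measurability of `f`.
-/
theorem le_of_forall_Ioc_lintegral_le {f : ℝ → ℝ≥0∞} {t₀ T : ℝ} {M : ℝ≥0∞}
    (h : ∀ t₁, t₀ < t₁ → t₁ ≤ T → ∫⁻ t in Ioc t₁ T, f t ≤ M) (hT : t₀ < T) :
    ∫⁻ t in Ioo t₀ T, f t ≤ M := by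
  set τ : ℕ → ℝ := fun n => t₀ + (T - t₀) / (n + 1) with hτ
  have hanti : Antitone τ := fun m n hmn => by
    have : (m : ℝ) ≤ n := by exact_mod_cast hmn
    have h0 : 0 ≤ T - t₀ := by linarith
    simp only [hτ]; gcongr
  have hsub : Ioo t₀ T ⊆ ⋃ n, Ioc (τ n) T := by
    intro t ht
    obtain ⟨n, hn⟩ := exists_nat_gt ((T - t₀) / (t - t₀))
    refine mem_iUnion.2 ⟨n, ?_, ht.2.le⟩
    have h1 : 0 < t - t₀ := sub_pos.2 ht.1
    have h2 : (T - t₀) / ((n : ℝ) + 1) < t - t₀ := by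
      rw [div_lt_iff₀ (by positivity)]
      rw [div_lt_iff₀ h1] at hn
      nlinarith
    simp only [hτ]; linarith
  refine (lintegral_mono_set hsub).trans ?_
  rw [setLIntegral_iUnion_of_directed]
  · refine iSup_le fun n => h _ ?_ ?_
    · have : 0 < (T - t₀) / ((n : ℝ) + 1) := div_pos (by linarith) (by positivity)
      simp only [hτ]; linarith
    · have : (T - t₀) / ((n : ℝ) + 1) ≤ T - t₀ := div_le_self (by linarith) (by simp)
      simp only [hτ]; linarith
  · exact Monotone.directed_le fun m n hmn => Ioc_subset_Ioc_left (hanti hmn)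

/-- The auxiliary parameters disappear here: `ε = 1/(n+1) → 0` and `t₁ → t₀`. -/
theorem IsSupercaloric.moser_step_lintegral (ha : IsCoefficient p q a lam Lam)
    (hA : Admissible d p q) {t₀ s : ℝ} {z : Rd d} {r : ℝ} {u : ℝ → Rd d → ℝ}
    (hu : IsSupercaloric a Lam (Ioo t₀ s) (Metric.ball z r) u)
    (hpos : ∀ t ∈ Ioo t₀ s, ∀ᵐ x, x ∈ Metric.ball z r → 0 < u t x)
    {β k : ℝ} (hβ : 0 < β) (hk : 0 < k) (hkβ : k * β ≤ 1 - β)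
    {ρ₁ ρ₂ : ℝ} (hρ₁ : 0 < ρ₁) (hρ : ρ₁ < ρ₂) (hρ₂ : ρ₂ ≤ r)
    {T T' : ℝ} (h0T : t₀ < T) (hT : T < T') (hT's : T' ≤ s)
    {b : ℝ} (hb0 : 0 ≤ b) (hb1 : b ≤ 1) :
    ∫⁻ t in Ioo t₀ T, ∫⁻ x in Metric.ball z ρ₁, ‖u t x‖ₑ ^ (β * (1 + (nu d p q - 1) * b))
        ∂(weightedMeasure Lam) ≤
      (ENNReal.ofReal (2 / (T' - T) + (2 * k + 2 / k) * (4 * transitionBound / (ρ₂ - ρ₁)) ^ 2)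
          ^ nu d p q *
        (ballSobolevConst p q lam Lam (Metric.ball z r) * ENNReal.ofReal (1 / k))) ^ b *
      (∫⁻ t in Ioo t₀ T', ∫⁻ x in Metric.ball z ρ₂, ‖u t x‖ₑ ^ β
        ∂(weightedMeasure Lam)) ^ (1 + (nu d p q - 1) * b) := by
  set ν := nu d p q
  have hν1 : 1 < ν := hA.one_lt_nu
  have hν0 : 0 ≤ ν := by linarith
  set μ := weightedMeasure Lam with hμ
  -- The midpoints leave room for the support of the cut-off and keep the closed time interval below
  -- `s` even if `T' = s`. They account for the constants `2` and `4` in the bound.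
  set ρ := (ρ₁ + ρ₂) / 2 with hρdef
  set S := (T + T') / 2 with hS
  obtain ⟨η, hη, hη0, hη1, hηB, hηℓ⟩ := exists_cutoff z hρ₁ (ρ₂ := ρ) (ρ₃ := ρ₂)
    (by linarith) (by linarith)
  have hηr : IsTestFunction (Metric.ball z r) η :=
    ⟨hη.1, hη.2.1, hη.2.2.trans (Metric.ball_subset_ball hρ₂)⟩
  have hℓeq : 2 * transitionBound / (ρ - ρ₁) = 4 * transitionBound / (ρ₂ - ρ₁) := by
    have h1 : ρ - ρ₁ = (ρ₂ - ρ₁) / 2 := by rw [hρdef]; ring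
    have h2 : ρ₂ - ρ₁ ≠ 0 := by linarith
    rw [h1]; field_simp; ring
  have hSeq : 1 / (S - T) = 2 / (T' - T) := by
    have h1 : S - T = (T' - T) / 2 := by rw [hS]; ring
    have h2 : T' - T ≠ 0 := by linarith
    rw [h1]; field_simp
  rw [hℓeq] at hηℓ
  set Q := (ENNReal.ofReal (2 / (T' - T) +
      (2 * k + 2 / k) * (4 * transitionBound / (ρ₂ - ρ₁)) ^ 2) ^ ν *
        (ballSobolevConst p q lam Lam (Metric.ball z r) * ENNReal.ofReal (1 / k))) ^ b with hQ
  have hQtop : Q ≠ ∞ := ENNReal.rpow_ne_top_of_nonneg hb0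
    (ENNReal.mul_ne_top (ENNReal.rpow_ne_top_of_nonneg hν0 ENNReal.ofReal_ne_top)
      (ENNReal.mul_ne_top (ballSobolevConst_ne_top ha hA z r) ENNReal.ofReal_ne_top))
  refine le_of_forall_Ioc_lintegral_le (fun t₁ ht₁ ht₁T => ?_) h0T
  have hsub : Icc t₁ S ⊆ Ioo t₀ s := fun t h =>
    ⟨ht₁.trans_le h.1, h.2.trans_lt (by rw [hS]; linarith)⟩
  have hstep : ∀ n : ℕ, ∫⁻ t in Ioc t₁ T, ∫⁻ x in Metric.ball z ρ₁,
      ‖u t x‖ₑ ^ (β * (1 + (ν - 1) * b)) ∂μ ≤ Q *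
      ((∫⁻ t in Ioo t₀ T', ∫⁻ x in Metric.ball z ρ₂, ‖u t x‖ₑ ^ β ∂μ) +
        ENNReal.ofReal (1 / ((n : ℝ) + 1)) ^ β * (μ (Metric.ball z ρ₂) *
          volume (Ioo t₀ T'))) ^ (1 + (ν - 1) * b) := by
    intro n
    have h1 := hu.moser_step_aux ha hA isOpen_Ioo hpos (ε := 1 / ((n : ℝ) + 1))
      (by positivity) hβ hk hkβ hηr hη0 hη1 hηℓ measurableSet_ball hηB
      measurableSet_ball hη.2.2 (Metric.ball_subset_ball hρ₂) ht₁T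
      (show T < S by rw [hS]; linarith) hsub hb0 hb1
    rw [hSeq, ← hμ] at h1
    refine h1.trans (mul_le_mul' le_rfl (ENNReal.rpow_le_rpow ?_ (by nlinarith)))
    have hsub' : Ioc t₁ S ⊆ Ioo t₀ T' := fun t h =>
      ⟨ht₁.trans h.1, h.2.trans_lt (by rw [hS]; linarith)⟩
    refine (lintegral_mono_set hsub').trans (le_of_eq ?_)
    have h2 : ∀ t, ∫⁻ x in Metric.ball z ρ₂,
        (‖u t x‖ₑ ^ β + ENNReal.ofReal (1 / ((n : ℝ) + 1)) ^ β) ∂μ =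
        (∫⁻ x in Metric.ball z ρ₂, ‖u t x‖ₑ ^ β ∂μ) +
          ENNReal.ofReal (1 / ((n : ℝ) + 1)) ^ β * μ (Metric.ball z ρ₂) := fun t => by
      rw [lintegral_add_right _ measurable_const, lintegral_const, Measure.restrict_apply_univ]
    simp only [h2]
    rw [lintegral_add_right _ measurable_const, lintegral_const, Measure.restrict_apply_univ,
      mul_assoc]
  have hlim : Tendsto (fun n : ℕ => Q *
      ((∫⁻ t in Ioo t₀ T', ∫⁻ x in Metric.ball z ρ₂, ‖u t x‖ₑ ^ β ∂μ) +
        ENNReal.ofReal (1 / ((n : ℝ) + 1)) ^ β * (μ (Metric.ball z ρ₂) *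
          volume (Ioo t₀ T'))) ^ (1 + (ν - 1) * b)) atTop
      (𝓝 (Q * ((∫⁻ t in Ioo t₀ T', ∫⁻ x in Metric.ball z ρ₂, ‖u t x‖ₑ ^ β ∂μ) + 0 *
        (μ (Metric.ball z ρ₂) * volume (Ioo t₀ T'))) ^ (1 + (ν - 1) * b))) := by
    refine ENNReal.Tendsto.const_mul ?_ (Or.inr hQtop)
    refine ((ENNReal.continuous_rpow_const).tendsto _).comp ?_
    refine tendsto_const_nhds.add (ENNReal.Tendsto.mul_const ?_ (Or.inr ?_))
    · have h1 := ENNReal.tendsto_ofReal tendsto_one_div_add_atTop_nhds_zero_nat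
      have h2 := ((ENNReal.continuous_rpow_const (y := β)).tendsto _).comp h1
      simpa [ENNReal.zero_rpow_of_pos hβ, Function.comp_def] using h2
    · exact ENNReal.mul_ne_top (ha.weightedMeasure_ball_lt_top hA.one_le_p z ρ₂).ne
        (by simp)
  rw [zero_mul, add_zero] at hlim
  exact ge_of_tendsto' hlim hstep

/-! ### Normalisation -/

/-- The base of the constant in the mean value inequality. -/
def moserBase (d : ℕ) (p q : ℝ≥0∞) (lam Lam : Rd d → ℝ) (τ : ℝ) (B : Set (Rd d)) (δ : ℝ) : ℝ≥0∞ :=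
  ENNReal.ofReal (τ * (1 + τ⁻¹) ^ (nu d p q / (nu d p q - 1))) *
    (max 1 (sobolevConst p q lam Lam B) / ENNReal.ofReal (δ ^ 2)) ^ (nu d p q / (nu d p q - 1))

theorem ballSobolevConst_eq (hA : Admissible d p q) (z : Rd d) {r : ℝ} (hr : 0 < r) :
    ballSobolevConst p q lam Lam (Metric.ball z r) = 2 * (gnsConst d q : ℝ≥0∞) ^ (2 : ℝ) *
      (volume (Metric.ball z r) ^ ((q⁻¹).toReal + (p⁻¹).toReal * codim d p q) *
        sobolevConst p q lam Lam (Metric.ball z r)) := by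
  have hx0 : 0 ≤ (p⁻¹).toReal := ENNReal.toReal_nonneg
  have hy0 : 0 ≤ (q⁻¹).toReal := ENNReal.toReal_nonneg
  have hm := hA.codim_pos.le
  rw [ballSobolevConst, eLpNorm_eq_avgNorm hr, eLpNorm_eq_avgNorm hr,
    ENNReal.mul_rpow_of_nonneg _ _ hm, ← ENNReal.rpow_mul,
    ENNReal.rpow_add_of_nonneg _ _ hy0 (by positivity)]
  simp only [sobolevConst, codim]
  ring

theorem volume_ball_rpow (hd : 2 ≤ d) (z : Rd d) {r : ℝ} (hr : 0 < r) :
    volume (Metric.ball z r) ^ (2 / (d : ℝ)) =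
      ENNReal.ofReal (r ^ 2) * volume (Metric.ball (0 : Rd d) 1) ^ (2 / (d : ℝ)) := by
  have hd0 : (d : ℝ) ≠ 0 := by simp; omega
  rw [Measure.addHaar_ball_of_pos _ _ hr, finrank_euclideanSpace, Fintype.card_fin,
    ENNReal.mul_rpow_of_nonneg _ _ (by positivity),
    ENNReal.ofReal_rpow_of_nonneg (by positivity) (by positivity)]
  congr 2
  rw [← Real.rpow_natCast, ← Real.rpow_mul hr.le, mul_div_cancel₀ _ hd0]
  norm_cast

theorem volume_ball_mul (z : Rd d) {σ r : ℝ} (hσ : 0 < σ) :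
    volume (Metric.ball z (σ * r)) = ENNReal.ofReal (σ ^ d) * volume (Metric.ball z r) := by
  rw [Measure.addHaar_ball_mul_of_pos _ _ hσ, finrank_euclideanSpace, Fintype.card_fin,
    ← Measure.addHaar_ball_center _ z]

/-- The constant of a single step, before normalisation. -/
def stepConst (d : ℕ) (p q : ℝ≥0∞) (k : ℝ) : ℝ≥0∞ :=
  ENNReal.ofReal (2 + (2 * k + 2 / k) * (16 * transitionBound ^ 2)) ^ nu d p q *
    (2 * (gnsConst d q : ℝ≥0∞) ^ (2 : ℝ) * volume (Metric.ball (0 : Rd d) 1) ^ (2 / (d : ℝ)) *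
      ENNReal.ofReal (1 / k))

/-- By `volume_exponent` the powers of the volume produce one factor `r²`, so the total power of `r`
is `2(ν - 1) - 2ν + 2 = 0`. -/
theorem volume_mul_const_le (hA : Admissible d p q) (z : Rd d) {r τ δ k : ℝ} (hr : 0 < r)
    (hτ : 0 < τ) (hδ : 0 < δ) (hδ1 : δ ≤ 1) (hk : 0 < k) :
    (ENNReal.ofReal (τ * r ^ 2) * volume (Metric.ball z r)) ^ (nu d p q - 1) *
      (ENNReal.ofReal (2 / (δ * τ * r ^ 2) +
          (2 * k + 2 / k) * (4 * transitionBound / (δ * r)) ^ 2) ^ nu d p q *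
        (ballSobolevConst p q lam Lam (Metric.ball z r) * ENNReal.ofReal (1 / k))) ≤
    stepConst d p q k * moserBase d p q lam Lam τ (Metric.ball z r) δ ^ (nu d p q - 1) := by
  have hν := hA.one_lt_nu
  have hν2 := hA.volume_exponent
  set ν := nu d p q with hνdef
  have hν0 : 0 ≤ ν := by linarith
  have hν1 : 0 ≤ ν - 1 := by linarith
  have hc := transitionBound_pos
  set c := 2 + (2 * k + 2 / k) * (16 * transitionBound ^ 2) with hcdef
  have hc0 : 0 < c := by positivity
  set V := volume (Metric.ball z r) with hV
  set X := sobolevConst p q lam Lam (Metric.ball z r)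
  have hx0 : 0 ≤ (p⁻¹).toReal := ENNReal.toReal_nonneg
  have hy0 : 0 ≤ (q⁻¹).toReal := ENNReal.toReal_nonneg
  have hcod := hA.codim_pos
  have hτ1 : 0 < 1 + τ⁻¹ := by positivity
  have h1 : ENNReal.ofReal (2 / (δ * τ * r ^ 2) +
      (2 * k + 2 / k) * (4 * transitionBound / (δ * r)) ^ 2) ≤
      ENNReal.ofReal c * ENNReal.ofReal (1 + τ⁻¹) * (ENNReal.ofReal (δ ^ 2))⁻¹ *
        (ENNReal.ofReal (r ^ 2))⁻¹ := by
    rw [← ENNReal.ofReal_inv_of_pos (by positivity), ← ENNReal.ofReal_inv_of_pos (by positivity),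
      ← ENNReal.ofReal_mul hc0.le, ← ENNReal.ofReal_mul (by positivity),
      ← ENNReal.ofReal_mul (by positivity)]
    refine ENNReal.ofReal_le_ofReal ?_
    have e1 : 2 / (δ * τ * r ^ 2) + (2 * k + 2 / k) * (4 * transitionBound / (δ * r)) ^ 2 =
        (2 * δ * τ⁻¹ + (2 * k + 2 / k) * (16 * transitionBound ^ 2)) * (δ ^ 2)⁻¹ *
          (r ^ 2)⁻¹ := by field_simp; ring
    rw [e1]
    refine mul_le_mul_of_nonneg_right (mul_le_mul_of_nonneg_right ?_ (by positivity))
      (by positivity)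
    have h2 : 0 ≤ (2 * k + 2 / k) * (16 * transitionBound ^ 2) := by positivity
    have h3 : 0 < τ⁻¹ := by positivity
    have h4 := mul_le_mul_of_nonneg_right hδ1 h3.le
    have h5 := mul_nonneg h2 h3.le
    rw [hcdef]; nlinarith
  have hR0 : ENNReal.ofReal (r ^ 2) ≠ 0 := by simp; positivity
  have hRt : ENNReal.ofReal (r ^ 2) ≠ ∞ := ENNReal.ofReal_ne_top
  have hbase : moserBase d p q lam Lam τ (Metric.ball z r) δ ^ (ν - 1) =
      ENNReal.ofReal τ ^ (ν - 1) * ENNReal.ofReal (1 + τ⁻¹) ^ ν *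
        ((max 1 X) ^ ν * (ENNReal.ofReal (δ ^ 2))⁻¹ ^ ν) := by
    have hne : ν - 1 ≠ 0 := by linarith
    rw [moserBase, ENNReal.mul_rpow_of_nonneg _ _ hν1, ← ENNReal.rpow_mul, ← hνdef,
      div_mul_cancel₀ _ hne, div_eq_mul_inv (max 1 _), ENNReal.mul_rpow_of_nonneg _ _ hν0,
      ENNReal.ofReal_mul hτ.le, ENNReal.mul_rpow_of_nonneg _ _ hν1,
      ← ENNReal.ofReal_rpow_of_pos hτ1, ← ENNReal.rpow_mul, div_mul_cancel₀ _ hne]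
  -- The Sobolev constant enters linearly; truncating it at `1` allows the power `ν` that makes it
  -- part of `moserBase ^ (ν - 1)`.
  have hX : X ≤ max 1 X ^ ν := (le_max_right 1 X).trans
    (by simpa using ENNReal.rpow_le_rpow_of_exponent_le (le_max_left 1 X) hν.le)
  have hRcancel : ENNReal.ofReal (r ^ 2) ^ (ν - 1) * (ENNReal.ofReal (r ^ 2))⁻¹ ^ ν *
      ENNReal.ofReal (r ^ 2) = 1 := by
    nth_rw 3 [← ENNReal.rpow_one (ENNReal.ofReal (r ^ 2))]
    rw [mul_right_comm, ← ENNReal.rpow_add _ _ hR0 hRt, sub_add_cancel, ENNReal.inv_rpow]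
    exact ENNReal.mul_inv_cancel (by simp [ENNReal.rpow_eq_zero_iff, hR0, hRt])
      (ENNReal.rpow_ne_top_of_nonneg hν0 hRt)
  have hVV : V ^ (ν - 1) * V ^ ((q⁻¹).toReal + (p⁻¹).toReal * codim d p q) =
      ENNReal.ofReal (r ^ 2) * volume (Metric.ball (0 : Rd d) 1) ^ (2 / (d : ℝ)) := by
    rw [← ENNReal.rpow_add_of_nonneg _ _ hν1 (by positivity), add_comm (ν - 1), hν2,
      volume_ball_rpow hA.two_le z hr]
  rw [hbase, ballSobolevConst_eq hA z hr, stepConst, ← hνdef, ← hcdef]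
  calc _ ≤ (ENNReal.ofReal (τ * r ^ 2) * V) ^ (ν - 1) *
      ((ENNReal.ofReal c * ENNReal.ofReal (1 + τ⁻¹) * (ENNReal.ofReal (δ ^ 2))⁻¹ *
        (ENNReal.ofReal (r ^ 2))⁻¹) ^ ν *
        (2 * (gnsConst d q : ℝ≥0∞) ^ (2 : ℝ) *
      (V ^ ((q⁻¹).toReal + (p⁻¹).toReal * codim d p q) * max 1 X ^ ν) *
        ENNReal.ofReal (1 / k))) := by gcongr
    _ = ENNReal.ofReal c ^ ν * (2 * (gnsConst d q : ℝ≥0∞) ^ (2 : ℝ) * ENNReal.ofReal (1 / k)) *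
        (ENNReal.ofReal τ ^ (ν - 1) * ENNReal.ofReal (1 + τ⁻¹) ^ ν *
        ((max 1 X) ^ ν * (ENNReal.ofReal (δ ^ 2))⁻¹ ^ ν)) *
        (ENNReal.ofReal (r ^ 2) ^ (ν - 1) * (ENNReal.ofReal (r ^ 2))⁻¹ ^ ν *
        (V ^ (ν - 1) * V ^ ((q⁻¹).toReal + (p⁻¹).toReal * codim d p q))) := by
        rw [ENNReal.ofReal_mul hτ.le, ENNReal.mul_rpow_of_nonneg _ _ hν1,
          ENNReal.mul_rpow_of_nonneg _ _ hν1, ENNReal.mul_rpow_of_nonneg _ _ hν0,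
          ENNReal.mul_rpow_of_nonneg _ _ hν0, ENNReal.mul_rpow_of_nonneg _ _ hν0]
        ring
    _ = _ := by
        rw [hVV, ← mul_assoc (ENNReal.ofReal (r ^ 2) ^ (ν - 1) * _), hRcancel]
        ring

theorem normQ'_eq (ha : IsCoefficient p q a lam Lam) (γ τ : ℝ) (z : Rd d) (s r : ℝ) {σ : ℝ}
    (hσ : 0 < σ) (u : ℝ → Rd d → ℝ) :
    normQ' Lam γ τ z s r σ u =
      ((ENNReal.ofReal (σ ^ (d + 1)) * (ENNReal.ofReal (τ * r ^ 2) *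
        volume (Metric.ball z r)))⁻¹ *
        ∫⁻ t in Ioo (s - τ * r ^ 2) (s - (1 - σ) * τ * r ^ 2), ∫⁻ x in Metric.ball z (σ * r),
          ‖u t x‖ₑ ^ γ ∂(weightedMeasure Lam)) ^ (1 / γ) := by
  have h1 : volume (Ioo (s - τ * r ^ 2) (s - (1 - σ) * τ * r ^ 2)) =
      ENNReal.ofReal σ * ENNReal.ofReal (τ * r ^ 2) := by
    rw [Real.volume_Ioo, ← ENNReal.ofReal_mul hσ.le]; congr 1; ring
  have h2 : ENNReal.ofReal (σ ^ (d + 1)) * (ENNReal.ofReal (τ * r ^ 2) *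
        volume (Metric.ball z r)) = (ENNReal.ofReal σ * ENNReal.ofReal (τ * r ^ 2)) *
        (ENNReal.ofReal (σ ^ d) * volume (Metric.ball z r)) := by
    rw [pow_succ, ENNReal.ofReal_mul (by positivity)]; ring
  have h3 := ENNReal.mul_inv (a := ENNReal.ofReal σ * ENNReal.ofReal (τ * r ^ 2))
    (b := ENNReal.ofReal (σ ^ d) * volume (Metric.ball z r))
    (Or.inr (ENNReal.mul_ne_top ENNReal.ofReal_ne_top (volume_ball_ne_top z r)))
    (Or.inl (ENNReal.mul_ne_top ENNReal.ofReal_ne_top ENNReal.ofReal_ne_top))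
  rw [normQ', avgNormQ, h1, volume_ball_mul z hσ, h2, h3]
  simp only [ha.setLIntegral_weightedMeasure measurableSet_ball]

theorem stepConst_ne_top (hA : Admissible d p q) (k : ℝ) : stepConst d p q k ≠ ∞ := by
  have hν := hA.one_lt_nu
  refine ENNReal.mul_ne_top (ENNReal.rpow_ne_top_of_nonneg (by linarith) ENNReal.ofReal_ne_top)
    (ENNReal.mul_ne_top (ENNReal.mul_ne_top (ENNReal.mul_ne_top (by simp) ?_) ?_)
      ENNReal.ofReal_ne_top)
  · exact ENNReal.rpow_ne_top_of_nonneg zero_le_two ENNReal.coe_ne_top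
  · exact ENNReal.rpow_ne_top_of_nonneg (by positivity) (volume_ball_ne_top _ _)

/-- One step of the iteration: the gain of integrability from `β` to `γ ≤ ν β`. -/
theorem moser_step (ha : IsCoefficient p q a lam Lam) (hA : Admissible d p q)
    {α₀ : ℝ} (hα₀ : α₀ < nu d p q) {τ : ℝ} {z : Rd d} {s r : ℝ} (hτ : 0 < τ)
    (hr : 0 < r) {u : ℝ → Rd d → ℝ}
    (hu : IsSupercaloric a Lam (Ioo (s - τ * r ^ 2) s) (Metric.ball z r) u)
    (hpos : ∀ t ∈ Ioo (s - τ * r ^ 2) s, ∀ᵐ x, x ∈ Metric.ball z r → 0 < u t x)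
    {σ' σ : ℝ} (hσ' : 1 / 2 ≤ σ') (hσσ : σ' < σ) (hσ : σ ≤ 1) {β γ : ℝ} (hβ : 0 < β)
    (hβγ : β ≤ γ) (hγ : γ ≤ nu d p q * β) (hβα : β * nu d p q ≤ α₀) :
    normQ' Lam γ τ z s r σ' u ≤
      (2 ^ (d + 1) * max 1 (stepConst d p q (1 - α₀ / nu d p q))) ^ (1 / γ) *
        moserBase d p q lam Lam τ (Metric.ball z r) (σ - σ') ^ (1 / β - 1 / γ) *
        normQ' Lam β τ z s r σ u := by
  have hν := hA.one_lt_nu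
  have hν0 : 0 < nu d p q := by linarith
  have hγ0 : 0 < γ := hβ.trans_le hβγ
  -- This `k` serves every step: `β ≤ α₀/ν = 1 - k` gives `(1 + k) β ≤ 1 - k² ≤ 1`. It is positive
  -- exactly because `α₀ < ν`.
  set k := 1 - α₀ / nu d p q with hk
  have hk0 : 0 < k := by rw [hk, sub_pos, div_lt_one hν0]; exact hα₀
  have hβk : β ≤ 1 - k := by rw [hk, sub_sub_cancel, le_div_iff₀ hν0]; exact hβα
  have hkβ : k * β ≤ 1 - β := by nlinarith
  -- Chosen so that `β (1 + (ν - 1) b) = γ`.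
  set b := (γ / β - 1) / (nu d p q - 1) with hb
  have hθ1 : 1 ≤ γ / β := (one_le_div hβ).2 hβγ
  have hb0 : 0 ≤ b := div_nonneg (by linarith) (by linarith)
  have hb1 : b ≤ 1 := by
    rw [hb, div_le_one (by linarith)]
    have : γ / β ≤ nu d p q := (div_le_iff₀ hβ).2 hγ
    linarith
  have hθ : 1 + (nu d p q - 1) * b = γ / β := by
    rw [hb, mul_div_cancel₀ _ (by linarith : nu d p q - 1 ≠ 0)]; ring
  have hσ0 : 0 < σ := by linarith
  have hσ'0 : 0 < σ' := by linarith
  have hτr : 0 < τ * r ^ 2 := by positivity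
  set T := s - (1 - σ') * τ * r ^ 2 with hT
  set T' := s - (1 - σ) * τ * r ^ 2 with hT'
  have hstep := hu.moser_step_lintegral ha hA hpos hβ hk0 hkβ (ρ₁ := σ' * r) (ρ₂ := σ * r)
    (by positivity) (by gcongr) (by nlinarith) (T := T) (T' := T')
    (by rw [hT]; nlinarith) (by rw [hT, hT']; nlinarith) (by rw [hT']; nlinarith) hb0 hb1
  rw [hθ, mul_div_cancel₀ _ hβ.ne', show T' - T = (σ - σ') * τ * r ^ 2 by rw [hT, hT']; ring,
    ← sub_mul] at hstep
  have hconst := volume_mul_const_le (lam := lam) (Lam := Lam) hA z hr hτ (sub_pos.2 hσσ)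
    (by linarith : σ - σ' ≤ 1) hk0
  rw [normQ'_eq ha γ τ z s r hσ'0, normQ'_eq ha β τ z s r hσ0, ← hT, ← hT']
  set Q := ENNReal.ofReal (2 / ((σ - σ') * τ * r ^ 2) +
    (2 * k + 2 / k) * (4 * transitionBound / ((σ - σ') * r)) ^ 2) ^ nu d p q *
    (ballSobolevConst p q lam Lam (Metric.ball z r) * ENNReal.ofReal (1 / k))
  set V := ENNReal.ofReal (τ * r ^ 2) * volume (Metric.ball z r) with hV
  set Xβ := ∫⁻ t in Ioo (s - τ * r ^ 2) T', ∫⁻ x in Metric.ball z (σ * r), ‖u t x‖ₑ ^ β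
    ∂(weightedMeasure Lam)
  set Xγ := ∫⁻ t in Ioo (s - τ * r ^ 2) T, ∫⁻ x in Metric.ball z (σ' * r), ‖u t x‖ₑ ^ γ
    ∂(weightedMeasure Lam)
  set Θ := moserBase d p q lam Lam τ (Metric.ball z r) (σ - σ')
  set c := stepConst d p q k
  have hV0 : V ≠ 0 := mul_ne_zero (by simpa using hτr) (volume_ball_ne_zero z hr)
  have hVt : V ≠ ∞ := ENNReal.mul_ne_top ENNReal.ofReal_ne_top (volume_ball_ne_top z r)
  set nβ := (ENNReal.ofReal (σ ^ (d + 1)) * V)⁻¹ * Xβ with hnβ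
  have hXβ : Xβ ≤ V * nβ := by
    have hs0 : ENNReal.ofReal (σ ^ (d + 1)) ≠ 0 := by simp; positivity
    have h1 : Xβ = ENNReal.ofReal (σ ^ (d + 1)) * V * nβ := by
      rw [hnβ, ← mul_assoc, ENNReal.mul_inv_cancel (mul_ne_zero hs0 hV0)
        (ENNReal.mul_ne_top ENNReal.ofReal_ne_top hVt), one_mul]
    rw [h1]
    gcongr
    refine mul_le_of_le_one_left zero_le ?_
    rw [← ENNReal.ofReal_one]
    exact ENNReal.ofReal_le_ofReal (pow_le_one₀ hσ0.le hσ)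
  -- The lower bound `σ' ≥ 1/2` keeps the normalising volume of the smaller cylinder comparable to
  -- that of the full one.
  have hinv : (ENNReal.ofReal (σ' ^ (d + 1)) * V)⁻¹ ≤ 2 ^ (d + 1) * V⁻¹ := by
    rw [ENNReal.mul_inv (Or.inr hVt) (Or.inl ENNReal.ofReal_ne_top)]
    gcongr
    rw [ENNReal.inv_le_iff_inv_le, ENNReal.inv_pow, ENNReal.ofReal_pow hσ'0.le]
    refine pow_le_pow_left' ?_ _
    rw [← ENNReal.ofReal_ofNat, ← ENNReal.ofReal_inv_of_pos two_pos]
    exact ENNReal.ofReal_le_ofReal (by linarith)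
  have hVpow : V⁻¹ * V ^ (γ / β) = (V ^ (nu d p q - 1)) ^ b := by
    rw [← ENNReal.rpow_neg_one, ← ENNReal.rpow_add _ _ hV0 hVt, ← ENNReal.rpow_mul, ← hθ]
    congr 1; ring
  have hmain : (ENNReal.ofReal (σ' ^ (d + 1)) * V)⁻¹ * Xγ ≤
      2 ^ (d + 1) * max 1 c * Θ ^ ((nu d p q - 1) * b) * nβ ^ (γ / β) := by
    calc (ENNReal.ofReal (σ' ^ (d + 1)) * V)⁻¹ * Xγ
        ≤ (2 ^ (d + 1) * V⁻¹) * (Q ^ b * (V * nβ) ^ (γ / β)) := by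
          gcongr
          exact hstep.trans (by gcongr)
      _ = 2 ^ (d + 1) * (V ^ (nu d p q - 1) * Q) ^ b * nβ ^ (γ / β) := by
          rw [ENNReal.mul_rpow_of_nonneg V nβ (by positivity),
            ENNReal.mul_rpow_of_nonneg (V ^ (nu d p q - 1)) Q hb0, ← hVpow]
          ring
      _ ≤ 2 ^ (d + 1) * (c * Θ ^ (nu d p q - 1)) ^ b * nβ ^ (γ / β) := by gcongr
      _ ≤ _ := by
          rw [ENNReal.mul_rpow_of_nonneg _ _ hb0, ← ENNReal.rpow_mul, ← mul_assoc]
          gcongr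
          calc c ^ b ≤ max 1 c ^ b := by gcongr; exact le_max_right _ _
            _ ≤ max 1 c ^ (1 : ℝ) :=
              ENNReal.rpow_le_rpow_of_exponent_le (le_max_left _ _) hb1
            _ = max 1 c := ENNReal.rpow_one _
  have hγi : 0 ≤ 1 / γ := by positivity
  refine (ENNReal.rpow_le_rpow hmain hγi).trans (le_of_eq ?_)
  rw [ENNReal.mul_rpow_of_nonneg _ _ hγi, ENNReal.mul_rpow_of_nonneg _ _ hγi, ← ENNReal.rpow_mul,
    ← ENNReal.rpow_mul, show (nu d p q - 1) * b * (1 / γ) = 1 / β - 1 / γ by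
      rw [show (nu d p q - 1) * b = γ / β - 1 by linarith]; field_simp,
    show γ / β * (1 / γ) = 1 / β by field_simp]

/-! ### Iteration -/

/-- Induction on the number of steps, peeling off the lowest exponent; each peeled step uses half of
the remaining gap. The powers of `Θ` telescope exactly, so only `c` and `c'` have to be absorbed. -/
theorem moser_iteration {ν α₀ : ℝ} (hν : 1 < ν) (hα₀ : 0 < α₀) {N : ℝ → ℝ → ℝ≥0∞}
    {Θ : ℝ → ℝ≥0∞} {c c' : ℝ≥0∞} (hc : 1 ≤ c) (hc' : 1 ≤ c')
    (hΘ : ∀ δ, 0 < δ → Θ (δ / 2) ≤ c' * Θ δ)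
    (hstep : ∀ {σ' σ β γ : ℝ}, 1 / 2 ≤ σ' → σ' < σ → σ ≤ 1 → 0 < β → β ≤ γ → γ ≤ ν * β →
      β * ν ≤ α₀ → N γ σ' ≤ c ^ (1 / γ) * Θ (σ - σ') ^ (1 / β - 1 / γ) * N β σ)
    (n : ℕ) : ∀ {α σ' σ : ℝ}, α₀ / ν ^ (n + 2) ≤ α → 0 < α → α < α₀ / ν → 1 / 2 ≤ σ' →
      σ' < σ → σ ≤ 1 →
      N α₀ σ' ≤ ((c * c') ^ ((1 + ν) / (ν - 1)) * Θ (σ - σ')) ^ (1 / α - 1 / α₀) * N α σ := by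
  have hν0 : 0 < ν := by linarith
  have hν1 : 0 < ν - 1 := by linarith
  -- With `w = 1/α - 1/(να)`, this makes `E w = (1 + ν)/(να)`, which exceeds both the power `1/(να)`
  -- of `c` and the power of `c'`, at most `1/α`. At the top, `E (ν - 1)/α₀ = (1 + ν)/α₀` is the
  -- power of `c` from the last two steps.
  set E := (1 + ν) / (ν - 1) with hE
  have hE0 : 0 < E := by positivity
  have hE1 : 1 ≤ E := by rw [hE, le_div_iff₀ hν1]; linarith
  -- The top of the iteration: a step of ratio at most `ν` up to `α₀/ν`, then a full step to `α₀`.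
  have hmid : ∀ {α σ' σ : ℝ}, α₀ / ν ^ 2 ≤ α → 0 < α → α < α₀ / ν → 1 / 2 ≤ σ' →
      σ' < σ → σ ≤ 1 →
      N α₀ σ' ≤ ((c * c') ^ E * Θ (σ - σ')) ^ (1 / α - 1 / α₀) * N α σ := by
    intro α σ' σ h1 hα h2 hσ' hσσ hσ
    have hαν : α * ν < α₀ := (lt_div_iff₀ hν0).1 h2
    have hα2 : α₀ / ν ≤ ν * α := by
      rw [div_le_iff₀ (by positivity)] at h1 ⊢; nlinarith
    have s1 := hstep (σ' := σ') (σ := (σ' + σ) / 2) (β := α₀ / ν) (γ := α₀) hσ' (by linarith)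
      (by linarith) (by positivity) (div_le_self hα₀.le hν.le)
      (by rw [mul_div_cancel₀ _ hν0.ne']) (by rw [div_mul_cancel₀ _ hν0.ne'])
    have s2 := hstep (σ' := (σ' + σ) / 2) (σ := σ) (β := α) (γ := α₀ / ν) (by linarith)
      (by linarith) hσ hα h2.le hα2 hαν.le
    rw [show (σ' + σ) / 2 - σ' = (σ - σ') / 2 by ring] at s1
    rw [show σ - (σ' + σ) / 2 = (σ - σ') / 2 by ring] at s2
    rw [one_div_div] at s1 s2
    set X := 1 / α - 1 / α₀ with hX
    have h3 : ν / α₀ ≤ 1 / α := by rw [div_le_div_iff₀ hα₀ hα]; linarith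
    have hXle : (ν - 1) / α₀ ≤ X := by rw [hX, sub_div]; linarith
    have hX0 : 0 ≤ X := le_trans (by positivity) hXle
    have hEX : 1 / α₀ + ν / α₀ ≤ E * X := by
      calc 1 / α₀ + ν / α₀ = E * ((ν - 1) / α₀) := by rw [hE]; field_simp
        _ ≤ E * X := by gcongr
    calc N α₀ σ' ≤ c ^ (1 / α₀) * Θ ((σ - σ') / 2) ^ (ν / α₀ - 1 / α₀) *
          (c ^ (ν / α₀) * Θ ((σ - σ') / 2) ^ (1 / α - ν / α₀) * N α σ) :=
          s1.trans (by gcongr)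
      _ = c ^ (1 / α₀ + ν / α₀) * Θ ((σ - σ') / 2) ^ X * N α σ := by
          rw [ENNReal.rpow_add_of_nonneg _ _ (by positivity) (by positivity),
            show X = (ν / α₀ - 1 / α₀) + (1 / α - ν / α₀) by rw [hX]; ring,
            ENNReal.rpow_add_of_nonneg _ _ (by rw [← sub_div]; positivity) (by linarith)]
          ring
      _ ≤ c ^ (E * X) * (c' ^ E * Θ (σ - σ')) ^ X * N α σ := by
          gcongr
          refine (hΘ _ (by linarith)).trans ?_
          gcongr
          simpa using ENNReal.rpow_le_rpow_of_exponent_le hc' hE1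
      _ = _ := by
          rw [ENNReal.rpow_mul, ← ENNReal.mul_rpow_of_nonneg _ _ hX0, ← mul_assoc,
            ← ENNReal.mul_rpow_of_nonneg _ _ hE0.le]
  induction n with
  | zero =>
    intro α σ' σ h1 hα h2 hσ' hσσ hσ
    exact hmid (by simpa using h1) hα h2 hσ' hσσ hσ
  | succ n ih =>
    intro α σ' σ h1 hα h2 hσ' hσσ hσ
    rcases le_or_gt (α₀ / ν ^ 2) α with h | h
    · exact hmid h hα h2 hσ' hσσ hσ
    have hνα : 0 < ν * α := by positivity
    have s1 := ih (α := ν * α) (σ' := σ') (σ := (σ' + σ) / 2)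
      (by
        rw [div_le_iff₀ (by positivity)] at h1 ⊢
        calc α₀ ≤ α * ν ^ (n + 1 + 2) := h1
          _ = ν * α * ν ^ (n + 2) := by ring) hνα
      (by rw [lt_div_iff₀ (by positivity)] at h ⊢; nlinarith) hσ' (by linarith) (by linarith)
    have s2 := hstep (σ' := (σ' + σ) / 2) (σ := σ) (β := α) (γ := ν * α) (by linarith)
      (by linarith) hσ hα (by nlinarith) le_rfl ((lt_div_iff₀ hν0).1 h2).le
    rw [show (σ' + σ) / 2 - σ' = (σ - σ') / 2 by ring] at s1
    rw [show σ - (σ' + σ) / 2 = (σ - σ') / 2 by ring] at s2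
    set X' := 1 / (ν * α) - 1 / α₀ with hX'
    set w := 1 / α - 1 / (ν * α) with hw
    have hX : 1 / α - 1 / α₀ = X' + w := by rw [hX', hw]; ring
    have hwe : w = (ν - 1) / (ν * α) := by rw [hw]; field_simp
    have hw0 : 0 ≤ w := by rw [hwe]; positivity
    have hEw : E * w = (1 + ν) / (ν * α) := by rw [hwe, hE]; field_simp
    have hX'0 : 0 ≤ X' := by
      have h3 := (lt_div_iff₀ hν0).1 h2
      rw [hX', sub_nonneg]
      exact one_div_le_one_div_of_le hνα (by linarith)
    have e1 : 1 / (ν * α) ≤ E * w := by rw [hEw]; gcongr; linarith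
    have e2 : X' + w ≤ E * w := by
      rw [hEw, ← hX]
      have h4 : 1 / α = ν / (ν * α) := by field_simp
      have h5 : ν / (ν * α) ≤ (1 + ν) / (ν * α) := by gcongr; linarith
      have h6 : 0 < 1 / α₀ := by positivity
      linarith
    rw [hX]
    calc N α₀ σ' ≤ ((c * c') ^ E * Θ ((σ - σ') / 2)) ^ X' *
          (c ^ (1 / (ν * α)) * Θ ((σ - σ') / 2) ^ w * N α σ) := s1.trans (by gcongr)
      _ = ((c * c') ^ E) ^ X' * c ^ (1 / (ν * α)) * Θ ((σ - σ') / 2) ^ (X' + w) * N α σ := by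
          rw [ENNReal.mul_rpow_of_nonneg _ _ hX'0, ENNReal.rpow_add_of_nonneg _ _ hX'0 hw0]
          ring
      _ ≤ ((c * c') ^ E) ^ X' * c ^ (1 / (ν * α)) * (c' * Θ (σ - σ')) ^ (X' + w) * N α σ := by
          gcongr
          exact hΘ _ (by linarith)
      _ = ((c * c') ^ E) ^ X' * (c ^ (1 / (ν * α)) * c' ^ (X' + w)) *
          Θ (σ - σ') ^ (X' + w) * N α σ := by
          rw [ENNReal.mul_rpow_of_nonneg c' (Θ (σ - σ')) (by linarith)]; ring
      _ ≤ ((c * c') ^ E) ^ X' * (c ^ (E * w) * c' ^ (E * w)) *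
          Θ (σ - σ') ^ (X' + w) * N α σ := by
          gcongr
      _ = _ := by
          rw [← ENNReal.mul_rpow_of_nonneg _ _ (by positivity), ENNReal.rpow_mul,
            ← ENNReal.rpow_add_of_nonneg _ _ hX'0 hw0,
            ← ENNReal.mul_rpow_of_nonneg _ _ (by linarith)]

/-! ### Properties of the base and conclusion -/

theorem moserBase_half (hA : Admissible d p q) (τ : ℝ) (B : Set (Rd d)) (δ : ℝ) :
    moserBase d p q lam Lam τ B (δ / 2) ≤
      4 ^ (nu d p q / (nu d p q - 1)) * moserBase d p q lam Lam τ B δ := by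
  have hν := hA.one_lt_nu
  have he : 0 ≤ nu d p q / (nu d p q - 1) := div_nonneg (by linarith) (by linarith)
  have h1 : ENNReal.ofReal ((δ / 2) ^ 2) = 4⁻¹ * ENNReal.ofReal (δ ^ 2) := by
    rw [show (δ / 2) ^ 2 = 4⁻¹ * δ ^ 2 by ring, ENNReal.ofReal_mul (by norm_num),
      ENNReal.ofReal_inv_of_pos (by norm_num), ENNReal.ofReal_ofNat]
  rw [moserBase, moserBase, h1, div_eq_mul_inv (max 1 _), ENNReal.mul_inv (by simp) (by simp), inv_inv,
    mul_left_comm (max 1 _), ENNReal.mul_rpow_of_nonneg _ _ he, div_eq_mul_inv (max 1 _)]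
  exact le_of_eq (by ring)

/-- As `ν/(ν - 1) ≥ 1`, the time factor is at least `τ (1 + τ⁻¹) = τ + 1`; the other factor is at
least `1` because `δ ≤ 1`. This is what allows the exponent to be enlarged at the end. -/
theorem one_le_moserBase (hA : Admissible d p q) {τ : ℝ} (hτ : 0 < τ) (B : Set (Rd d)) {δ : ℝ}
    (hδ0 : 0 ≤ δ) (hδ : δ ≤ 1) : 1 ≤ moserBase d p q lam Lam τ B δ := by
  have hν := hA.one_lt_nu
  have he : 1 ≤ nu d p q / (nu d p q - 1) := by rw [le_div_iff₀ (by linarith)]; linarith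
  refine one_le_mul ?_ ?_
  · rw [← ENNReal.ofReal_one]
    refine ENNReal.ofReal_le_ofReal ?_
    have h1 : 1 ≤ 1 + τ⁻¹ := by have : 0 < τ⁻¹ := by positivity
                                linarith
    have h2 := Real.rpow_le_rpow_of_exponent_le h1 he
    rw [Real.rpow_one] at h2
    calc (1 : ℝ) ≤ τ * (1 + τ⁻¹) := by rw [mul_add, mul_inv_cancel₀ hτ.ne']; linarith
      _ ≤ _ := by gcongr
  · refine ENNReal.one_le_rpow ?_ (by linarith)
    rw [ENNReal.le_div_iff_mul_le (Or.inr (by simp)) (Or.inl ENNReal.ofReal_ne_top), one_mul]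
    refine le_trans ?_ (le_max_left _ _)
    rw [← ENNReal.ofReal_one]
    exact ENNReal.ofReal_le_ofReal (pow_le_one₀ hδ0 hδ)

/-- The mean value inequality for positive supercaloric functions. -/
theorem normQ'_le_of_isSupercaloric {d : ℕ} {p q : ℝ≥0∞} (hA : Admissible d p q)
    (α₀ : ℝ) (hα₀ : 0 < α₀) (hα₀ν : α₀ < nu d p q) :
    ∃ C₅ : ℝ, 0 < C₅ ∧
      ∀ (a : Rd d → Matrix (Fin d) (Fin d) ℝ) (lam Lam : Rd d → ℝ),
        IsCoefficient p q a lam Lam →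
      ∀ (τ : ℝ) (x : Rd d) (s r σ' σ : ℝ), 0 < τ → 0 < r →
        1 / 2 ≤ σ' → σ' < σ → σ ≤ 1 →
      ∀ u : ℝ → Rd d → ℝ,
        IsSupercaloric a Lam (Ioo (s - τ * r ^ 2) s) (Metric.ball x r) u →
        (∀ t ∈ Ioo (s - τ * r ^ 2) s, ∀ᵐ z, z ∈ Metric.ball x r → 0 < u t z) →
      ∀ α : ℝ, 0 < α → α < α₀ / nu d p q →
        normQ' Lam α₀ τ x s r σ' u ≤
          (ENNReal.ofReal
              (C₅ * τ * (1 + τ⁻¹) ^ (nu d p q / (nu d p q - 1))) *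
            (max 1 (sobolevConst p q lam Lam (Metric.ball x r)) /
                ENNReal.ofReal ((σ - σ') ^ 2)) ^
              (nu d p q / (nu d p q - 1))) ^
            ((1 + nu d p q) * (1 / α - 1 / α₀)) *
          normQ' Lam α τ x s r σ u := by
  have hν := hA.one_lt_nu
  have hν0 : 0 < nu d p q := by linarith
  have hE : 0 ≤ (1 + nu d p q) / (nu d p q - 1) := div_nonneg (by linarith) (by linarith)
  have he : 0 ≤ nu d p q / (nu d p q - 1) := div_nonneg hν0.le (by linarith)
  set c : ℝ≥0∞ := 2 ^ (d + 1) * max 1 (stepConst d p q (1 - α₀ / nu d p q)) with hc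
  set c' : ℝ≥0∞ := 4 ^ (nu d p q / (nu d p q - 1)) with hc'
  have hc1 : 1 ≤ c := one_le_mul (one_le_pow₀ (by norm_num)) (le_max_left _ _)
  have hc'1 : 1 ≤ c' := by
    have := ENNReal.rpow_le_rpow (by norm_num : (1 : ℝ≥0∞) ≤ 4) he
    rwa [ENNReal.one_rpow] at this
  have hct : c ≠ ∞ := ENNReal.mul_ne_top (by simp)
    (max_lt (by simp) (stepConst_ne_top hA _).lt_top).ne
  have hc't : c' ≠ ∞ := ENNReal.rpow_ne_top_of_nonneg he (by simp)
  set D : ℝ≥0∞ := (c * c') ^ ((1 + nu d p q) / (nu d p q - 1)) with hD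
  have hD1 : 1 ≤ D := by
    have := ENNReal.rpow_le_rpow (one_le_mul hc1 hc'1) hE
    rwa [ENNReal.one_rpow] at this
  have hDt : D ≠ ∞ := ENNReal.rpow_ne_top_of_nonneg hE (ENNReal.mul_ne_top hct hc't)
  have hD0 : 0 < D.toReal := ENNReal.toReal_pos (by positivity) hDt
  refine ⟨D.toReal, hD0, ?_⟩
  intro a lam Lam ha τ x s r σ' σ hτ hr hσ' hσσ hσ u hu hpos α hα hαν
  -- The number of steps depends on `α`, but the constant `D` does not.
  obtain ⟨n, hn⟩ := pow_unbounded_of_one_lt (α₀ / α) hν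
  have hn2 : α₀ / nu d p q ^ (n + 2) ≤ α := by
    rw [div_le_iff₀ (by positivity)]
    rw [div_lt_iff₀ hα] at hn
    have h1 : nu d p q ^ n ≤ nu d p q ^ (n + 2) := pow_le_pow_right₀ hν.le (by omega)
    nlinarith
  have key := moser_iteration hν hα₀ (N := fun γ σ => normQ' Lam γ τ x s r σ u)
    (Θ := moserBase d p q lam Lam τ (Metric.ball x r)) hc1 hc'1
    (fun δ _ => moserBase_half hA τ _ δ)
    (fun h1 h2 h3 h4 h5 h6 h7 => moser_step ha hA hα₀ν hτ hr hu hpos h1 h2 h3 h4 h5 h6 h7)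
    n hn2 hα hαν hσ' hσσ hσ
  have hX : 0 ≤ 1 / α - 1 / α₀ := by
    rw [sub_nonneg]
    refine one_div_le_one_div_of_le hα ?_
    exact hαν.le.trans (div_le_self hα₀.le hν.le)
  have hbase : ENNReal.ofReal (D.toReal * τ * (1 + τ⁻¹) ^ (nu d p q / (nu d p q - 1))) *
      (max 1 (sobolevConst p q lam Lam (Metric.ball x r)) / ENNReal.ofReal ((σ - σ') ^ 2)) ^
        (nu d p q / (nu d p q - 1)) =
      D * moserBase d p q lam Lam τ (Metric.ball x r) (σ - σ') := by
    rw [mul_assoc D.toReal, ENNReal.ofReal_mul hD0.le, ENNReal.ofReal_toReal hDt, moserBase,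
      mul_assoc]
  rw [hbase]
  refine key.trans ?_
  -- The iteration gives the exponent `1/α - 1/α₀`; since the base is at least `1`, the factor `1 +
  -- ν` only weakens the bound.
  gcongr
  · exact one_le_mul hD1 (one_le_moserBase hA hτ _ (by linarith) (by linarith))
  · exact le_mul_of_one_le_left hX (by linarith)

end CaloricModel

end

theorem mainTheorem8 (d : ℕ) (hd : 2 ≤ d) (p q : ℝ≥0∞) (hp : 1 ≤ p) (hq : 1 ≤ q)
    (hpq : p⁻¹ + q⁻¹ < 2 / (d : ℝ≥0∞)) (hdq : d = 2 → q ≠ ∞)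
    (α₀ : ℝ) (hα₀ : 0 < α₀) (hα₀ν : α₀ < CaloricModel.nu d p q) :
    ∃ C₅ : ℝ, 0 < C₅ ∧
      ∀ (a : CaloricModel.Rd d → Matrix (Fin d) (Fin d) ℝ) (lam Lam : CaloricModel.Rd d → ℝ),
        CaloricModel.IsCoefficient p q a lam Lam →
      ∀ (τ : ℝ) (x : CaloricModel.Rd d) (s r σ' σ : ℝ), 0 < τ → 0 < r →
        1 / 2 ≤ σ' → σ' < σ → σ ≤ 1 →
      ∀ u : ℝ → CaloricModel.Rd d → ℝ,
        CaloricModel.IsSupercaloric a Lam (Ioo (s - τ * r ^ 2) s) (Metric.ball x r) u →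
        (∀ t ∈ Ioo (s - τ * r ^ 2) s, ∀ᵐ z, z ∈ Metric.ball x r → 0 < u t z) →
      ∀ α : ℝ, 0 < α → α < α₀ / CaloricModel.nu d p q →
        CaloricModel.normQ' Lam α₀ τ x s r σ' u ≤
          (ENNReal.ofReal
              (C₅ * τ * (1 + τ⁻¹) ^ (CaloricModel.nu d p q / (CaloricModel.nu d p q - 1))) *
            (max 1 (CaloricModel.sobolevConst p q lam Lam (Metric.ball x r)) /
                ENNReal.ofReal ((σ - σ') ^ 2)) ^
              (CaloricModel.nu d p q / (CaloricModel.nu d p q - 1))) ^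
            ((1 + CaloricModel.nu d p q) * (1 / α - 1 / α₀)) *
          CaloricModel.normQ' Lam α τ x s r σ u := by
  exact CaloricModel.normQ'_le_of_isSupercaloric ⟨hd, hp, hq, hpq, hdq⟩ α₀ hα₀ hα₀ν
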